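/- An instance of the Stackelberg minimum spanning tree problem is a finite undirected graph $G=(V,E)$, with loops and parallel edges allowed, whose edge set is partitioned into red edges $R$ and blue edges $B$, where $(V,R)$ is connected and each red edge $e$ has a positive rational cost $c(e)$. Let $c_1<c_2<\dots<c_k$ be the distinct red costs, put $c_0=0$, and let $R_j$ be the set of red edges of cost at most $c_j$. The LP relaxation of the problem has the variables $x_{j,e}$ ($1\le j\le k$, $e\in B$), the objective $\max\sum_{e\in B}\sum_{j=1}^k (c_j-c_{j-1})\,x_{j,e}$, and the constraints 1. $\sum_{e\in\delta_B(C_1:\cdots:C_t)}x_{j,e}\le t-1$ for all $j\in\{1,\dots,k\}$ and all families of $t\ge 1$ distinct components $C_1,\dots,C_t$ of $(V,R_{j-1})$, where $\delta_B(C_1:\cdots:C_t)$ is the set of blue edges joining two different members of $C_1,\dots,C_t$; 2. $\sum_{e\in P\cap B}x_{1,e}+x_{j,f}\le|P\cap B|$ for all blue edges $f=ab$, all $j\in\{2,\dots,k\}$, and all (simple) $ab$-paths $P$ in $(V,(B\cup R_{j-1})-f)$, where for $a=b$ the only such path is the trivial one; 3. $x_{1,e}\ge x_{2,e}\ge\cdots\ge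 x_{k,e}\ge 0$ for all $e\in B$. **Proposition.** The LP can be separated in polynomial time: there is an algorithm which, given an instance and a vector $x\in\mathbb{Q}^{\{1,\dots,k\}\times B}$, either correctly reports that $x$ satisfies all the constraints 1–3, or returns one of these inequalities that $x$ violates. Its running time is bounded by a polynomial in the binary encoding length of the instance and of $x$ (random access machine, logarithmic cost). -/

import Mathlib

namespace StackMST

/-! ## Machine model: random access machine programs with logarithmic cost -/

/-- The memory of the machine: finitely many named arrays are accessible to a program, each of them
indexed by the integers and holding an integer in every cell. -/
abbrev Memory : Type := ℕ → ℤ → ℤ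

/-- Integer expressions; `get a i` reads cell `i` of the array `a` (indirect addressing). -/
inductive Expr : Type
  | const (z : ℤ)
  | get (a : ℕ) (i : Expr)
  | add (l r : Expr)
  | sub (l r : Expr)
  | mul (l r : Expr)
  | div (l r : Expr)

/-- The number of bits used to write an integer down. -/
def bitLength (z : ℤ) : ℕ := Nat.size z.natAbs + 1

/-- The value of an expression. -/
def Expr.eval (σ : Memory) : Expr → ℤ
  | .const z => z
  | .get a i => σ a (i.eval σ)
  | .add l r => l.eval σ + r.eval σ
  | .sub l r => l.eval σ - r.eval σ
  | .mul l r => l.eval σ * r.eval σ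
  | .div l r => l.eval σ / r.eval σ

/-- The logarithmic cost of evaluating an expression: every constant, memory access and arithmetic
operation is charged the bit lengths of all the numbers that it involves (addresses included). -/
def Expr.cost (σ : Memory) : Expr → ℕ
  | .const z => bitLength z
  | .get a i => i.cost σ + bitLength (i.eval σ) + bitLength (σ a (i.eval σ))
  | .add l r => l.cost σ + r.cost σ + bitLength (l.eval σ) + bitLength (r.eval σ)
  | .sub l r => l.cost σ + r.cost σ + bitLength (l.eval σ) + bitLength (r.eval σ)
  | .mul l r => l.cost σ + r.cost σ + bitLength (l.eval σ) + bitLength (r.eval σ)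
  | .div l r => l.cost σ + r.cost σ + bitLength (l.eval σ) + bitLength (r.eval σ)

/-- Programs: `assign a i e` performs `a[i] := e`; the tests of `ite` and `loop` (a while loop)
succeed when the value of the expression is positive. -/
inductive Program : Type
  | skip
  | assign (a : ℕ) (i e : Expr)
  | seq (P Q : Program)
  | ite (e : Expr) (P Q : Program)
  | loop (e : Expr) (P : Program)

/-- The memory after writing `v` into cell `i` of the array `a`. -/
def Memory.write (σ : Memory) (a : ℕ) (i v : ℤ) : Memory :=
  Function.update σ a (Function.update (σ a) i v)

/-- `Exec P σ t τ`: started in the memory `σ`, the program `P` halts after running for time `t`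
(logarithmic cost), and leaves the memory `τ`. -/
inductive Exec : Program → Memory → ℕ → Memory → Prop
  | skip (σ : Memory) : Exec .skip σ 1 σ
  | assign (a : ℕ) (i e : Expr) (σ : Memory) :
      Exec (.assign a i e) σ
        (1 + i.cost σ + e.cost σ + bitLength (i.eval σ) + bitLength (e.eval σ))
        (σ.write a (i.eval σ) (e.eval σ))
  | seq {P Q : Program} {σ τ υ : Memory} {s t : ℕ} :
      Exec P σ s τ → Exec Q τ t υ → Exec (.seq P Q) σ (s + t) υ
  | ite_pos {e : Expr} {P Q : Program} {σ τ : Memory} {t : ℕ} :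
      0 < e.eval σ → Exec P σ t τ → Exec (.ite e P Q) σ (1 + e.cost σ + t) τ
  | ite_neg {e : Expr} {P Q : Program} {σ τ : Memory} {t : ℕ} :
      ¬ 0 < e.eval σ → Exec Q σ t τ → Exec (.ite e P Q) σ (1 + e.cost σ + t) τ
  | loop_done {e : Expr} {P : Program} {σ : Memory} :
      ¬ 0 < e.eval σ → Exec (.loop e P) σ (1 + e.cost σ) σ
  | loop_step {e : Expr} {P : Program} {σ τ υ : Memory} {s t : ℕ} :
      0 < e.eval σ → Exec P σ s τ → Exec (.loop e P) τ t υ →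
      Exec (.loop e P) σ (1 + e.cost σ + s + t) υ

/-- The initial memory on the input word `w`: cell `0` of array `0` holds the length of `w`, the
following cells hold the entries of `w`, and all other cells of all arrays hold `0`. -/
def initialMemory (w : List ℤ) : Memory := fun a i =>
  if a = 0 then
    if i = 0 then (w.length : ℤ) else if 0 < i then w.getD (i.toNat - 1) 0 else 0
  else 0

/-- The output word `w` stands in array `1`: its length in cell `0`, its entries in the cells that
follow. -/
def HasOutput (σ : Memory) (w : List ℤ) : Prop :=
  σ 1 0 = (w.length : ℤ) ∧ ∀ m : ℕ, ∀ h : m < w.length, σ 1 ((m : ℤ) + 1) = w[m]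

/-- The binary encoding length of a word of integers. -/
def encodingLength (w : List ℤ) : ℕ := (w.map bitLength).sum

/-- The search problem "given `a`, find `y` with `R a y`" is solvable in polynomial time: one program
finds, on every `a`, a correct answer in time bounded by one polynomial in the encoding length of
`a`. -/
def SolvableInPolyTime {α : Type} {β : α → Type} (encIn : α → List ℤ)
    (encOut : ∀ a, β a → List ℤ) (R : ∀ a, β a → Prop) : Prop :=
  ∃ (P : Program) (p : Polynomial ℕ), ∀ a : α, ∃ (y : β a) (t : ℕ) (τ : Memory),
    Exec P (initialMemory (encIn a)) t τ ∧
    t ≤ p.eval (encodingLength (encIn a)) ∧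
    HasOutput τ (encOut a y) ∧ R a y

/-! ## Instances of the Stackelberg minimum spanning tree problem -/

/-- An instance: a finite undirected graph, loops and parallel edges allowed, on the vertices
`0, …, n - 1`, with `r` red edges of positive rational cost and `b` blue edges, such that the red
edges connect all vertices (there is a spanning tree all of whose edges are red). -/
structure Instance where
  n : ℕ
  r : ℕ
  b : ℕ
  redEnds : Fin r → Fin n × Fin n
  blueEnds : Fin b → Fin n × Fin n
  cost : Fin r → ℚ
  cost_pos : ∀ e, 0 < cost e
  red_connected : (SimpleGraph.fromRel fun u v => ∃ e, redEnds e = (u, v)).Preconnected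

namespace Instance

variable (I : Instance)

/-- The set of red costs. -/
def costSet : Finset ℚ := Finset.univ.image I.cost

/-- The number `k` of distinct red costs. -/
def k : ℕ := I.costSet.card

/-- `c 0 = 0`, and `c j` is the `j`-th smallest red cost for `1 ≤ j ≤ k`. -/
def c (j : ℕ) : ℚ := (0 :: I.costSet.sort (· ≤ ·)).getD j 0

/-- The edges of the graph, red ones on the left and blue ones on the right. -/
abbrev Edge : Type := Fin I.r ⊕ Fin I.b

/-- The two ends of an edge. -/
def ends : I.Edge → Fin I.n × Fin I.n := Sum.elim I.redEnds I.blueEnds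

/-- The set `R j` of the red edges of cost at most `c j`. -/
def R (j : ℕ) : Set (Fin I.r) := {e | I.cost e ≤ I.c j}

/-- The graph `(V, R j)`; loops and multiplicities do not matter for its components. -/
def redGraph (j : ℕ) : SimpleGraph (Fin I.n) :=
  SimpleGraph.fromRel fun u v => ∃ e ∈ I.R j, I.redEnds e = (u, v)

/-- A component of `(V, R j)`. -/
abbrev Component (j : ℕ) : Type := (I.redGraph j).ConnectedComponent

open Classical in
/-- The cut `δ_B(C₁ : ⋯ : C_t)`: the blue edges that join two different members of the family `𝒞`
of components of `(V, R j)`. -/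
noncomputable def cut (j : ℕ) (𝒞 : Finset (I.Component j)) : Finset (Fin I.b) :=
  Finset.univ.filter fun e =>
    ∃ C ∈ 𝒞, ∃ D ∈ 𝒞, C ≠ D ∧ (I.blueEnds e).1 ∈ C.supp ∧ (I.blueEnds e).2 ∈ D.supp

/-- `IsPath A u w P W`: in the graph with edge set `A` there is a path from `u` to `w` with the
sequence of edges `P` and the sequence of (distinct) vertices `W`. -/
inductive IsPath (A : Set I.Edge) : Fin I.n → Fin I.n → List I.Edge → List (Fin I.n) → Prop
  | nil (v : Fin I.n) : IsPath A v v [] [v]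
  | cons {u v w : Fin I.n} {e : I.Edge} {P : List I.Edge} {W : List (Fin I.n)} :
      e ∈ A → (I.ends e = (u, v) ∨ I.ends e = (v, u)) → u ∉ W → IsPath A v w P W →
      IsPath A u w (e :: P) (u :: W)

/-- The edge set `(B ∪ R j) - f`, for a blue edge `f`. -/
def edgesWithout (j : ℕ) (f : Fin I.b) : Set I.Edge :=
  {e | (∃ g ∈ I.R j, e = Sum.inl g) ∨ ∃ g, g ≠ f ∧ e = Sum.inr g}

/-- The set `P ∩ B` of the blue edges of a path. -/
def blueEdges (P : List I.Edge) : Finset (Fin I.b) :=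
  (P.filterMap Sum.getRight?).toFinset

/-! ## The linear programming relaxation

The variable `x_{j,e}`, `1 ≤ j ≤ k`, is `x i e` with `i = j - 1 : Fin k`. -/

/-- A linear inequality `∑ i, ∑ e, coeff i e * x i e ≤ rhs` with integer coefficients in the
variables of the linear program. -/
@[ext] structure Inequality where
  coeff : Fin I.k → Fin I.b → ℤ
  rhs : ℤ

/-- The point `x` satisfies the inequality. -/
def Inequality.Satisfied {I : Instance} (q : I.Inequality) (x : Fin I.k → Fin I.b → ℚ) : Prop :=
  ∑ i, ∑ e, (q.coeff i e : ℚ) * x i e ≤ q.rhs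

open Classical in
/-- The inequalities of the linear program. In `forest` and `cycle`, `j = i + 1`, so that
`R_{j-1} = R i`.
* `forest`: the sum of `x_{j,e}` over the blue edges `e` of the cut defined by `t ≥ 1` different
  components of `(V, R_{j-1})` is at most `t - 1`;
* `cycle`: `∑_{e ∈ P ∩ B} x_{1,e} + x_{j,f} ≤ |P ∩ B|` for every blue edge `f = ab`, every `j ≥ 2`
  and every `ab`-path `P` in `(B ∪ R_{j-1}) - f`;
* `mono`: `x_{j+1,e} - x_{j,e} ≤ 0` for `1 ≤ j < k`;
* `nonneg`: `- x_{k,e} ≤ 0`. -/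
inductive IsConstraint : I.Inequality → Prop
  | forest (i : Fin I.k) (𝒞 : Finset (I.Component i)) (h𝒞 : 𝒞.Nonempty) :
      IsConstraint
        { coeff := fun i' e => if i' = i ∧ e ∈ I.cut i 𝒞 then 1 else 0
          rhs := (𝒞.card : ℤ) - 1 }
  | cycle (f : Fin I.b) (i : Fin I.k) (hi : 1 ≤ i.val)
      (P : List I.Edge) (W : List (Fin I.n))
      (hP : I.IsPath (I.edgesWithout i f) (I.blueEnds f).1 (I.blueEnds f).2 P W) :
      IsConstraint
        { coeff := fun i' e =>
            (if i'.val = 0 ∧ e ∈ I.blueEdges P then 1 else 0) + (if i' = i ∧ e = f then 1 else 0)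
          rhs := ((I.blueEdges P).card : ℤ) }
  | mono (e : Fin I.b) (i j : Fin I.k) (hij : j.val = i.val + 1) :
      IsConstraint
        { coeff := fun i' e' =>
            (if i' = j ∧ e' = e then 1 else 0) - (if i' = i ∧ e' = e then 1 else 0)
          rhs := 0 }
  | nonneg (e : Fin I.b) (i : Fin I.k) (hi : i.val + 1 = I.k) :
      IsConstraint
        { coeff := fun i' e' => if i' = i ∧ e' = e then -1 else 0
          rhs := 0 }

/-- The point `x` is feasible for the linear program. -/
def Feasible (x : Fin I.k → Fin I.b → ℚ) : Prop :=
  ∀ q : I.Inequality, I.IsConstraint q → q.Satisfied x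

end Instance

/-! ## The separation problem -/

/-- The input of the separation problem: an instance together with a rational point. -/
structure Query where
  inst : Instance
  x : Fin inst.k → Fin inst.b → ℚ

/-- The encoding of a rational number by its numerator and denominator in lowest terms. -/
def encodeRat (q : ℚ) : List ℤ := [q.num, (q.den : ℤ)]

/-- The encoding of the ends of an edge. -/
def encodeEnds {n : ℕ} (e : Fin n × Fin n) : List ℤ := [(e.1.val : ℤ), (e.2.val : ℤ)]

/-- The encoding of an input: the numbers `n`, `r`, `b`, then the ends and the cost of every red
edge, the ends of every blue edge, and the coordinates of the point, ordered by `j` first. -/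
def Query.encode (q : Query) : List ℤ :=
  [(q.inst.n : ℤ), (q.inst.r : ℤ), (q.inst.b : ℤ)] ++
  ((List.finRange q.inst.r).flatMap fun e =>
    encodeEnds (q.inst.redEnds e) ++ encodeRat (q.inst.cost e)) ++
  ((List.finRange q.inst.b).flatMap fun e => encodeEnds (q.inst.blueEnds e)) ++
  ((List.finRange q.inst.k).flatMap fun i =>
    (List.finRange q.inst.b).flatMap fun e => encodeRat (q.x i e))

/-- An answer: `none` says that the point is feasible, `some q` returns an inequality. -/
abbrev Query.Answer (q : Query) : Type := Option q.inst.Inequality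

/-- The encoding of an answer: `0` for `none`; for an inequality `1`, all its coefficients (ordered
by `j` first) and its right-hand side. -/
def Query.encodeAnswer (q : Query) : q.Answer → List ℤ
  | none => [0]
  | some a =>
      1 :: ((List.finRange q.inst.k).flatMap fun i =>
        (List.finRange q.inst.b).map fun e => a.coeff i e) ++ [a.rhs]

/-- The correct answers: `none` if the point is feasible for the linear program, and otherwise any
inequality of the linear program that the point violates. -/
def Query.Correct (q : Query) : q.Answer → Prop
  | none => q.inst.Feasible q.x
  | some a => q.inst.IsConstraint a ∧ ¬ a.Satisfied q.x

end StackMST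

set_option linter.unusedSimpArgs false
namespace StackMST

/-! ## A program logic for the machine -/

/-! After multiplication by a common denominator `D` the point is integral, and an inequality is
tested by integer arithmetic. Monotonicity and non-negativity give only `k * b` inequalities, which
are tested one by one. The other two families are exponentially large, but for each of finitely many
parameters it suffices to test one optimal member.

Forest inequalities: fix `j`, and for a set `S` of components of `(V, R_{j-1})` let `w(S)` be the
total value of `x_j` on the blue edges joining different members of `S`. The inequalities say that
`w(S) - |S| ≤ -1` for all nonempty `S`. Maximizing `w(S) - |S|` over the sets containing a given `s`
is a minimum cut problem (`Query.cut_capacity`), so one minimum cut for every source `s` decides all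
of them (`Query.forest_complete`). Minimum cuts are found by capacity scaling with unit
augmentations (`phase_spec`, `minCut_spec`). Passing to the next binary digit of the capacities
turns a cut of residual capacity zero into one of residual capacity at most `N * N`, so that `N * N`
augmentations complete a phase.

Cycle inequalities: give a blue edge `e` the length `1 - x_{1,e}` and a red edge the length zero.
The inequality of `f`, `j` and `P` then says that `x_{j,f}` is at most the length of `P`, so only a
shortest path matters (`Query.cycle_complete`), and the method of Bellman and Ford finds one
(`shortestPaths_spec`). The lengths on a path are non-negative: a path contains no loops, and the
forest inequalities for `j = 1`, where all components are single vertices, give `x_{1,e} ≤ 1` for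
every edge that is not a loop (`Query.num_le_den`). Thus each stage may rely on the inequalities
tested before it.

Running time: a single number `m` bounds both the bits of every memory cell and the rounds of every
single loop. Then the running time is bounded by a polynomial in `m` read off from the program
(`Program.costPoly`), and the specification `wp` leaves only two kinds of obligations, namely that
every stored number is small and that every loop makes at most `m` rounds. `Query.bounds` provides
an `m` that is quadratic in the encoding length. -/

instance : Add Expr := ⟨.add⟩
instance : Sub Expr := ⟨.sub⟩
instance : Mul Expr := ⟨.mul⟩
instance : Div Expr := ⟨.div⟩
instance (n : ℕ) : OfNat Expr n := ⟨.const n⟩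

/-- The scalar variable stored in cell `0` of the array `a`. -/
abbrev var (a : ℕ) : Expr := .get a 0

/-- Assignment to the scalar variable stored in cell `0` of the array `a`. -/
abbrev set (a : ℕ) (e : Expr) : Program := .assign a 0 e

infixr:60 " ;; " => Program.seq

section eval
variable (σ : Memory) (l r : Expr)

@[simp] theorem Expr.eval_add : (l + r).eval σ = l.eval σ + r.eval σ := rfl
@[simp] theorem Expr.eval_sub : (l - r).eval σ = l.eval σ - r.eval σ := rfl
@[simp] theorem Expr.eval_mul : (l * r).eval σ = l.eval σ * r.eval σ := rfl
@[simp] theorem Expr.eval_div : (l / r).eval σ = l.eval σ / r.eval σ := rfl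
@[simp] theorem Expr.eval_get (a : ℕ) : (Expr.get a l).eval σ = σ a (l.eval σ) := rfl
@[simp] theorem Expr.eval_zero : (0 : Expr).eval σ = 0 := rfl
@[simp] theorem Expr.eval_one : (1 : Expr).eval σ = 1 := rfl
@[simp] theorem Expr.eval_ofNat (n : ℕ) [n.AtLeastTwo] :
    (no_index (OfNat.ofNat n : Expr)).eval σ = OfNat.ofNat n := rfl

end eval

theorem Memory.write_of_ne (σ : Memory) {a b : ℕ} (i v : ℤ) (h : b ≠ a) : σ.write a i v b = σ b := by
  simp [Memory.write, h]

@[simp] theorem Memory.write_self (σ : Memory) (a : ℕ) (i v : ℤ) :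
    σ.write a i v a = Function.update (σ a) i v := by
  simp [Memory.write]

/-- The integers with at most `m` binary digits. -/
def Small (m : ℕ) (z : ℤ) : Prop := |z| < 2 ^ m

/-- All cells of the memory hold integers with at most `m` binary digits. -/
def Memory.Bdd (m : ℕ) (σ : Memory) : Prop := ∀ a i, Small m (σ a i)

theorem Small.bitLength_le {m : ℕ} {z : ℤ} (h : Small m z) : bitLength z ≤ m + 1 := by
  have : z.natAbs < 2 ^ m := by
    have h' : |z| < 2 ^ m := h
    rw [Int.abs_eq_natAbs] at h'
    exact_mod_cast h'
  simpa [bitLength] using Nat.size_le.2 this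

/-! ### Bit lengths under arithmetic -/

theorem bitLength_pos (z : ℤ) : 1 ≤ bitLength z := by simp [bitLength]

theorem bitLength_le_iff {z : ℤ} {m : ℕ} : bitLength z ≤ m + 1 ↔ z.natAbs < 2 ^ m := by
  simp [bitLength, Nat.size_le]

theorem natAbs_lt_two_pow_bitLength (z : ℤ) : z.natAbs < 2 ^ (bitLength z - 1) := by
  simpa [bitLength] using Nat.lt_size_self z.natAbs

theorem bitLength_le_of_natAbs_le {y z : ℤ} (h : y.natAbs ≤ z.natAbs) :
    bitLength y ≤ bitLength z := by
  simpa [bitLength] using Nat.size_le_size h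

/-- `bitLength` exceeds the binary size by one, and this slack absorbs the carry. Hence one additive
bound serves all four operations, and `valuePoly` and `costPoly` treat them alike. -/
theorem bitLength_add_le (y z : ℤ) : bitLength (y + z) ≤ bitLength y + bitLength z := by
  have h1 := natAbs_lt_two_pow_bitLength y
  have h2 := natAbs_lt_two_pow_bitLength z
  obtain ⟨p, hp⟩ := Nat.exists_eq_add_of_le (bitLength_pos y)
  obtain ⟨q, hq⟩ := Nat.exists_eq_add_of_le (bitLength_pos z)
  rw [hp] at h1 ⊢
  rw [hq] at h2 ⊢
  simp only [Nat.add_sub_cancel_left] at h1 h2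
  have h3 : (y + z).natAbs < 2 ^ (p + q + 1) := by
    have := Int.natAbs_add_le y z
    have h4 : 2 ^ p ≤ 2 ^ (p + q) := Nat.pow_le_pow_right (by norm_num) (by omega)
    have h5 : 2 ^ q ≤ 2 ^ (p + q) := Nat.pow_le_pow_right (by norm_num) (by omega)
    rw [pow_succ]
    omega
  have := bitLength_le_iff.2 h3
  omega

theorem bitLength_sub_le (y z : ℤ) : bitLength (y - z) ≤ bitLength y + bitLength z := by
  have := bitLength_add_le y (-z)
  rw [← sub_eq_add_neg] at this
  simpa [bitLength] using this

theorem bitLength_mul_le (y z : ℤ) : bitLength (y * z) ≤ bitLength y + bitLength z := by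
  have h1 := natAbs_lt_two_pow_bitLength y
  have h2 := natAbs_lt_two_pow_bitLength z
  obtain ⟨p, hp⟩ := Nat.exists_eq_add_of_le (bitLength_pos y)
  obtain ⟨q, hq⟩ := Nat.exists_eq_add_of_le (bitLength_pos z)
  rw [hp] at h1 ⊢
  rw [hq] at h2 ⊢
  simp only [Nat.add_sub_cancel_left] at h1 h2
  have h3 : (y * z).natAbs < 2 ^ (p + q) := by
    rw [Int.natAbs_mul, pow_add]
    exact Nat.mul_lt_mul'' h1 h2
  have := bitLength_le_iff.2 h3
  omega

theorem bitLength_div_le (y z : ℤ) : bitLength (y / z) ≤ bitLength y + bitLength z :=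
  (bitLength_le_of_natAbs_le (Int.natAbs_ediv_le_natAbs y z)).trans (Nat.le_add_right _ _)

open Polynomial in
/-- A bound for the number of bits of the value of an expression, as a polynomial in the number of
bits of the cells of the memory. -/
noncomputable def Expr.valuePoly : Expr → ℕ[X]
  | .const z => C (bitLength z)
  | .get _ _ => X + 1
  | .add l r | .sub l r | .mul l r | .div l r => l.valuePoly + r.valuePoly

open Polynomial in
/-- A bound for the cost of evaluating an expression. -/
noncomputable def Expr.costPoly : Expr → ℕ[X]
  | .const z => C (bitLength z)
  | .get _ i => i.costPoly + i.valuePoly + (X + 1)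
  | .add l r | .sub l r | .mul l r | .div l r =>
      l.costPoly + r.costPoly + l.valuePoly + r.valuePoly

theorem Expr.bitLength_eval_le {m : ℕ} {σ : Memory} (h : σ.Bdd m) (e : Expr) :
    bitLength (e.eval σ) ≤ e.valuePoly.eval m := by
  induction e with
  | const z => simp [Expr.eval, Expr.valuePoly]
  | get a i _ => simpa [Expr.eval, Expr.valuePoly] using (h a (i.eval σ)).bitLength_le
  | add l r hl hr =>
    simpa [Expr.valuePoly, Expr.eval] using (bitLength_add_le _ _).trans (Nat.add_le_add hl hr)
  | sub l r hl hr =>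
    simpa [Expr.valuePoly, Expr.eval] using (bitLength_sub_le _ _).trans (Nat.add_le_add hl hr)
  | mul l r hl hr =>
    simpa [Expr.valuePoly, Expr.eval] using (bitLength_mul_le _ _).trans (Nat.add_le_add hl hr)
  | div l r hl hr =>
    simpa [Expr.valuePoly, Expr.eval] using (bitLength_div_le _ _).trans (Nat.add_le_add hl hr)

theorem Expr.cost_le {m : ℕ} {σ : Memory} (h : σ.Bdd m) (e : Expr) :
    e.cost σ ≤ e.costPoly.eval m := by
  induction e with
  | const z => simp [Expr.cost, Expr.costPoly]
  | get a i hi =>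
    have h1 := (h a (i.eval σ)).bitLength_le
    have h2 := i.bitLength_eval_le h
    simp only [Expr.cost, Expr.costPoly, Polynomial.eval_add, Polynomial.eval_X,
      Polynomial.eval_one]
    omega
  | add l r hl hr | sub l r hl hr | mul l r hl hr | div l r hl hr =>
    have h1 := l.bitLength_eval_le h
    have h2 := r.bitLength_eval_le h
    simp only [Expr.cost, Expr.costPoly, Polynomial.eval_add]
    omega

open Polynomial in
/-- A bound for the running time of a program all of whose loops make at most `X` steps, in a memory
all of whose cells hold integers with at most `X` binary digits. -/
noncomputable def Program.costPoly : Program → ℕ[X]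
  | .skip => 1
  | .assign _ i e => 1 + i.costPoly + e.costPoly + i.valuePoly + e.valuePoly
  | .seq P Q => P.costPoly + Q.costPoly
  | .ite e P Q => 1 + e.costPoly + P.costPoly + Q.costPoly
  | .loop e P => (X + 1) * (1 + e.costPoly + P.costPoly)

/-- Whether a program contains an assignment to the array. -/
def Program.touches : Program → ℕ → Bool
  | .skip, _ => false
  | .assign a _ _, b => a == b
  | .seq P Q, b => P.touches b || Q.touches b
  | .ite _ P Q, b => P.touches b || Q.touches b
  | .loop _ P, b => P.touches b

/-- The two memories agree outside of the arrays to which the program assigns. -/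
def Frame (P : Program) (σ τ : Memory) : Prop := ∀ a, P.touches a = false → τ a = σ a

/-- `touches` is computed from the syntax alone, so for a concrete program and array a proof by
`rfl` or `decide` shows that the array is preserved. This is how facts are carried across the parts
of the program. -/
theorem Exec.frame {P : Program} {σ τ : Memory} {t : ℕ} (h : Exec P σ t τ) : Frame P σ τ := by
  induction h with
  | skip σ => exact fun _ _ => rfl
  | assign a i e σ =>
    intro b hb
    refine Memory.write_of_ne _ _ _ ?_
    rintro rfl
    simp [Program.touches] at hb
  | seq _ _ h1 h2 =>
    intro b hb
    simp only [Program.touches, Bool.or_eq_false_iff] at hb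
    rw [h2 b hb.2, h1 b hb.1]
  | ite_pos _ _ h1 | ite_neg _ _ h1 =>
    intro b hb
    simp only [Program.touches, Bool.or_eq_false_iff] at hb
    first | exact h1 b hb.1 | exact h1 b hb.2
  | loop_done _ => exact fun _ _ => rfl
  | loop_step _ _ _ h1 h2 =>
    intro b hb
    rw [h2 b hb, h1 b hb]

/-- Started in the memory `σ` with cells of at most `m` bits, the program halts in the time that its
cost polynomial grants, in a memory with cells of at most `m` bits that satisfies `Q`. -/
def wp (m : ℕ) (P : Program) (Q : Memory → Prop) (σ : Memory) : Prop :=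
  σ.Bdd m → ∃ t τ, Exec P σ t τ ∧ t ≤ P.costPoly.eval m ∧ τ.Bdd m ∧ Q τ

/-! ### Proof rules for total correctness with a time bound -/

section rules

variable {m : ℕ} {P P' : Program} {Q R : Memory → Prop} {σ : Memory}

theorem wp_bdd (h : σ.Bdd m → wp m P Q σ) : wp m P Q σ := fun hσ => h hσ hσ

theorem wp_mono (h : wp m P Q σ) (hR : ∀ τ, τ.Bdd m → Frame P σ τ → Q τ → R τ) : wp m P R σ := by
  intro hσ
  obtain ⟨t, τ, he, ht, hb, hQ⟩ := h hσ
  exact ⟨t, τ, he, ht, hb, hR τ hb he.frame hQ⟩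

theorem wp_skip (h : Q σ) : wp m .skip Q σ :=
  fun hσ => ⟨1, σ, .skip σ, by simp [Program.costPoly], hσ, h⟩

/-- Among the basic rules this is the only one that asks for a number to be small: values computed
in a test or as an address are charged to the running time but are not stored. -/
theorem wp_assign {a : ℕ} {i e : Expr} (hs : σ.Bdd m → Small m (e.eval σ))
    (h : Q (σ.write a (i.eval σ) (e.eval σ))) : wp m (.assign a i e) Q σ := by
  intro hσ
  refine ⟨_, _, .assign a i e σ, ?_, ?_, h⟩
  · have h1 := i.cost_le hσ
    have h2 := e.cost_le hσ
    have h3 := i.bitLength_eval_le hσ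
    have h4 := e.bitLength_eval_le hσ
    simp only [Program.costPoly, Polynomial.eval_add, Polynomial.eval_one]
    omega
  · intro b j
    by_cases hb : b = a
    · subst hb
      rw [Memory.write_self, Function.update_apply]
      split_ifs
      exacts [hs hσ, hσ _ _]
    · rw [Memory.write_of_ne _ _ _ hb]
      exact hσ _ _

theorem wp_seq (h : wp m P (wp m P' Q) σ) : wp m (P ;; P') Q σ := by
  intro hσ
  obtain ⟨t, τ, he, ht, hb, hQ⟩ := h hσ
  obtain ⟨t', τ', he', ht', hb', hQ'⟩ := hQ hb
  exact ⟨_, _, .seq he he', by simpa [Program.costPoly] using Nat.add_le_add ht ht', hb', hQ'⟩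

/-- Sequential composition, with the frame of the first program at hand for the second one. -/
theorem wp_then (h : wp m P Q σ) (h' : ∀ τ, τ.Bdd m → Frame P σ τ → Q τ → wp m P' R τ) :
    wp m (P ;; P') R σ :=
  wp_seq (wp_mono h h')

theorem wp_ite {e : Expr} (h1 : 0 < e.eval σ → wp m P Q σ) (h2 : ¬ 0 < e.eval σ → wp m P' Q σ) :
    wp m (.ite e P P') Q σ := by
  intro hσ
  have hc := e.cost_le hσ
  by_cases h : 0 < e.eval σ
  · obtain ⟨t, τ, he, ht, hb, hQ⟩ := h1 h hσ
    refine ⟨_, _, .ite_pos h he, ?_, hb, hQ⟩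
    simp only [Program.costPoly, Polynomial.eval_add, Polynomial.eval_one]
    omega
  · obtain ⟨t, τ, he, ht, hb, hQ⟩ := h2 h hσ
    refine ⟨_, _, .ite_neg h he, ?_, hb, hQ⟩
    simp only [Program.costPoly, Polynomial.eval_add, Polynomial.eval_one]
    omega

/-- The rule for while loops: `I j` holds after `j` rounds. -/
theorem wp_loop {e : Expr} (I : ℕ → Memory → Prop) (h0 : I 0 σ)
    (hstep : ∀ j τ, I j τ → 0 < e.eval τ → j < m ∧ wp m P (I (j + 1)) τ)
    (hend : ∀ j τ, I j τ → ¬ 0 < e.eval τ → Q τ) : wp m (.loop e P) Q σ := by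
  -- `d` is the number of rounds that are still allowed. As a successful test forces `j < m`, it is
  -- also the termination measure.
  have key : ∀ d j σ, j + d = m → I j σ → σ.Bdd m →
      ∃ t τ, Exec (.loop e P) σ t τ ∧
        t ≤ (d + 1) * (1 + e.costPoly.eval m + P.costPoly.eval m) ∧ τ.Bdd m ∧ Q τ := by
    intro d
    induction d with
    | zero =>
      intro j σ hj hI hσ
      have h : ¬ 0 < e.eval σ := fun h => by
        have := (hstep j σ hI h).1
        omega
      refine ⟨_, _, .loop_done h, ?_, hσ, hend j σ hI h⟩
      have := e.cost_le hσ
      omega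
    | succ d ih =>
      intro j σ hj hI hσ
      have hc := e.cost_le hσ
      by_cases h : 0 < e.eval σ
      · obtain ⟨t, τ, he, ht, hb, hQ⟩ := (hstep j σ hI h).2 hσ
        obtain ⟨t', τ', he', ht', hb', hQ'⟩ := ih (j + 1) τ (by omega) hQ hb
        refine ⟨_, _, .loop_step h he he', ?_, hb', hQ'⟩
        rw [Nat.succ_mul (d + 1)]
        omega
      · refine ⟨_, _, .loop_done h, ?_, hσ, hend j σ hI h⟩
        rw [Nat.succ_mul]
        omega
  intro hσ
  obtain ⟨t, τ, he, ht, hb, hQ⟩ := key m 0 σ (by omega) h0 hσ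
  refine ⟨t, τ, he, ?_, hb, hQ⟩
  simpa [Program.costPoly] using ht

end rules

/-- `forLoop v l P` runs `P` with the values `0, …, l - 1` of the variable `v`. -/
def forLoop (v l : ℕ) (P : Program) : Program :=
  set v 0 ;; .loop (var l - var v) (P ;; set v (var v + 1))

theorem small_of_le {m : ℕ} {z : ℤ} (h : |z| ≤ m) : Small m z :=
  h.trans_lt (by exact_mod_cast Nat.lt_two_pow_self)

theorem small_natCast {m n : ℕ} (h : n ≤ m) : Small m (n : ℤ) :=
  small_of_le (by simpa using h)

/-- The rule for counting loops. -/
theorem wp_for {m v l : ℕ} {P : Program} {Q : Memory → Prop} {σ : Memory}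
    (n : ℕ) (I : ℕ → Memory → Prop) (hn : n ≤ m) (hl : σ l 0 = n)
    (hv : P.touches v = false) (hlv : (forLoop v l P).touches l = false)
    (hI : ∀ i τ x, I i τ → I i (τ.write v 0 x))
    (h0 : I 0 σ)
    (hstep : ∀ i < n, ∀ τ, τ.Bdd m → τ v 0 = (i : ℤ) → Frame (forLoop v l P) σ τ → I i τ →
      wp m P (I (i + 1)) τ)
    (hend : ∀ τ, Frame (forLoop v l P) σ τ → I n τ → Q τ) : wp m (forLoop v l P) Q σ := by
  have hne : l ≠ v := by
    rintro rfl
    simp [forLoop, Program.touches] at hlv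
  refine wp_seq (wp_assign (fun _ => ?_) ?_)
  · simpa using small_natCast (Nat.zero_le m)
  refine wp_loop (fun (i : ℕ) (τ : Memory) => i ≤ n ∧ τ v 0 = (i : ℤ) ∧ Frame (forLoop v l P) σ τ ∧ I i τ) ?_ ?_ ?_
  · refine ⟨Nat.zero_le _, by simp, ?_, by simpa using hI 0 σ 0 h0⟩
    intro a ha
    refine Memory.write_of_ne _ _ _ ?_
    rintro rfl
    simp [forLoop, Program.touches] at ha
  · rintro i τ ⟨_, hvi, hF, hIi⟩ hpos
    have hli : τ l 0 = n := by rw [hF l hlv, hl]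
    simp only [Expr.eval_sub, Expr.eval_get, Expr.eval_zero, hli, hvi] at hpos
    have hin : i < n := by omega
    refine ⟨hin.trans_le hn, wp_bdd fun hτ => wp_then (hstep i hin τ hτ hvi hF hIi) ?_⟩
    intro τ' _ hF' hI'
    have hvi' : τ' v 0 = i := by rw [hF' v hv, hvi]
    refine wp_assign (fun _ => ?_) ?_
    · have := small_natCast (m := m) (n := i + 1) (by omega)
      simpa [hvi'] using this
    -- The increment writes to the counter after the body has established the invariant, which `hI`
    -- declares harmless.
    · refine ⟨hin, by simp [hvi'], ?_, hI _ _ _ hI'⟩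
      intro a ha
      have ha' := ha
      simp only [forLoop, Program.touches, Bool.or_eq_false_iff] at ha'
      rw [Memory.write_of_ne, hF' a ha'.2.1, hF a ha]
      rintro rfl
      simp at ha'
  · rintro i τ ⟨hin, hvi, hF, hIi⟩ hpos
    have hli : τ l 0 = n := by rw [hF l hlv, hl]
    simp only [Expr.eval_sub, Expr.eval_get, Expr.eval_zero, hli, hvi] at hpos
    have : i = n := by omega
    subst this
    exact hend τ hF hIi

/-! ## The separation program -/

/-- Reading a cell of an array. -/
abbrev rd (a : ℕ) (i : Expr) : Expr := .get a i

/-- Positive if and only if the two values are equal. -/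
abbrev eqTest (x y : Expr) : Expr := 1 - (x - y) * (x - y)

/-- Positive if and only if the two values are different. -/
abbrev neTest (x y : Expr) : Expr := (x - y) * (x - y)

/-! The arrays of the program: the input, the output, the numbers of vertices, red edges, blue edges
and different costs, the common denominator, the numerators of the point, the ranks of the red edges,
products and sums of these numbers, and the ends of all edges, red edges first. -/

notation "aIn" => (0 : ℕ)
notation "aOut" => (1 : ℕ)
notation "aN" => (2 : ℕ)
notation "aR" => (3 : ℕ)
notation "aB" => (4 : ℕ)
notation "aK" => (5 : ℕ)
notation "aDen" => (6 : ℕ)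
notation "aX" => (7 : ℕ)
notation "aRank" => (8 : ℕ)
notation "aKB" => (9 : ℕ)
notation "aRB" => (10 : ℕ)
notation "aEA" => (11 : ℕ)
notation "aEB" => (12 : ℕ)
notation "aN1" => (13 : ℕ)
notation "aNN" => (14 : ℕ)

/-! Working arrays of the preparations, and the candidate for a violated inequality. -/

notation "aCN" => (20 : ℕ)
notation "aCD" => (21 : ℕ)
notation "aFst" => (22 : ℕ)
notation "aOff" => (23 : ℕ)
notation "aCf" => (24 : ℕ)
notation "aRhs" => (25 : ℕ)
notation "aSum" => (26 : ℕ)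

/-! Working arrays of the forest stage. -/

notation "aLab" => (27 : ℕ)
notation "aLa" => (28 : ℕ)
notation "aLb" => (29 : ℕ)
notation "aWt" => (30 : ℕ)
notation "aOutW" => (31 : ℕ)
notation "aXv" => (32 : ℕ)
notation "aCap" => (33 : ℕ)
notation "aTot" => (34 : ℕ)
notation "aPow" => (35 : ℕ)
notation "aPh" => (36 : ℕ)
notation "aRes" => (37 : ℕ)
notation "aReach" => (38 : ℕ)
notation "aPush" => (39 : ℕ)

/-! Working arrays of the cycle stage. -/

notation "aLim" => (40 : ℕ)
notation "aLen" => (41 : ℕ)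
notation "aOk" => (42 : ℕ)
notation "aDist" => (43 : ℕ)
notation "aRu" => (44 : ℕ)
notation "aRv" => (45 : ℕ)
notation "aUsed" => (46 : ℕ)

/-! Loop counters. -/

notation "cA" => (62 : ℕ)
notation "cB" => (63 : ℕ)
notation "cC" => (64 : ℕ)
notation "cD" => (65 : ℕ)
notation "cE" => (66 : ℕ)
notation "cF" => (67 : ℕ)
notation "cG" => (68 : ℕ)
notation "cH" => (69 : ℕ)
notation "cI" => (70 : ℕ)
notation "cJ" => (71 : ℕ)

/-- Reads the dimensions and the edges. -/
def readEdges : Program :=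
  set aN (rd aIn 1) ;; set aR (rd aIn 2) ;; set aB (rd aIn 3) ;;
  set aRB (var aR + var aB) ;; set aN1 (var aN + 1) ;; set aNN (var aN1 * var aN1) ;;
  .assign aOut 0 1 ;; .assign aOut 1 0 ;;
  forLoop cA aR
    (.assign aEA (var cA) (rd aIn (4 + 4 * var cA)) ;;
     .assign aEB (var cA) (rd aIn (5 + 4 * var cA)) ;;
     .assign aCN (var cA) (rd aIn (6 + 4 * var cA)) ;;
     .assign aCD (var cA) (rd aIn (7 + 4 * var cA))) ;;
  forLoop cA aB
    (.assign aEA (var aR + var cA) (rd aIn (4 + 4 * var aR + 2 * var cA)) ;;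
     .assign aEB (var aR + var cA) (rd aIn (5 + 4 * var aR + 2 * var cA)))

/-- Marks the first red edge of every cost. -/
def markFirst : Program :=
  forLoop cA aR
    (.assign aFst (var cA) 1 ;;
     forLoop cB cA
      (.ite (eqTest (rd aCN (var cB) * rd aCD (var cA)) (rd aCN (var cA) * rd aCD (var cB)))
        (.assign aFst (var cA) 0) .skip))

/-- Computes the numbers `j` such that an edge has the `j`-th smallest cost. -/
def computeRanks : Program :=
  forLoop cA aR
    (.assign aRank (var cA) 0 ;;
     forLoop cB aR
      (.ite (rd aFst (var cB))
        (.ite (1 + rd aCN (var cA) * rd aCD (var cB) - rd aCN (var cB) * rd aCD (var cA))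
          (.assign aRank (var cA) (rd aRank (var cA) + 1)) .skip) .skip))

/-- Computes the number of different costs. -/
def countCosts : Program :=
  set aK 0 ;; forLoop cA aR (set aK (var aK + rd aFst (var cA))) ;; set aKB (var aK * var aB)

/-- Brings the coordinates of the point to a common denominator. -/
def scalePoint : Program :=
  set aOff (4 + 4 * var aR + 2 * var aB) ;;
  set aDen 1 ;;
  forLoop cA aKB (set aDen (var aDen * rd aIn (var aOff + 2 * var cA + 1))) ;;
  forLoop cA aKB
    (.assign aX (var cA)
      (rd aIn (var aOff + 2 * var cA) * (var aDen / rd aIn (var aOff + 2 * var cA + 1))))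

def prepare : Program :=
  readEdges ;; markFirst ;; computeRanks ;; countCosts ;; scalePoint

/-- Sets all coefficients of the candidate to zero. -/
def clearCand : Program := forLoop cA aKB (.assign aCf (var cA) 0)

/-- Outputs the candidate if it is violated. -/
def check : Program :=
  set aSum 0 ;;
  forLoop cA aKB (set aSum (var aSum + rd aCf (var cA) * rd aX (var cA))) ;;
  .ite (var aSum - var aRhs * var aDen)
    (.assign aOut 0 (var aKB + 2) ;; .assign aOut 1 1 ;; .assign aOut (var aKB + 2) (var aRhs) ;;
     forLoop cA aKB (.assign aOut (var cA + 2) (rd aCf (var cA))))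
    .skip

/-- Checks monotonicity and non-negativity. -/
def monoStage : Program :=
  forLoop cB aKB
    (clearCand ;; set aRhs 0 ;; .assign aCf (var cB) (0 - 1) ;;
     .ite (var aKB - (var cB + var aB)) (.assign aCf (var cB + var aB) 1) .skip ;; check)

/-- Replaces one label by another. -/
def relabel : Program :=
  forLoop cA aN
    (.ite (eqTest (rd aLab (var cA)) (var aLb)) (.assign aLab (var cA) (var aLa)) .skip)

/-- Labels the vertices by their components. -/
def labels : Program :=
  forLoop cA aN (.assign aLab (var cA) (var cA)) ;;
  forLoop cD aR
    (.ite (1 + var cC - rd aRank (var cD))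
      (set aLa (rd aLab (rd aEA (var cD))) ;; set aLb (rd aLab (rd aEB (var cD))) ;; relabel) .skip)

/-- Loads the labels of the ends of the blue edge `cD`. -/
def loadEnds : Program :=
  set aLa (rd aLab (rd aEA (var aR + var cD))) ;; set aLb (rd aLab (rd aEB (var aR + var cD)))

/-- Computes the weights between the components, and the capacities to the sink. -/
def weights : Program :=
  forLoop cA aNN (.assign aWt (var cA) 0) ;;
  forLoop cA aN (.assign aWt (var cA * var aN1 + var aN) (var aDen) ;; .assign aOutW (var cA) 0) ;;
  forLoop cD aB
    (loadEnds ;; set aXv (rd aX (var cC * var aB + var cD)) ;;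
     .ite (neTest (var aLa) (var aLb))
      (.ite (var aXv)
        (.assign aWt (var aLa * var aN1 + var aLb)
          (rd aWt (var aLa * var aN1 + var aLb) + var aXv) ;;
         .assign aOutW (var aLa) (rd aOutW (var aLa) + var aXv)) .skip) .skip)

/-- Computes the capacities for the source `cE`. -/
def capacities : Program :=
  forLoop cA aNN (.assign aCap (var cA) (rd aWt (var cA))) ;;
  forLoop cA aN
    (.assign aCap (var cE * var aN1 + var cA)
      (rd aCap (var cE * var aN1 + var cA) + rd aOutW (var cA)))

/-- Reaches the vertex `cJ` from the vertex `cI` by pushing one unit. -/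
def pushStep : Program :=
  .assign aReach (var cJ) 1 ;;
  forLoop cA aNN
    (.assign aPush (var cJ * var aNN + var cA) (rd aPush (var cI * var aNN + var cA))) ;;
  .assign aPush (var cJ * var aNN + (var cI * var aN1 + var cJ))
    (rd aPush (var cJ * var aNN + (var cI * var aN1 + var cJ)) - 1) ;;
  .assign aPush (var cJ * var aNN + (var cJ * var aN1 + var cI))
    (rd aPush (var cJ * var aNN + (var cJ * var aN1 + var cI)) + 1)

/-- One round of the search. -/
def searchRound : Program :=
  forLoop cI aN1 (forLoop cJ aN1
    (.ite (rd aReach (var cI)) (.ite (1 - rd aReach (var cJ))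
      (.ite (rd aRes (var cI * var aN1 + var cJ)) pushStep .skip) .skip) .skip))

/-- Searches for the vertices that are reachable from the source in the residual network, and computes
for each of them the residual network that results from pushing one unit to it. -/
def search : Program :=
  forLoop cA aN1 (.assign aReach (var cA) 0) ;;
  .assign aReach (var cE) 1 ;;
  forLoop cA aNN (.assign aPush (var cE * var aNN + var cA) (rd aRes (var cA))) ;;
  forLoop cH aN1 searchRound

/-- Pushes one unit from the source to the sink if possible. -/
def augment : Program :=
  search ;;
  .ite (rd aReach (var aN))
    (forLoop cA aNN (.assign aRes (var cA) (rd aPush (var aN * var aNN + var cA)))) .skip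

/-- Proceeds from the capacities divided by `aPow` to those divided by half of it. -/
def refineRes : Program :=
  set aPow (var aPow / 2) ;;
  forLoop cA aNN
    (.assign aRes (var cA)
      (2 * rd aRes (var cA) +
        (rd aCap (var cA) / var aPow - 2 * (rd aCap (var cA) / (2 * var aPow)))))

/-- Computes a minimum cut by scaling. -/
def minCut : Program :=
  set aTot 0 ;; forLoop cA aNN (set aTot (var aTot + rd aCap (var cA))) ;;
  set aPow 1 ;; set aPh 0 ;;
  .loop (1 + var aTot - var aPow) (set aPow (2 * var aPow) ;; set aPh (var aPh + 1)) ;;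
  forLoop cA aNN (.assign aRes (var cA) 0) ;;
  forLoop cF aPh (refineRes ;; forLoop cG aNN augment) ;;
  search

/-- The forest inequality of the set of the components whose labels have been reached. -/
def forestCand : Program :=
  set aRhs (0 - 1) ;;
  forLoop cA aN
    (.ite (rd aReach (var cA)) (.ite (eqTest (rd aLab (var cA)) (var cA))
      (set aRhs (var aRhs + 1)) .skip) .skip) ;;
  clearCand ;;
  forLoop cD aB
    (loadEnds ;;
     .ite (neTest (var aLa) (var aLb)) (.ite (rd aReach (var aLa)) (.ite (rd aReach (var aLb))
      (.assign aCf (var cC * var aB + var cD) 1) .skip) .skip) .skip)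

/-- Checks the forest inequalities. -/
def forestStage : Program :=
  forLoop cC aK
    (labels ;; weights ;;
     forLoop cE aN
      (capacities ;; minCut ;; forestCand ;; .ite (var aRhs + 1) check .skip))

/-- Computes the lengths of the edges, and which of them may be used. -/
def lengths : Program :=
  set aLim (rd aX (var cC * var aB + var cB)) ;;
  .ite (var aLim) .skip (set aLim 0) ;;
  forLoop cA aR
    (.assign aLen (var cA) 0 ;;
     .ite (1 + var cC - rd aRank (var cA)) (.assign aOk (var cA) 1) (.assign aOk (var cA) 0)) ;;
  forLoop cA aB
    (.assign aOk (var aR + var cA) 1 ;;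
     .ite (var aDen - rd aX (var cA))
      (.assign aLen (var aR + var cA) (var aDen - rd aX (var cA)))
      (.assign aLen (var aR + var cA) 0)) ;;
  .assign aOk (var aR + var cB) 0

/-- Improves the path from `aRu` by the edge `cI` to `aRv`. -/
def relax : Program :=
  .ite (rd aDist (var aRu) - (rd aDist (var aRv) + rd aLen (var cI)))
    (.assign aDist (var aRu) (rd aDist (var aRv) + rd aLen (var cI)) ;;
     forLoop cA aRB
      (.assign aUsed (var aRu * var aRB + var cA) (rd aUsed (var aRv * var aRB + var cA))) ;;
     .assign aUsed (var aRu * var aRB + var cI) 1) .skip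

/-- Improves the paths by all edges. -/
def relaxRound : Program :=
  forLoop cI aRB
    (.ite (rd aOk (var cI))
      (set aRu (rd aEA (var cI)) ;; set aRv (rd aEB (var cI)) ;; relax ;;
       set aRu (rd aEB (var cI)) ;; set aRv (rd aEA (var cI)) ;; relax) .skip)

/-- Computes shortest paths to the second end of the blue edge `cB`. -/
def shortestPaths : Program :=
  forLoop cA aN (.assign aDist (var cA) (var aLim)) ;;
  .assign aDist (rd aEB (var aR + var cB)) 0 ;;
  forLoop cA aRB (.assign aUsed (rd aEB (var aR + var cB) * var aRB + var cA) 0) ;;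
  forLoop cH aN relaxRound

/-- The cycle inequality of the shortest path. -/
def cycleCand : Program :=
  clearCand ;; set aRhs 0 ;;
  forLoop cA aB
    (.assign aCf (var cA) (rd aUsed (rd aEA (var aR + var cB) * var aRB + (var aR + var cA))) ;;
     set aRhs (var aRhs + rd aCf (var cA))) ;;
  .assign aCf (var cC * var aB + var cB) 1

/-- Checks the cycle inequalities. -/
def cycleStage : Program :=
  forLoop cB aB (forLoop cC aK
    (.ite (var cC)
      (lengths ;; shortestPaths ;;
       .ite (var aLim - rd aDist (rd aEA (var aR + var cB))) (cycleCand ;; check) .skip) .skip))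

/-- The separation program. -/
def separate : Program := prepare ;; monoStage ;; forestStage ;; cycleStage

/-- The program does not change the input and the results of the preparations. -/
def Program.Safe (P : Program) : Prop := ∀ a < 20, a ≠ 1 → P.touches a = false

instance (P : Program) : Decidable P.Safe := inferInstanceAs (Decidable (∀ a < 20, _ → _))

/-! ## The scaled point and the prepared memory -/

/-- Doubly indexed data are stored row by row, with the entry `(i, e)` in cell `i * b + e`; the
lemmas on indices translate between the two views. -/
theorem sum_range_mul {M : Type*} [AddCommMonoid M] (k b : ℕ) (f : ℕ → M) :
    ∑ p ∈ Finset.range (k * b), f p = ∑ i : Fin k, ∑ e : Fin b, f (i * b + e) := by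
  induction k with
  | zero => simp
  | succ k ih =>
    rw [Nat.succ_mul, Finset.sum_range_add, ih, Fin.sum_univ_castSucc]
    congr 1
    simp [Finset.sum_range]

theorem index_lt {k b i e : ℕ} (hi : i < k) (he : e < b) : i * b + e < k * b := by
  have : (i + 1) * b ≤ k * b := Nat.mul_le_mul_right b hi
  rw [Nat.succ_mul] at this
  omega

theorem index_inj {b i e i' e' : ℕ} (he : e < b) (he' : e' < b) (h : i * b + e = i' * b + e') :
    i = i' ∧ e = e' := by
  have hb : 0 < b := by omega
  have h1 : (i * b + e) / b = i := by
    rw [mul_comm, Nat.mul_add_div hb, Nat.div_eq_of_lt he, add_zero]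
  have h2 : (i' * b + e') / b = i' := by
    rw [mul_comm, Nat.mul_add_div hb, Nat.div_eq_of_lt he', add_zero]
  have h3 : i = i' := by rw [← h1, h, h2]
  subst h3
  exact ⟨rfl, by omega⟩

theorem index_inj_iff {b i e i' e' : ℕ} (he : e < b) (he' : e' < b) :
    (i : ℤ) * b + e = i' * b + e' ↔ i = i' ∧ e = e' := by
  constructor
  · intro h
    exact index_inj he he' (by exact_mod_cast h)
  · rintro ⟨rfl, rfl⟩
    rfl

theorem exists_index {k b p : ℕ} (h : p < k * b) : ∃ i < k, ∃ e < b, p = i * b + e := by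
  have hb : 0 < b := Nat.pos_of_ne_zero (by rintro rfl; simp at h)
  exact ⟨p / b, Nat.div_lt_of_lt_mul (by rwa [mul_comm]), p % b, Nat.mod_lt _ hb,
    (Nat.div_add_mod' p b).symm⟩

theorem getElem?_flatMap_finRange {α : Type*} {b k : ℕ} (g : Fin k → List α)
    (hg : ∀ i, (g i).length = b) (i : Fin k) {j : ℕ} (hj : j < b) :
    ((List.finRange k).flatMap g)[i.val * b + j]? = (g i)[j]? := by
  induction k with
  | zero => exact i.elim0
  | succ k ih =>
    rw [List.finRange_succ, List.flatMap_cons]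
    refine Fin.cases ?_ (fun i => ?_) i
    · rw [List.getElem?_append_left (by simpa [hg] using hj)]
      simp
    · rw [List.getElem?_append_right (by rw [hg]; simp [Nat.succ_mul]; omega), hg]
      have := ih (fun i => g i.succ) (fun i => hg i.succ) i
      rw [← this, List.flatMap_map]
      congr 1
      simp [Nat.succ_mul]
      omega

theorem length_flatMap_finRange {α : Type*} {b k : ℕ} (g : Fin k → List α)
    (hg : ∀ i, (g i).length = b) : ((List.finRange k).flatMap g).length = k * b := by
  simp [List.length_flatMap, hg]

/-- The number `j` such that the cost of the edge is the `j`-th smallest one. -/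
def Instance.rank (I : Instance) (e : Fin I.r) : ℕ := (I.costSet.filter (· ≤ I.cost e)).card

namespace Query

variable (q : Query)

/-- The common denominator of the coordinates of the point. -/
def den : ℤ := ∏ i, ∏ e, ((q.x i e).den : ℤ)

/-- The numerators of the coordinates of the point with respect to the common denominator. -/
def num (i : Fin q.inst.k) (e : Fin q.inst.b) : ℤ := (q.x i e).num * (q.den / (q.x i e).den)

theorem den_pos : 0 < q.den :=
  Finset.prod_pos fun _ _ => Finset.prod_pos fun _ _ => by exact_mod_cast Rat.den_pos _

theorem den_dvd (i : Fin q.inst.k) (e : Fin q.inst.b) : ((q.x i e).den : ℤ) ∣ q.den :=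
  (Finset.dvd_prod_of_mem (fun e => ((q.x i e).den : ℤ)) (Finset.mem_univ e)).trans
    (Finset.dvd_prod_of_mem (fun i => ∏ e, ((q.x i e).den : ℤ)) (Finset.mem_univ i))

theorem num_cast (i : Fin q.inst.k) (e : Fin q.inst.b) : (q.num i e : ℚ) = q.den * q.x i e := by
  obtain ⟨c, hc⟩ := q.den_dvd i e
  have h0 : ((q.x i e).den : ℤ) ≠ 0 := by exact_mod_cast (Rat.den_pos _).ne'
  have h1 : q.den / (q.x i e).den = c := by
    rw [hc, Int.mul_ediv_cancel_left _ h0]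
  have h2 := Rat.den_mul_eq_num (q.x i e)
  rw [num, h1, hc]
  push_cast
  rw [← h2]
  ring

/-- Scaling by the positive common denominator yields the integer comparison that `check` performs.
-/
theorem satisfied_iff (a : q.inst.Inequality) :
    a.Satisfied q.x ↔ ∑ i, ∑ e, a.coeff i e * q.num i e ≤ a.rhs * q.den := by
  have hD : (0 : ℚ) < q.den := by exact_mod_cast q.den_pos
  have h : ((∑ i, ∑ e, a.coeff i e * q.num i e : ℤ) : ℚ)
      = q.den * ∑ i, ∑ e, (a.coeff i e : ℚ) * q.x i e := by
    push_cast
    simp only [num_cast, Finset.mul_sum]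
    refine Finset.sum_congr rfl fun i _ => Finset.sum_congr rfl fun e _ => ?_
    ring
  rw [Instance.Inequality.Satisfied, ← Int.cast_le (R := ℚ), h, mul_comm a.rhs]
  push_cast
  exact (mul_le_mul_iff_right₀ hD).symm

end Query

/-- The results of the preparations stand in the memory. -/
structure Base (q : Query) (σ : Memory) : Prop where
  n : σ aN 0 = q.inst.n
  r : σ aR 0 = q.inst.r
  b : σ aB 0 = q.inst.b
  k : σ aK 0 = q.inst.k
  den : σ aDen 0 = q.den
  kb : σ aKB 0 = q.inst.k * q.inst.b
  rb : σ aRB 0 = q.inst.r + q.inst.b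
  n1 : σ aN1 0 = q.inst.n + 1
  nn : σ aNN 0 = (q.inst.n + 1) * (q.inst.n + 1)
  num : ∀ (i : Fin q.inst.k) (e : Fin q.inst.b), σ aX (i * q.inst.b + e) = q.num i e
  rank : ∀ e : Fin q.inst.r, σ aRank e = q.inst.rank e
  redA : ∀ e : Fin q.inst.r, σ aEA e = (q.inst.redEnds e).1
  redB : ∀ e : Fin q.inst.r, σ aEB e = (q.inst.redEnds e).2
  blueA : ∀ e : Fin q.inst.b, σ aEA (q.inst.r + e) = (q.inst.blueEnds e).1
  blueB : ∀ e : Fin q.inst.b, σ aEB (q.inst.r + e) = (q.inst.blueEnds e).2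

/-- The array names below `20`, except for the output array `1`, are reserved for the input and the
results of the preparations. Preservation of `Base` thereby becomes the decidable condition
`Program.Safe`. -/
theorem Base.congr {q : Query} {σ τ : Memory} (h : Base q σ) (hτ : ∀ a < 20, a ≠ 1 → τ a = σ a) :
    Base q τ := by
  constructor <;> (try intro) <;> (try intro) <;> rw [hτ _ (by norm_num) (by norm_num)] <;>
    simp [h.n, h.r, h.b, h.k, h.den, h.kb, h.rb, h.n1, h.nn, h.num, h.rank, h.redA, h.redB, h.blueA,
      h.blueB]

theorem Base.frame {q : Query} {σ τ : Memory} {P : Program} (h : Base q σ) (hτ : Frame P σ τ)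
    (hP : P.Safe) : Base q τ :=
  h.congr fun a h1 h2 => hτ a (hP a h1 h2)

theorem Base.write {q : Query} {σ : Memory} (h : Base q σ) {a : ℕ} (ha : 20 ≤ a) (i v : ℤ) :
    Base q (σ.write a i v) :=
  h.congr fun b h1 _ => Memory.write_of_ne _ _ _ (by omega)

/-- All numbers that occur in the computation are small. -/
structure Bounds (q : Query) (m : ℕ) (V : ℤ) : Prop where
  nn : (q.inst.n + 1) * (q.inst.n + 1) ≤ m
  rb : q.inst.r + q.inst.b ≤ m
  k : q.inst.k ≤ m
  kb2 : q.inst.k * q.inst.b + 2 ≤ m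
  den : q.den ≤ V
  num : ∑ i, ∑ e, |q.num i e| ≤ V
  value : 16 * ((q.inst.n + 1) * (q.inst.n + 1)) * V < 2 ^ m

namespace Bounds

variable {q : Query} {m : ℕ} {V : ℤ} (h : Bounds q m V)
include h

theorem n1 : q.inst.n + 1 ≤ m := (Nat.le_mul_self _).trans h.nn
theorem n : q.inst.n ≤ m := (Nat.le_succ _).trans h.n1
theorem b : q.inst.b ≤ m := (Nat.le_add_left _ _).trans h.rb
theorem kb : q.inst.k * q.inst.b ≤ m := (Nat.le_add_right _ _).trans h.kb2
theorem r : q.inst.r ≤ m := (Nat.le_add_right _ _).trans h.rb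
theorem V_pos : 0 < V := q.den_pos.trans_le h.den

theorem small {z : ℤ} (hz : |z| ≤ 16 * ((q.inst.n + 1) * (q.inst.n + 1)) * V) : Small m z :=
  hz.trans_lt h.value

theorem small_of_le {z : ℤ} (hz : |z| ≤ 16 * V) : Small m z := by
  refine h.small (hz.trans ?_)
  have := h.V_pos
  have h1 : (1 : ℤ) ≤ (q.inst.n + 1) * (q.inst.n + 1) := by
    have : (0 : ℤ) ≤ q.inst.n := by positivity
    nlinarith
  nlinarith

theorem num_le (i : Fin q.inst.k) (e : Fin q.inst.b) : |q.num i e| ≤ V :=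
  le_trans (le_trans (Finset.single_le_sum (f := fun e => |q.num i e|)
    (fun _ _ => abs_nonneg _) (Finset.mem_univ e))
    (Finset.single_le_sum (f := fun i => ∑ e, |q.num i e|)
      (fun _ _ => Finset.sum_nonneg fun _ _ => abs_nonneg _) (Finset.mem_univ i))) h.num

end Bounds

theorem small_zero (m : ℕ) : Small m 0 := by simp [Small]

theorem Bounds.small_one {q : Query} {m : ℕ} {V : ℤ} (h : Bounds q m V) : Small m 1 :=
  StackMST.small_of_le (by have := h.n1; simp; omega)

/-! ## Checking a candidate -/

/-- Either the answer `none` stands in the output, and `Φ` is true, or a correct inequality. -/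
def Ok (q : Query) (Φ : Prop) (σ : Memory) : Prop :=
  (HasOutput σ (q.encodeAnswer none) ∧ Φ) ∨
    ∃ a : q.inst.Inequality, q.Correct (some a) ∧ HasOutput σ (q.encodeAnswer (some a))

theorem Ok.mono {q : Query} {Φ Ψ : Prop} {σ : Memory} (h : Ok q Φ σ) (hΨ : Φ → Ψ) : Ok q Ψ σ :=
  h.imp (fun h => ⟨h.1, hΨ h.2⟩) id

theorem Ok.congr {q : Query} {Φ : Prop} {σ τ : Memory} (h : Ok q Φ σ) (hτ : τ aOut = σ aOut) :
    Ok q Φ τ := by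
  simpa only [Ok, HasOutput, hτ] using h

theorem Ok.frame {q : Query} {Φ : Prop} {σ τ : Memory} {P : Program} (h : Ok q Φ σ)
    (hτ : Frame P σ τ) (hP : P.touches aOut = false) : Ok q Φ τ :=
  h.congr (hτ _ hP)

theorem Ok.write {q : Query} {Φ : Prop} {σ : Memory} (h : Ok q Φ σ) {a : ℕ} (ha : 2 ≤ a)
    (i v : ℤ) : Ok q Φ (σ.write a i v) :=
  h.congr (Memory.write_of_ne _ _ _ (by omega))

/-- The inequality stands in the memory as the candidate. -/
structure Cand (q : Query) (a : q.inst.Inequality) (σ : Memory) : Prop where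
  coeff : ∀ (i : Fin q.inst.k) (e : Fin q.inst.b), σ aCf (i * q.inst.b + e) = a.coeff i e
  rhs : σ aRhs 0 = a.rhs
  abs_le : ∀ i e, |a.coeff i e| ≤ 1

/-- The coefficients are shifted by two cells: cell `0` holds the length, and cell `1` the leading
`1` of the encoding. -/
theorem hasOutput_some {q : Query} {a : q.inst.Inequality} {σ : Memory}
    (h0 : σ aOut 0 = q.inst.k * q.inst.b + 2) (h1 : σ aOut 1 = 1)
    (hc : ∀ (i : Fin q.inst.k) (e : Fin q.inst.b), σ aOut (i * q.inst.b + e + 2) = a.coeff i e)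
    (hr : σ aOut (q.inst.k * q.inst.b + 2) = a.rhs) :
    HasOutput σ (q.encodeAnswer (some a)) := by
  have hlen : ((List.finRange q.inst.k).flatMap fun i =>
        (List.finRange q.inst.b).map fun e => a.coeff i e).length = q.inst.k * q.inst.b :=
    length_flatMap_finRange _ (by simp)
  refine ⟨by rw [h0]; simp [Query.encodeAnswer, hlen]; ring, fun m hm => ?_⟩
  have hm' : m < q.inst.k * q.inst.b + 2 := by
    simp [Query.encodeAnswer, hlen] at hm; omega
  have key : (q.encodeAnswer (some a))[m]? = some (σ aOut (m + 1)) := by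
    rw [Query.encodeAnswer]
    rcases Nat.eq_zero_or_pos m with rfl | hpos
    · simp [h1]
    obtain ⟨p, rfl⟩ : ∃ p, m = p + 1 := ⟨m - 1, by omega⟩
    rw [List.cons_append, List.getElem?_cons_succ]
    rcases Nat.lt_or_ge p (q.inst.k * q.inst.b) with hp | hp
    · rw [List.getElem?_append_left (by rwa [hlen])]
      obtain ⟨i, hi, e, he, rfl⟩ := exists_index hp
      rw [getElem?_flatMap_finRange (b := q.inst.b) _ (by simp) ⟨i, hi⟩ he]
      have := hc ⟨i, hi⟩ ⟨e, he⟩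
      simp only [List.getElem?_map]
      rw [List.getElem?_eq_getElem (by simpa using he)]
      simp only [List.getElem_finRange, Option.map_some, Option.some.injEq]
      refine this.symm.trans ?_
      congr 1
    · have : p = q.inst.k * q.inst.b := by omega
      subst this
      rw [List.getElem?_append_right (by rw [hlen]), hlen]
      simp only [Nat.sub_self, List.getElem?_cons_zero, Option.some.injEq]
      rw [← hr]
      congr 1
  rw [List.getElem?_eq_getElem hm] at key
  exact (Option.some.inj key).symm

theorem clearCand_spec {q : Query} {m : ℕ} {V : ℤ} (hB : Bounds q m V) {σ : Memory} (h : Base q σ) :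
    wp m clearCand (fun τ => ∀ (i : Fin q.inst.k) (e : Fin q.inst.b),
      τ aCf (i * q.inst.b + e) = 0) σ := by
  refine wp_for (q.inst.k * q.inst.b) (fun j τ => ∀ p : ℕ, p < j → τ aCf p = 0) hB.kb
    (by rw [h.kb]; push_cast; rfl) rfl rfl ?_ ?_ ?_ ?_
  · intro i τ x hI p hp
    rw [Memory.write_of_ne _ _ _ (by norm_num)]
    exact hI p hp
  · intro p hp
    omega
  · intro j hj τ _ hv hF hI
    refine wp_assign (fun _ => small_zero m) ?_
    intro p hp
    simp only [Memory.write_self, Expr.eval_get, Expr.eval_zero, hv, Function.update_apply]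
    split_ifs with hpj
    · rfl
    · exact hI p (by have : p ≠ j := by rintro rfl; exact hpj rfl
                     omega)
  · intro τ _ hI i e
    have := hI _ (index_lt i.2 e.2)
    push_cast at this
    exact this

/-- The program never stops early. Since the candidate is a constraint, overwriting the output when
it is violated is harmless even if another violated inequality stands there already. If it is
satisfied, the output stays as it is, and the condition attached to the answer `none` gains one
conjunct. -/
theorem check_spec {q : Query} {m : ℕ} {V : ℤ} (hB : Bounds q m V) {σ : Memory} (h : Base q σ)
    {a : q.inst.Inequality} (ha : q.inst.IsConstraint a) (hc : Cand q a σ) {Φ : Prop}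
    (hO : Ok q Φ σ) : wp m check (Ok q (Φ ∧ a.Satisfied q.x)) σ := by
  set f : ℕ → ℤ := fun p => σ aCf p * σ aX p with hf
  -- The coefficients have absolute value at most one, so all partial sums are bounded by the sum of
  -- the absolute values of the numerators.
  have hsum : ∀ j, j ≤ q.inst.k * q.inst.b → |∑ p ∈ Finset.range j, f p| ≤ V := by
    intro j hj
    refine (Finset.abs_sum_le_sum_abs _ _).trans (le_trans ?_ hB.num)
    refine (Finset.sum_le_sum_of_subset_of_nonneg
      (Finset.range_subset_range.2 hj) fun _ _ _ => abs_nonneg _).trans ?_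
    rw [sum_range_mul]
    refine Finset.sum_le_sum fun i _ => Finset.sum_le_sum fun e _ => ?_
    simp only [hf]
    push_cast
    rw [hc.coeff, h.num, abs_mul]
    exact mul_le_of_le_one_left (abs_nonneg _) (hc.abs_le i e)
  refine wp_then (Q := fun τ => τ = σ.write aSum 0 0) (wp_assign (fun _ => small_zero m) rfl) ?_
  rintro _ _ _ rfl
  refine wp_then (Q := fun τ => τ aSum 0 = ∑ p ∈ Finset.range (q.inst.k * q.inst.b), f p) ?_ ?_
  · refine wp_for (q.inst.k * q.inst.b) (fun j τ => τ aSum 0 = ∑ p ∈ Finset.range j, f p) hB.kb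
      ?_ rfl rfl ?_ ?_ ?_ ?_
    · rw [Memory.write_of_ne _ _ _ (by norm_num), h.kb]
      push_cast
      rfl
    · intro i τ x hI
      rwa [Memory.write_of_ne _ _ _ (by norm_num)]
    · simp
    · intro j hj τ _ hv hF hI
      have h1 : τ aCf = σ aCf := by
        rw [hF _ rfl, Memory.write_of_ne _ _ _ (by norm_num)]
      have h2 : τ aX = σ aX := by
        rw [hF _ rfl, Memory.write_of_ne _ _ _ (by norm_num)]
      have h3 : τ aSum 0 + τ aCf j * τ aX j = ∑ p ∈ Finset.range (j + 1), f p := by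
        rw [Finset.sum_range_succ, hI, h1, h2]
      refine wp_assign (fun _ => ?_) ?_
      · simp only [Expr.eval_add, Expr.eval_mul, Expr.eval_get, Expr.eval_zero, hv, h3]
        refine hB.small_of_le ((hsum _ hj).trans ?_)
        linarith [hB.V_pos]
      · simp [hv, h3]
    · intro τ _ hI
      exact hI
  · intro τ hτ hF hs
    have hF' : ∀ b, b ≠ aSum → b ≠ cA → τ b = σ b := by
      intro b h1 h2
      rw [hF b (by simp [forLoop, Program.touches, Ne.symm h1, Ne.symm h2]),
        Memory.write_of_ne _ _ _ h1]
    have hb : Base q τ := h.congr fun b h1 _ => hF' b (by omega) (by omega)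
    have hc' : Cand q a τ := ⟨fun i e => by rw [hF' _ (by norm_num) (by norm_num), hc.coeff],
      by rw [hF' _ (by norm_num) (by norm_num), hc.rhs], hc.abs_le⟩
    have hO' : Ok q Φ τ := hO.congr (hF' _ (by norm_num) (by norm_num))
    have hsat : a.Satisfied q.x ↔ ¬ 0 < τ aSum 0 - τ aRhs 0 * τ aDen 0 := by
      rw [q.satisfied_iff, hs, sum_range_mul, hc'.rhs, hb.den, sub_pos, not_lt]
      simp only [hf]
      push_cast
      simp only [hc.coeff, h.num]
    refine wp_ite (fun hpos => ?_) (fun hpos => wp_skip (hO'.mono fun hΦ => ⟨hΦ, hsat.2 hpos⟩))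
    have hk2 : Small m (q.inst.k * q.inst.b + 2) := by
      have := small_natCast hB.kb2
      push_cast at this
      exact this
    refine wp_seq (wp_assign (fun _ => by simpa [hb.kb] using hk2) ?_)
    refine wp_seq (wp_assign (fun _ => by simpa using hB.small_one) ?_)
    refine wp_seq (wp_assign (fun hbdd => hbdd _ _) ?_)
    set υ := ((τ.write aOut ((0 : Expr).eval τ) ((var aKB + 2).eval τ)).write aOut
      ((1 : Expr).eval (τ.write aOut ((0 : Expr).eval τ) ((var aKB + 2).eval τ)))
      ((1 : Expr).eval (τ.write aOut ((0 : Expr).eval τ) ((var aKB + 2).eval τ)))) with hυ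
    have hF2 : ∀ b, b ≠ aOut → υ b = τ b := by
      intro b hb'
      simp [hυ, Memory.write_of_ne _ _ _ hb']
    have hout : υ aOut 0 = q.inst.k * q.inst.b + 2 ∧ υ aOut 1 = 1 := by
      simp [hυ, hb.kb]
    have hkb0 : (0 : ℤ) ≤ q.inst.k * q.inst.b := by positivity
    have hkb : υ aKB 0 = q.inst.k * q.inst.b := by rw [hF2 _ (by norm_num), hb.kb]
    -- The right-hand side has been written first. It survives because the coefficients go to the
    -- cells `p + 2` with `p < k * b`.
    refine wp_for (q.inst.k * q.inst.b)
      (fun j τ => τ aOut 0 = q.inst.k * q.inst.b + 2 ∧ τ aOut 1 = 1 ∧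
        τ aOut (q.inst.k * q.inst.b + 2) = a.rhs ∧ ∀ p : ℕ, p < j → τ aOut (p + 2) = σ aCf p) hB.kb
      ?_ rfl rfl ?_ ?_ ?_ ?_
    · rw [Memory.write_of_ne _ _ _ (by norm_num), hkb]
      push_cast
      rfl
    · intro i τ x hI
      simpa [Memory.write_of_ne] using hI
    · refine ⟨?_, ?_, ?_, by simp⟩
      · simp [Function.update_apply, hkb, hout]
        omega
      · simp [Function.update_apply, hkb, hout]
        omega
      · simp only [Memory.write_self, Expr.eval_add, Expr.eval_get, Expr.eval_zero, Expr.eval_ofNat,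
          hkb, Function.update_self]
        rw [hF2 _ (by norm_num), hc'.rhs]
    · rintro j hj κ _ hv hFκ ⟨h1, h2, h3, h4⟩
      have hcf : κ aCf = σ aCf := by
        rw [hFκ _ rfl, Memory.write_of_ne _ _ _ (by norm_num), hF2 _ (by norm_num),
          hF' _ (by norm_num) (by norm_num)]
      refine wp_assign (fun hbdd => hbdd _ _) ?_
      have hj' : (j : ℤ) < q.inst.k * q.inst.b := by exact_mod_cast hj
      simp only [Memory.write_self, Expr.eval_add, Expr.eval_get, Expr.eval_zero, Expr.eval_ofNat, hv,
        Function.update_apply, hcf]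
      refine ⟨?_, ?_, ?_, fun p hp => ?_⟩
      · rw [if_neg (by omega), h1]
      · rw [if_neg (by omega), h2]
      · rw [if_neg (by omega), h3]
      · split_ifs with hpj
        · rw [show p = j by omega]
        · exact h4 p (by omega)
    · rintro κ _ ⟨h1, h2, h3, h4⟩
      refine Or.inr ⟨a, ⟨ha, fun hs => hsat.1 hs (by simpa using hpos)⟩,
        hasOutput_some h1 h2 (fun i e => ?_) h3⟩
      have := h4 _ (index_lt i.2 e.2)
      push_cast at this
      rw [this, hc.coeff]

/-! ## The monotonicity stage -/

/-- The inequality `x_{j+1,e} ≤ x_{j,e}`, or the inequality `0 ≤ x_{k,e}`. -/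
def Instance.monoIneq (I : Instance) (i : Fin I.k) (e : Fin I.b) : I.Inequality where
  coeff i' e' := (if i'.val = i.val + 1 ∧ e' = e then 1 else 0) - (if i' = i ∧ e' = e then 1 else 0)
  rhs := 0

/-- On the last level no `i'` has the value `i + 1`, so the positive term vanishes and
non-negativity remains. One formula, and one loop of the program, thus covers both kinds of
inequalities. -/
theorem Instance.isConstraint_monoIneq (I : Instance) (i : Fin I.k) (e : Fin I.b) :
    I.IsConstraint (I.monoIneq i e) := by
  by_cases h : i.val + 1 < I.k
  · convert IsConstraint.mono e i ⟨i.val + 1, h⟩ rfl using 1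
    ext i' e'
    · simp [monoIneq, Fin.ext_iff]
    · rfl
  · convert IsConstraint.nonneg e i (by omega) using 1
    ext i' e'
    · have : i'.val ≠ i.val + 1 := by omega
      simp only [monoIneq, this, false_and, if_false, zero_sub]
      split_ifs <;> rfl
    · rfl

theorem monoStage_spec {q : Query} {m : ℕ} {V : ℤ} (hB : Bounds q m V) {σ : Memory} (h : Base q σ)
    {Φ : Prop} (hO : Ok q Φ σ) :
    wp m monoStage (Ok q (Φ ∧ ∀ i e, (q.inst.monoIneq i e).Satisfied q.x)) σ := by
  refine wp_for (q.inst.k * q.inst.b)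
    (fun j τ => Ok q (Φ ∧ ∀ (i : Fin q.inst.k) (e : Fin q.inst.b), i * q.inst.b + e < j →
      (q.inst.monoIneq i e).Satisfied q.x) τ) hB.kb (by rw [h.kb]; push_cast; rfl) rfl rfl
    (fun _ _ _ hI => hI.write (by norm_num) _ _) (hO.mono fun h => ⟨h, by simp⟩) ?_ ?_
  · intro j hj τ _ hv hF hI
    have hb : Base q τ := h.frame hF (by decide)
    obtain ⟨i, hi, e, he, rfl⟩ := exists_index hj
    refine wp_then (clearCand_spec hB hb) fun υ _ hFυ hz => ?_
    have hbυ : Base q υ := hb.frame hFυ (by decide)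
    have hIυ := hI.frame hFυ rfl
    have hvυ : υ cB 0 = ((i * q.inst.b + e : ℕ) : ℤ) := by rw [hFυ _ rfl, hv]
    refine wp_seq (wp_assign (fun _ => small_zero m) (wp_seq (wp_assign (fun _ => ?_) ?_)))
    · have := hB.small_one
      simpa [Small] using this
    set κ := (υ.write aRhs ((0 : Expr).eval υ) ((0 : Expr).eval υ)).write aCf
      ((var cB).eval (υ.write aRhs ((0 : Expr).eval υ) ((0 : Expr).eval υ)))
      ((0 - 1 : Expr).eval (υ.write aRhs ((0 : Expr).eval υ) ((0 : Expr).eval υ))) with hκ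
    have hbκ : Base q κ := (hbυ.write (by norm_num) _ _).write (by norm_num) _ _
    have hOκ := (hIυ.write (a := aRhs) (by norm_num) ((0 : Expr).eval υ) ((0 : Expr).eval υ)).write
      (a := aCf) (by norm_num)
      ((var cB).eval (υ.write aRhs ((0 : Expr).eval υ) ((0 : Expr).eval υ)))
      ((0 - 1 : Expr).eval (υ.write aRhs ((0 : Expr).eval υ) ((0 : Expr).eval υ)))
    have hvκ : κ cB 0 = i * q.inst.b + e := by
      simp [hκ, Memory.write_of_ne, hvυ]
    have hcκ : ∀ (i' : Fin q.inst.k) (e' : Fin q.inst.b), κ aCf (i' * q.inst.b + e') =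
        if i'.val = i ∧ e'.val = e then -1 else 0 := by
      intro i' e'
      simp [hκ, Memory.write_of_ne, hvυ, Function.update_apply, hz, index_inj_iff e'.2 he]
    have hrκ : κ aRhs 0 = 0 := by simp [hκ, Memory.write_of_ne]
    have habs : ∀ i' e', |(q.inst.monoIneq ⟨i, hi⟩ ⟨e, he⟩).coeff i' e'| ≤ 1 := by
      intro i' e'
      simp only [Instance.monoIneq]
      split_ifs <;> simp
    refine wp_then (Q := fun τ => Cand q (q.inst.monoIneq ⟨i, hi⟩ ⟨e, he⟩) τ)
      (wp_ite (fun hpos => ?_) (fun hpos => ?_)) ?_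
    · simp only [Expr.eval_sub, Expr.eval_add, Expr.eval_get, Expr.eval_zero, hbκ.kb, hbκ.b, hvκ]
        at hpos
      refine wp_assign (fun _ => hB.small_one) ⟨fun i' e' => ?_, ?_, habs⟩
      -- Adding `b` to an index leads to the same edge on the next level.
      · have hne : (i' : ℤ) * q.inst.b + e' = i * q.inst.b + e + q.inst.b ↔
            i'.val = i + 1 ∧ e'.val = e := by
          rw [← index_inj_iff e'.2 he]
          push_cast
          constructor <;> intro h <;> linarith
        simp only [Memory.write_self, Expr.eval_add, Expr.eval_get, Expr.eval_zero, hvκ, hbκ.b,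
          Function.update_apply, hne, hcκ, Instance.monoIneq, Fin.ext_iff, Expr.eval_one]
        by_cases h1 : i'.val = i + 1 ∧ e'.val = e
        · rw [if_pos h1, if_pos h1, if_neg (by omega)]
          rfl
        · rw [if_neg h1, if_neg h1]
          split_ifs <;> rfl
      · rw [Memory.write_of_ne _ _ _ (by norm_num), hrκ]
        rfl
    · simp only [Expr.eval_sub, Expr.eval_add, Expr.eval_get, Expr.eval_zero, hbκ.kb, hbκ.b, hvκ]
        at hpos
      have hlast : ¬ i + 1 < q.inst.k := by
        intro hlt
        apply hpos
        have := index_lt hlt he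
        zify at this
        linarith
      refine wp_skip ⟨fun i' e' => ?_, hrκ, habs⟩
      have hi' : i'.val ≠ i + 1 := by omega
      simp only [hcκ, Instance.monoIneq, hi', false_and, if_false, zero_sub, Fin.ext_iff]
      split_ifs <;> rfl
    · intro τ' _ hFτ hc
      have hbτ : Base q τ' := hbκ.frame hFτ (by decide)
      refine wp_mono (check_spec hB hbτ (q.inst.isConstraint_monoIneq _ _) hc
        (hOκ.frame hFτ rfl)) fun τ'' _ _ hOk => hOk.mono ?_
      rintro ⟨⟨h1, h2⟩, h3⟩
      refine ⟨h1, fun i' e' hlt => ?_⟩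
      rcases Nat.lt_succ_iff_lt_or_eq.1 hlt with hlt | heq
      · exact h2 i' e' hlt
      · obtain ⟨h4, h5⟩ := index_inj e'.2 he heq
        have h6 : i' = ⟨i, hi⟩ := Fin.ext h4
        have h7 : e' = ⟨e, he⟩ := Fin.ext h5
        rwa [h6, h7]
  · intro τ _ hI
    exact hI.mono fun h => ⟨h.1, fun i e => h.2 i e (index_lt i.2 e.2)⟩

/-! ## Minimum cuts -/

/-- The capacity of the cut between `S` and its complement in `{0, …, N - 1}`. -/
def cut (N : ℕ) (f : ℕ → ℕ → ℤ) (S : Finset ℕ) : ℤ :=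
  ∑ u ∈ Finset.range N, ∑ v ∈ Finset.range N, if u ∈ S ∧ v ∉ S then f u v else 0

/-- The residual capacities after pushing one unit from `a` to `b`. -/
def push (f : ℕ → ℕ → ℤ) (a b : ℕ) (u v : ℕ) : ℤ :=
  f u v - (if u = a ∧ v = b then 1 else 0) + (if u = b ∧ v = a then 1 else 0)

/-! ### Cut capacities depend linearly on the arc capacities -/

theorem cut_congr {N : ℕ} {f g : ℕ → ℕ → ℤ} (h : ∀ u < N, ∀ v < N, f u v = g u v) (S : Finset ℕ) :
    cut N f S = cut N g S := by
  refine Finset.sum_congr rfl fun u hu => Finset.sum_congr rfl fun v hv => ?_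
  rw [h u (Finset.mem_range.1 hu) v (Finset.mem_range.1 hv)]

theorem cut_nonneg {N : ℕ} {f : ℕ → ℕ → ℤ} (h : ∀ u < N, ∀ v < N, 0 ≤ f u v) (S : Finset ℕ) :
    0 ≤ cut N f S := by
  refine Finset.sum_nonneg fun u hu => Finset.sum_nonneg fun v hv => ?_
  split_ifs
  exacts [h u (Finset.mem_range.1 hu) v (Finset.mem_range.1 hv), le_rfl]

theorem cut_eq_zero {N : ℕ} {f : ℕ → ℕ → ℤ} {S : Finset ℕ}
    (h : ∀ u < N, ∀ v < N, u ∈ S → v ∉ S → f u v = 0) : cut N f S = 0 := by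
  refine Finset.sum_eq_zero fun u hu => Finset.sum_eq_zero fun v hv => ?_
  split_ifs with huv
  exacts [h u (Finset.mem_range.1 hu) v (Finset.mem_range.1 hv) huv.1 huv.2, rfl]

theorem cut_linear (N : ℕ) (f g : ℕ → ℕ → ℤ) (S : Finset ℕ) (c : ℤ) :
    cut N (fun u v => f u v + c * g u v) S = cut N f S + c * cut N g S := by
  simp only [cut, Finset.mul_sum, ← Finset.sum_add_distrib]
  refine Finset.sum_congr rfl fun u _ => Finset.sum_congr rfl fun v _ => ?_
  split_ifs <;> simp

theorem cut_single {N a b : ℕ} (ha : a < N) (hb : b < N) (S : Finset ℕ) :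
    cut N (fun u v => if u = a ∧ v = b then 1 else 0) S = if a ∈ S ∧ b ∉ S then 1 else 0 := by
  rw [cut, Finset.sum_eq_single_of_mem a (Finset.mem_range.2 ha),
    Finset.sum_eq_single_of_mem b (Finset.mem_range.2 hb)]
  · simp
  · intro v _ hv
    simp [hv]
  · intro u _ hu
    simp [hu]

/-- Only the two opposite arcs change, and their effect on a cut is a difference of two indicators.
In this form the contributions telescope along a path. -/
theorem cut_push {N a b : ℕ} (ha : a < N) (hb : b < N) (f : ℕ → ℕ → ℤ) (S : Finset ℕ) :
    cut N (push f a b) S = cut N f S - (if a ∈ S then 1 else 0) + (if b ∈ S then 1 else 0) := by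
  have h : cut N (push f a b) S = cut N (fun u v => (f u v + (-1) *
      (if u = a ∧ v = b then 1 else 0)) + 1 * (if u = b ∧ v = a then 1 else 0)) S := by
    refine cut_congr (fun u _ v _ => ?_) S
    rw [push]
    ring
  rw [h, cut_linear, cut_linear, cut_single ha hb, cut_single hb ha]
  by_cases h1 : a ∈ S <;> by_cases h2 : b ∈ S <;> simp [h1, h2, sub_eq_add_neg]

/-- The invariant of the search from `s` in the network with the residual capacities `f`: all
vertices in `A` are reachable, and `g v` is obtained by pushing one unit from `s` to `v`. -/
structure Searched (N s : ℕ) (f : ℕ → ℕ → ℤ) (A : Finset ℕ) (g : ℕ → ℕ → ℕ → ℤ) : Prop where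
  subset : A ⊆ Finset.range N
  source : s ∈ A
  nonneg : ∀ v ∈ A, ∀ i < N, ∀ j < N, 0 ≤ g v i j
  cut_eq : ∀ v ∈ A, ∀ S, cut N (g v) S =
    cut N f S - (if s ∈ S then 1 else 0) + (if v ∈ S then 1 else 0)
  symm : ∀ v ∈ A, ∀ i < N, ∀ j < N, g v i j + g v j i = f i j + f j i
  fresh : ∀ v ∈ A, ∀ i < N, ∀ j < N, j ∉ A → g v i j = f i j
  subset_closed : ∀ C : Finset ℕ, s ∈ C → (∀ u ∈ C, ∀ v < N, 0 < f u v → v ∈ C) → A ⊆ C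

theorem Searched.init {N s : ℕ} (hs : s < N) {f : ℕ → ℕ → ℤ} (hf : ∀ i < N, ∀ j < N, 0 ≤ f i j) :
    Searched N s f {s} fun _ => f where
  subset := by simpa using hs
  source := by simp
  nonneg := fun _ _ => hf
  cut_eq := by
    intro v hv S
    rw [Finset.mem_singleton.1 hv]
    ring
  symm := fun _ _ _ _ _ _ => rfl
  fresh := fun _ _ _ _ _ _ _ => rfl
  subset_closed := fun C hC _ => by simpa using hC

/-- Instead of predecessors, the search keeps for every reached vertex the full residual network
after pushing one unit to it. By `fresh`, no column of an unreached vertex has been modified, so the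
arc from `u` to the new vertex `v` still has its capacity `f u v` in `g u`, and decreasing it by one
is allowed. The changes of the cuts telescope from `s` via `u` to `v`. -/
theorem Searched.step {N s : ℕ} {f : ℕ → ℕ → ℤ} {A : Finset ℕ} {g : ℕ → ℕ → ℕ → ℤ}
    (h : Searched N s f A g) {u v : ℕ} (hu : u ∈ A) (hv : v ∉ A) (hvN : v < N) (huv : 0 < f u v) :
    Searched N s f (insert v A) (Function.update g v (push (g u) u v)) := by
  have huN : u < N := Finset.mem_range.1 (h.subset hu)
  have hne : u ≠ v := by
    rintro rfl
    exact hv hu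
  have hcase : ∀ w ∈ insert v A, (w = v ∧ Function.update g v (push (g u) u v) w = push (g u) u v) ∨
      (w ∈ A ∧ Function.update g v (push (g u) u v) w = g w) := by
    intro w hw
    rcases Finset.mem_insert.1 hw with rfl | hwA
    · simp
    · refine Or.inr ⟨hwA, Function.update_of_ne ?_ _ _⟩
      rintro rfl
      exact hv hwA
  have hguv : g u u v = f u v := h.fresh u hu u huN v hvN hv
  refine ⟨?_, Finset.mem_insert_of_mem h.source, ?_, ?_, ?_, ?_, ?_⟩
  · exact Finset.insert_subset (Finset.mem_range.2 hvN) h.subset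
  · intro w hw i hi j hj
    rcases hcase w hw with ⟨_, hw'⟩ | ⟨hwA, hw'⟩
    · rw [hw', push]
      have := h.nonneg u hu i hi j hj
      by_cases h1 : i = u ∧ j = v
      · rw [if_pos h1, if_neg (by omega), h1.1, h1.2, hguv]
        omega
      · rw [if_neg h1]
        split_ifs <;> omega
    · rw [hw']
      exact h.nonneg w hwA i hi j hj
  · intro w hw S
    rcases hcase w hw with ⟨rfl, hw'⟩ | ⟨hwA, hw'⟩
    · rw [hw', cut_push huN hvN, h.cut_eq u hu]
      ring
    · rw [hw', h.cut_eq w hwA]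
  · intro w hw i hi j hj
    rcases hcase w hw with ⟨_, hw'⟩ | ⟨hwA, hw'⟩
    · rw [hw', ← h.symm u hu i hi j hj, push, push]
      simp only [and_comm (a := j = _)]
      ring
    · rw [hw', h.symm w hwA i hi j hj]
  · intro w hw i hi j hj hjA
    rw [Finset.mem_insert, not_or] at hjA
    rcases hcase w hw with ⟨_, hw'⟩ | ⟨hwA, hw'⟩
    · rw [hw', push, if_neg (by omega), if_neg, h.fresh u hu i hi j hj hjA.2]
      · ring
      · rintro ⟨_, rfl⟩
        exact hjA.2 hu
    · rw [hw', h.fresh w hwA i hi j hj hjA.2]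
  · intro C hC hcl
    have hAC := h.subset_closed C hC hcl
    exact Finset.insert_subset (hcl u (hAC hu) v hvN huv) hAC

/-- The parameters of a network stand in the memory: `N` vertices, the source `s`, the sink `t`. -/
structure NetDim (m N s t : ℕ) (σ : Memory) : Prop where
  n1 : σ aN1 0 = N
  nn : σ aNN 0 = N * N
  src : σ cE 0 = s
  snk : σ aN 0 = t
  s_lt : s < N
  t_lt : t < N
  nn_le : N * N ≤ m

theorem NetDim.congr {m N s t : ℕ} {σ τ : Memory} (h : NetDim m N s t σ) (h1 : τ aN1 = σ aN1)
    (h2 : τ aNN = σ aNN) (h3 : τ cE = σ cE) (h4 : τ aN = σ aN) : NetDim m N s t τ :=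
  ⟨by rw [h1, h.n1], by rw [h2, h.nn], by rw [h3, h.src], by rw [h4, h.snk], h.s_lt, h.t_lt, h.nn_le⟩

theorem NetDim.frame {m N s t : ℕ} {σ τ : Memory} {P : Program} (h : NetDim m N s t σ)
    (hF : Frame P σ τ) (hP : (P.touches aN1 || P.touches aNN || P.touches cE || P.touches aN) = false) :
    NetDim m N s t τ := by
  simp only [Bool.or_eq_false_iff] at hP
  exact h.congr (hF _ hP.1.1.1) (hF _ hP.1.1.2) (hF _ hP.1.2) (hF _ hP.2)

theorem NetDim.n_le {m N s t : ℕ} {σ : Memory} (h : NetDim m N s t σ) : N ≤ m :=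
  (Nat.le_mul_self N).trans h.nn_le

theorem NetDim.small_one {m N s t : ℕ} {σ : Memory} (h : NetDim m N s t σ) : Small m 1 :=
  small_of_le (by have := h.n_le; have := h.s_lt; simp; omega)

/-- The matrix `f` stands in the array `a`. -/
def MatView (N : ℕ) (a : ℕ) (f : ℕ → ℕ → ℤ) (σ : Memory) : Prop :=
  ∀ i < N, ∀ j < N, σ a (i * N + j) = f i j

/-- The array `aReach` marks the members of `A`. -/
def ReachView (N : ℕ) (A : Finset ℕ) (σ : Memory) : Prop :=
  ∀ v < N, σ aReach v = if v ∈ A then 1 else 0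

/-- The matrices `g v`, for `v` in `A`, stand in the array `aPush`. -/
def PushView (N : ℕ) (A : Finset ℕ) (g : ℕ → ℕ → ℕ → ℤ) (σ : Memory) : Prop :=
  ∀ v ∈ A, ∀ i < N, ∀ j < N, σ aPush (v * (N * N) + (i * N + j)) = g v i j

theorem index_inj_iff₂ {N i j v i' j' v' : ℕ} (hi : i < N) (hj : j < N) (hi' : i' < N) (hj' : j' < N) :
    (v : ℤ) * (N * N) + (i * N + j) = v' * (N * N) + (i' * N + j') ↔ v = v' ∧ i = i' ∧ j = j' := by
  have h1 := index_lt hi hj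
  have h2 := index_lt hi' hj'
  have := index_inj_iff (i := v) (i' := v') h1 h2
  push_cast at this
  rw [this]
  constructor
  · rintro ⟨h3, h4⟩
    exact ⟨h3, index_inj hj hj' h4⟩
  · rintro ⟨h3, h4, h5⟩
    exact ⟨h3, by rw [h4, h5]⟩

/-- Pushing preserves the sum of the two entries of opposite arcs. A non-negative entry is therefore
at most `f i j + f j i`, which explains the form of `hsmall`. -/
theorem pushStep_spec {m N s t : ℕ} {f : ℕ → ℕ → ℤ} {A : Finset ℕ} {g : ℕ → ℕ → ℕ → ℤ} {u v : ℕ}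
    {σ : Memory} (hD : NetDim m N s t σ)
    (hsmall : ∀ i < N, ∀ j < N, ∀ z, 0 ≤ z → z ≤ f i j + f j i → Small m z)
    (hS : Searched N s f A g) (hR : ReachView N A σ) (hP : PushView N A g σ) (hu : u ∈ A) (hv : v ∉ A)
    (hvN : v < N) (huv : 0 < f u v) (hcI : σ cI 0 = u) (hcJ : σ cJ 0 = v) :
    wp m pushStep (fun τ => ReachView N (insert v A) τ ∧
      PushView N (insert v A) (Function.update g v (push (g u) u v)) τ) σ := by
  have huN : u < N := Finset.mem_range.1 (hS.subset hu)
  have hne : u ≠ v := by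
    rintro rfl
    exact hv hu
  have hS' := hS.step hu hv hvN huv
  have hsm : ∀ i < N, ∀ j < N, Small m (push (g u) u v i j) := by
    intro i hi j hj
    have h1 := hS'.nonneg v (Finset.mem_insert_self _ _) i hi j hj
    have h2 := hS'.nonneg v (Finset.mem_insert_self _ _) j hj i hi
    have h3 := hS'.symm v (Finset.mem_insert_self _ _) i hi j hj
    rw [Function.update_self] at h1 h2 h3
    exact hsmall i hi j hj _ h1 (by omega)
  refine wp_seq (wp_assign (fun _ => hD.small_one) ?_)
  set σ' := σ.write aReach ((var cJ).eval σ) ((1 : Expr).eval σ) with hσ'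
  have hσ : ∀ a, a ≠ aReach → σ' a = σ a := fun a ha => Memory.write_of_ne _ _ _ ha
  have hD' : NetDim m N s t σ' := hD.congr (hσ _ (by norm_num)) (hσ _ (by norm_num))
    (hσ _ (by norm_num)) (hσ _ (by norm_num))
  have hR' : ReachView N (insert v A) σ' := by
    intro w hw
    simp only [hσ', Memory.write_self, Expr.eval_get, Expr.eval_zero, hcJ, Function.update_apply,
      Expr.eval_one, Finset.mem_insert, Nat.cast_inj, hR w hw]
    by_cases hwv : w = v <;> simp [hwv]
  -- The block of `u` is copied to the block of `v`; as `v` has not been reached before, no block in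
  -- use is lost.
  refine wp_then (Q := fun τ => (∀ i < N, ∀ j < N, τ aPush (v * (N * N) + (i * N + j)) = g u i j) ∧
      PushView N A g τ) ?_ ?_
  · refine wp_for (N * N) (fun p τ => (∀ p' < p, τ aPush (v * (N * N) + p') =
      σ aPush (u * (N * N) + p')) ∧ PushView N A g τ) hD.nn_le (by rw [hD'.nn]; push_cast; rfl) rfl
      rfl ?_ ?_ ?_ ?_
    · intro i τ x hI
      simpa [PushView, Memory.write_of_ne] using hI
    · refine ⟨by simp, ?_⟩
      intro w hw i hi j hj
      rw [hσ _ (by norm_num)]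
      exact hP w hw i hi j hj
    · rintro p hp τ _ hcA hF ⟨h1, h2⟩
      have e1 : τ cJ 0 = v := by rw [hF _ rfl, hσ _ (by norm_num), hcJ]
      have e2 : τ cI 0 = u := by rw [hF _ rfl, hσ _ (by norm_num), hcI]
      have e3 : τ aNN 0 = N * N := by rw [hF _ rfl, hD'.nn]
      obtain ⟨i, hi, j, hj, rfl⟩ := exists_index hp
      refine wp_assign (fun hb => hb _ _) ?_
      simp only [Expr.eval_add, Expr.eval_mul, Expr.eval_get, Expr.eval_zero, e1, e2, e3, hcA]
      constructor
      · intro p' hp'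
        obtain ⟨i', hi', j', hj', rfl⟩ := exists_index (show p' < N * N by omega)
        rw [Memory.write_self, Function.update_apply]
        push_cast
        split_ifs with heq
        · rw [h2 u hu i hi j hj, add_left_cancel heq, hP u hu i hi j hj]
        · rw [index_inj_iff₂ hi' hj' hi hj] at heq
          have := h1 (i' * N + j') (by
            rcases Nat.lt_succ_iff_lt_or_eq.1 hp' with h | h
            · exact h
            · obtain ⟨h3, h4⟩ := index_inj hj' hj h
              exact absurd ⟨rfl, h3, h4⟩ heq)
          push_cast at this
          exact this
      · intro w hw i' hi' j' hj'
        rw [Memory.write_self, Function.update_apply]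
        push_cast
        rw [if_neg, h2 w hw i' hi' j' hj']
        rw [index_inj_iff₂ hi' hj' hi hj]
        rintro ⟨rfl, _⟩
        exact hv hw
    · rintro τ _ ⟨h1, h2⟩
      refine ⟨fun i hi j hj => ?_, h2⟩
      have := h1 _ (index_lt hi hj)
      push_cast at this
      rw [this, hP u hu i hi j hj]
  · rintro τ _ hF ⟨h1, h2⟩
    have e1 : τ cJ 0 = v := by rw [hF _ rfl, hσ _ (by norm_num), hcJ]
    have e2 : τ cI 0 = u := by rw [hF _ rfl, hσ _ (by norm_num), hcI]
    have e3 : τ aNN 0 = N * N := by rw [hF _ rfl, hD'.nn]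
    have e4 : τ aN1 0 = N := by rw [hF _ rfl, hD'.n1]
    have p1 : push (g u) u v u v = g u u v - 1 := by simp [push, hne]
    have p2 : push (g u) u v v u = g u v u + 1 := by simp [push, hne, hne.symm]
    have hne' : ¬ (v : ℤ) * (N * N) + (v * N + u) = v * (N * N) + (u * N + v) := by
      rw [index_inj_iff₂ hvN huN huN hvN]
      omega
    refine wp_seq (wp_assign (fun _ => ?_) (wp_assign (fun _ => ?_) ⟨?_, ?_⟩))
    · have := hsm u huN v hvN
      simpa [e1, e2, e3, e4, h1 u huN v hvN, p1] using this
    · have := hsm v hvN u huN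
      simp only [Expr.eval_add, Expr.eval_sub, Expr.eval_mul, Expr.eval_get, Expr.eval_zero, Expr.eval_one, e1,
        e2, e3, e4, Memory.write_self, Memory.write_of_ne _ _ _ (show cJ ≠ aPush by norm_num),
        Memory.write_of_ne _ _ _ (show cI ≠ aPush by norm_num),
        Memory.write_of_ne _ _ _ (show aNN ≠ aPush by norm_num),
        Memory.write_of_ne _ _ _ (show aN1 ≠ aPush by norm_num), Function.update_apply, if_neg hne',
        h1 v hvN u huN]
      rwa [p2] at this
    · intro w hw
      rw [Memory.write_of_ne _ _ _ (by norm_num), Memory.write_of_ne _ _ _ (by norm_num), hF _ rfl]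
      exact hR' w hw
    · intro w hw i hi j hj
      simp only [Expr.eval_add, Expr.eval_sub, Expr.eval_mul, Expr.eval_get, Expr.eval_zero, Expr.eval_one, e1,
        e2, e3, e4, Memory.write_self, Memory.write_of_ne _ _ _ (show cJ ≠ aPush by norm_num),
        Memory.write_of_ne _ _ _ (show cI ≠ aPush by norm_num),
        Memory.write_of_ne _ _ _ (show aNN ≠ aPush by norm_num),
        Memory.write_of_ne _ _ _ (show aN1 ≠ aPush by norm_num), Function.update_apply, if_neg hne',
        h1 v hvN u huN, h1 u huN v hvN, index_inj_iff₂ hi hj hvN huN, index_inj_iff₂ hi hj huN hvN]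
      rcases Finset.mem_insert.1 hw with rfl | hw'
      · by_cases c1 : i = w ∧ j = u
        · rw [if_pos ⟨rfl, c1⟩, if_pos rfl, c1.1, c1.2, p2]
        · rw [if_neg (by tauto), if_pos rfl]
          by_cases c2 : i = u ∧ j = w
          · rw [if_pos ⟨rfl, c2⟩, c2.1, c2.2, p1]
          · rw [if_neg (by tauto), h1 i hi j hj, push, if_neg c2, if_neg c1]
            ring
      · have hwv : w ≠ v := by
          rintro rfl
          exact hv hw'
        rw [if_neg (by tauto), if_neg (by tauto), if_neg hwv, h2 w hw' i hi j hj]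

/-- Vertices reached during the round may be scanned in the same round. Only the successors of the
vertices that were present at its beginning are guaranteed, which is enough for the progress
argument. -/
theorem searchRound_spec {m N s t : ℕ} {f : ℕ → ℕ → ℤ} {A : Finset ℕ} {g : ℕ → ℕ → ℕ → ℤ}
    {σ : Memory} (hD : NetDim m N s t σ)
    (hsmall : ∀ i < N, ∀ j < N, ∀ z, 0 ≤ z → z ≤ f i j + f j i → Small m z)
    (hf : MatView N aRes f σ)
    (hS : Searched N s f A g) (hR : ReachView N A σ) (hP : PushView N A g σ) :
    wp m searchRound (fun τ => ∃ A' g', A ⊆ A' ∧ Searched N s f A' g' ∧ ReachView N A' τ ∧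
      PushView N A' g' τ ∧ ∀ u ∈ A, ∀ v < N, 0 < f u v → v ∈ A') σ := by
  refine wp_for N (fun u τ => ∃ A' g', A ⊆ A' ∧ Searched N s f A' g' ∧ ReachView N A' τ ∧
      PushView N A' g' τ ∧ ∀ u' < u, u' ∈ A → ∀ v < N, 0 < f u' v → v ∈ A') hD.n_le hD.n1 rfl
      rfl ?_ ?_ ?_ ?_
  · intro i τ x hI
    simpa [ReachView, PushView, Memory.write_of_ne] using hI
  · exact ⟨A, g, subset_rfl, hS, hR, hP, by simp⟩
  · rintro u hu τ _ hcI hF ⟨A₁, g₁, hA₁, hS₁, hR₁, hP₁, hcl₁⟩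
    have hD₁ : NetDim m N s t τ := hD.frame hF rfl
    refine wp_for N (fun v τ => ∃ A' g', A ⊆ A' ∧ Searched N s f A' g' ∧ ReachView N A' τ ∧
      PushView N A' g' τ ∧ (∀ u' < u, u' ∈ A → ∀ v < N, 0 < f u' v → v ∈ A') ∧
      ∀ v' < v, u ∈ A → 0 < f u v' → v' ∈ A') hD₁.n_le hD₁.n1 rfl rfl ?_ ?_ ?_ ?_
    · intro i τ x hI
      simpa [ReachView, PushView, Memory.write_of_ne] using hI
    · exact ⟨A₁, g₁, hA₁, hS₁, hR₁, hP₁, hcl₁, by simp⟩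
    · rintro v hv υ _ hcJ hFυ ⟨A₂, g₂, hA₂, hS₂, hR₂, hP₂, hcl₂, hcl₃⟩
      have hD₂ : NetDim m N s t υ := hD₁.frame hFυ rfl
      have hcI₂ : υ cI 0 = u := by rw [hFυ _ rfl, hcI]
      have hf₂ : υ aRes (u * N + v) = f u v := by rw [hFυ _ rfl, hF _ rfl, hf u hu v hv]
      have hskip : (u ∈ A₂ → 0 < f u v → v ∈ A₂) →
          wp m .skip (fun τ => ∃ A' g', A ⊆ A' ∧ Searched N s f A' g' ∧ ReachView N A' τ ∧
            PushView N A' g' τ ∧ (∀ u' < u, u' ∈ A → ∀ v < N, 0 < f u' v → v ∈ A') ∧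
            ∀ v' < v + 1, u ∈ A → 0 < f u v' → v' ∈ A') υ := by
        intro h
        refine wp_skip ⟨A₂, g₂, hA₂, hS₂, hR₂, hP₂, hcl₂, fun v' hv' hu' hpos => ?_⟩
        rcases Nat.lt_succ_iff_lt_or_eq.1 hv' with hlt | rfl
        · exact hcl₃ v' hlt hu' hpos
        · exact h (hA₂ hu') hpos
      refine wp_ite (fun h1 => wp_ite (fun h2 => wp_ite (fun h3 => ?_) fun h3 => ?_) fun h2 => ?_)
        fun h1 => ?_
      all_goals
        simp only [Expr.eval_add, Expr.eval_sub, Expr.eval_mul, Expr.eval_get, Expr.eval_zero,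
          Expr.eval_one, hcI₂, hcJ, hR₂ u hu, hD₂.n1] at h1
      all_goals
        try simp only [Expr.eval_add, Expr.eval_sub, Expr.eval_mul, Expr.eval_get, Expr.eval_zero,
          Expr.eval_one, hcI₂, hcJ, hR₂ v hv, hD₂.n1] at h2
      all_goals
        try simp only [Expr.eval_add, Expr.eval_sub, Expr.eval_mul, Expr.eval_get, Expr.eval_zero,
          Expr.eval_one, hcI₂, hcJ, hD₂.n1, hf₂] at h3
      · have hu₂ : u ∈ A₂ := by
          by_contra hn
          simp [hn] at h1
        have hv₂ : v ∉ A₂ := by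
          intro hn
          simp [hn] at h2
        refine wp_mono (pushStep_spec hD₂ hsmall hS₂ hR₂ hP₂ hu₂ hv₂ hv h3 hcI₂ hcJ) ?_
        rintro κ _ _ ⟨hR₃, hP₃⟩
        refine ⟨_, _, hA₂.trans (Finset.subset_insert _ _), hS₂.step hu₂ hv₂ hv h3, hR₃, hP₃, ?_, ?_⟩
        · intro u' hu' hA' v' hv' hpos
          exact Finset.mem_insert_of_mem (hcl₂ u' hu' hA' v' hv' hpos)
        · intro v' hv' hu' hpos
          rcases Nat.lt_succ_iff_lt_or_eq.1 hv' with hlt | rfl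
          · exact Finset.mem_insert_of_mem (hcl₃ v' hlt hu' hpos)
          · exact Finset.mem_insert_self _ _
      · exact hskip fun _ hpos => absurd hpos h3
      · refine hskip fun _ _ => ?_
        by_contra hn
        simp [hn] at h2
      · refine hskip fun hu' => ?_
        simp [hu'] at h1
    · rintro υ _ ⟨A₂, g₂, hA₂, hS₂, hR₂, hP₂, hcl₂, hcl₃⟩
      refine ⟨A₂, g₂, hA₂, hS₂, hR₂, hP₂, fun u' hu' hA' v hv hpos => ?_⟩
      rcases Nat.lt_succ_iff_lt_or_eq.1 hu' with hlt | rfl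
      · exact hcl₂ u' hlt hA' v hv hpos
      · exact hcl₃ v hv hA' hpos
  · rintro τ _ ⟨A', g', h1, h2, h3, h4, h5⟩
    exact ⟨A', g', h1, h2, h3, h4, fun u hu => h5 u (Finset.mem_range.1 (hS.subset hu)) hu⟩

/-- The set is closed under the arcs of positive residual capacity. -/
def ResClosed (N : ℕ) (f : ℕ → ℕ → ℤ) (A : Finset ℕ) : Prop :=
  ∀ u ∈ A, ∀ v < N, 0 < f u v → v ∈ A

/-- A round that reaches no new vertex proves that the set is closed. Otherwise the set grows, so
after `i` rounds it is closed or has at least `i + 1` members, and for `i = N` the latter is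
impossible. -/
theorem search_spec {m N s t : ℕ} {f : ℕ → ℕ → ℤ} {σ : Memory} (hD : NetDim m N s t σ)
    (hf0 : ∀ i < N, ∀ j < N, 0 ≤ f i j)
    (hsmall : ∀ i < N, ∀ j < N, ∀ z, 0 ≤ z → z ≤ f i j + f j i → Small m z)
    (hf : MatView N aRes f σ) :
    wp m search (fun τ => ∃ A g, Searched N s f A g ∧ ReachView N A τ ∧ PushView N A g τ ∧
      ResClosed N f A) σ := by
  refine wp_then (Q := fun τ => ∀ v : ℕ, v < N → τ aReach v = 0) ?_ ?_
  · refine wp_for N (fun i τ => ∀ v : ℕ, v < i → τ aReach v = 0) hD.n_le hD.n1 rfl rfl ?_ ?_ ?_ ?_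
    · intro i τ x hI
      simpa [Memory.write_of_ne] using hI
    · simp
    · intro i hi τ _ hcA _ hI
      refine wp_assign (fun _ => small_zero m) ?_
      intro v hv
      simp only [Memory.write_self, Expr.eval_get, Expr.eval_zero, hcA, Function.update_apply]
      split_ifs with h
      · rfl
      · exact hI v (by
          have : v ≠ i := by
            rintro rfl
            exact h rfl
          omega)
    · exact fun τ _ hI => hI
  intro τ₁ _ hF₁ hz
  have hD₁ : NetDim m N s t τ₁ := hD.frame hF₁ rfl
  refine wp_seq (wp_assign (fun _ => hD.small_one) ?_)
  set τ₂ := τ₁.write aReach ((var cE).eval τ₁) ((1 : Expr).eval τ₁) with hτ₂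
  have hσ : ∀ a, a ≠ aReach → τ₂ a = τ₁ a := fun a ha => Memory.write_of_ne _ _ _ ha
  have hD₂ : NetDim m N s t τ₂ := hD₁.congr (hσ _ (by norm_num)) (hσ _ (by norm_num))
    (hσ _ (by norm_num)) (hσ _ (by norm_num))
  have hR₂ : ReachView N {s} τ₂ := by
    intro v hv
    simp [hτ₂, hD₁.src, Function.update_apply, hz v hv]
  have hf₂ : MatView N aRes f τ₂ := by
    intro i hi j hj
    rw [hσ _ (by norm_num), hF₁ _ rfl, hf i hi j hj]
  refine wp_then (Q := fun τ => PushView N {s} (fun _ => f) τ) ?_ ?_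
  · refine wp_for (N * N) (fun p τ => ∀ p' < p, τ aPush (s * (N * N) + p') = τ₂ aRes p') hD.nn_le
      (by rw [hD₂.nn]; push_cast; rfl) rfl rfl ?_ ?_ ?_ ?_
    · intro i τ x hI
      simpa [Memory.write_of_ne] using hI
    · simp
    · intro p hp τ _ hcA hF hI
      have e2 : τ cE 0 = s := by rw [hF _ rfl, hD₂.src]
      have e3 : τ aNN 0 = N * N := by rw [hF _ rfl, hD₂.nn]
      have e4 : τ aRes = τ₂ aRes := hF _ rfl
      refine wp_assign (fun hb => hb _ _) ?_
      intro p' hp'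
      simp only [Memory.write_self, Expr.eval_add, Expr.eval_mul, Expr.eval_get, Expr.eval_zero, e2,
        e3, hcA, Function.update_apply, e4]
      split_ifs with h
      · rw [show p' = p by omega]
      · exact hI p' (by
          have : p' ≠ p := by
            rintro rfl
            exact h rfl
          omega)
    · intro τ _ hI v hv i hi j hj
      have := hI _ (index_lt hi hj)
      push_cast at this
      rw [Finset.mem_singleton.1 hv, this, hf₂ i hi j hj]
  intro τ₃ _ hF₃ hP₃
  have hD₃ : NetDim m N s t τ₃ := hD₂.frame hF₃ rfl
  have hR₃ : ReachView N {s} τ₃ := by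
    intro v hv
    rw [hF₃ _ rfl, hR₂ v hv]
  have hf₃ : MatView N aRes f τ₃ := by
    intro i hi j hj
    rw [hF₃ _ rfl, hf₂ i hi j hj]
  refine wp_for N (fun i τ => ∃ A g, Searched N s f A g ∧ ReachView N A τ ∧ PushView N A g τ ∧
      (ResClosed N f A ∨ i + 1 ≤ A.card)) hD.n_le hD₃.n1 rfl rfl ?_ ?_ ?_ ?_
  · intro i τ x hI
    simpa [ReachView, PushView, Memory.write_of_ne] using hI
  · exact ⟨{s}, _, Searched.init hD.s_lt hf0, hR₃, hP₃, Or.inr (by simp)⟩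
  · rintro i hi τ _ _ hF ⟨A, g, hS, hR, hP, hA⟩
    have hD₄ : NetDim m N s t τ := hD₃.frame hF rfl
    have hf₄ : MatView N aRes f τ := by
      intro i hi j hj
      rw [hF _ rfl, hf₃ i hi j hj]
    refine wp_mono (searchRound_spec hD₄ hsmall hf₄ hS hR hP) ?_
    rintro υ _ _ ⟨A', g', hAA', hS', hR', hP', hcl⟩
    refine ⟨A', g', hS', hR', hP', ?_⟩
    by_cases heq : A' = A
    · left
      rw [heq] at hcl ⊢
      exact hcl
    -- A set that is already closed cannot grow, since `subset_closed` confines the reached vertices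
    -- to every closed set that contains the source.
    · rcases hA with hA | hA
      · exact absurd (Finset.Subset.antisymm (hS'.subset_closed A hS.source hA) hAA') heq
      · right
        have := Finset.card_lt_card (Finset.ssubset_iff_subset_ne.2 ⟨hAA', Ne.symm heq⟩)
        omega
  · rintro τ _ ⟨A, g, hS, hR, hP, hA⟩
    refine ⟨A, g, hS, hR, hP, ?_⟩
    rcases hA with hA | hA
    · exact hA
    · have := Finset.card_le_card hS.subset
      rw [Finset.card_range] at this
      omega

/-! ### Residual networks and capacity scaling -/

theorem ResClosed.cut_eq_zero {N : ℕ} {f : ℕ → ℕ → ℤ} {A : Finset ℕ}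
    (hA : ResClosed N f A) (hf : ∀ i < N, ∀ j < N, 0 ≤ f i j) : cut N f A = 0 := by
  refine StackMST.cut_eq_zero fun u hu v hv huA hvA => ?_
  by_contra hne
  exact hvA (hA u huA v hv (lt_of_le_of_ne (hf u hu v hv) (Ne.symm hne)))

/-- `f` is the residual network of some flow from `s` to `t` with respect to the capacities `c`. -/
structure Residual (N s t : ℕ) (c f : ℕ → ℕ → ℤ) : Prop where
  nonneg : ∀ i < N, ∀ j < N, 0 ≤ f i j
  symm : ∀ i < N, ∀ j < N, f i j + f j i = c i j + c j i
  cut_eq : ∃ F, ∀ S, s ∈ S → t ∉ S → cut N f S = cut N c S - F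

/-- No flow is ever represented: all that matters is that the cuts between `s` and `t` have lost one
common amount `F`, which is `Residual.cut_eq`. If `t` is reached, its stored network is the new
residual network, and `F` grows by one; if not, the reached set is a cut of residual capacity zero.
-/
theorem augment_spec {m N s t : ℕ} {c f : ℕ → ℕ → ℤ} {σ : Memory} (hD : NetDim m N s t σ)
    (hsmall : ∀ i < N, ∀ j < N, ∀ z, 0 ≤ z → z ≤ c i j + c j i → Small m z)
    (hf : MatView N aRes f σ) (hc : Residual N s t c f) :
    wp m augment (fun τ => ∃ f', MatView N aRes f' τ ∧ Residual N s t c f' ∧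
      ((∃ S, s ∈ S ∧ t ∉ S ∧ cut N f' S = 0) ∨
        ∀ S, s ∈ S → t ∉ S → cut N f' S = cut N f S - 1)) σ := by
  refine wp_then (search_spec hD hc.nonneg (fun i hi j hj z h0 hz =>
    hsmall i hi j hj z h0 (by rwa [← hc.symm i hi j hj])) hf) ?_
  rintro τ _ hF ⟨A, g, hS, hR, hP, hcl⟩
  have hD' : NetDim m N s t τ := hD.frame hF rfl
  have hf' : MatView N aRes f τ := by
    intro i hi j hj
    rw [hF _ rfl, hf i hi j hj]
  refine wp_ite (fun h => ?_) (fun h => wp_skip ⟨f, hf', hc, Or.inl ⟨A, hS.source, ?_, ?_⟩⟩)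
  · simp only [Expr.eval_get, Expr.eval_zero, hD'.snk, hR t hD.t_lt] at h
    have ht : t ∈ A := by
      by_contra hn
      simp [hn] at h
    have hcut : ∀ S, s ∈ S → t ∉ S → cut N (g t) S = cut N f S - 1 := by
      intro S h1 h2
      rw [hS.cut_eq t ht, if_pos h1, if_neg h2, add_zero]
    refine wp_for (N * N) (fun p τ' => ∀ p' < p, τ' aRes p' = τ aPush (t * (N * N) + p')) hD.nn_le
      (by rw [hD'.nn]; push_cast; rfl) rfl rfl ?_ ?_ ?_ ?_
    · intro i τ x hI
      simpa [Memory.write_of_ne] using hI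
    · simp
    · intro p hp υ _ hcA hFυ hI
      have e2 : υ aN 0 = t := by rw [hFυ _ rfl, hD'.snk]
      have e3 : υ aNN 0 = N * N := by rw [hFυ _ rfl, hD'.nn]
      have e4 : υ aPush = τ aPush := hFυ _ rfl
      refine wp_assign (fun hb => hb _ _) ?_
      intro p' hp'
      simp only [Memory.write_self, Expr.eval_add, Expr.eval_mul, Expr.eval_get, Expr.eval_zero, e2,
        e3, hcA, Function.update_apply, e4]
      split_ifs with h
      · rw [show p' = p by omega]
      · exact hI p' (by
          have : p' ≠ p := by
            rintro rfl
            exact h rfl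
          omega)
    · intro υ _ hI
      refine ⟨g t, fun i hi j hj => ?_, ⟨hS.nonneg t ht, fun i hi j hj => ?_, ?_⟩, Or.inr hcut⟩
      · have := hI _ (index_lt hi hj)
        push_cast at this
        rw [this, hP t ht i hi j hj]
      · rw [hS.symm t ht i hi j hj, hc.symm i hi j hj]
      · obtain ⟨F, hFl⟩ := hc.cut_eq
        refine ⟨F + 1, fun S h1 h2 => ?_⟩
        rw [hcut S h1 h2, hFl S h1 h2]
        ring
  · intro ht
    simp [hD'.snk, hR t hD.t_lt, ht] at h
  · exact hcl.cut_eq_zero hc.nonneg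

/-- The difference is the parity of `c / p`. When `p` is a power of two, this is the binary digit of
`c` that the next phase takes into account. -/
theorem ediv_sub_two_mul_ediv (c : ℤ) {p : ℤ} (hp : 0 < p) :
    0 ≤ c / p - 2 * (c / (2 * p)) ∧ c / p - 2 * (c / (2 * p)) ≤ 1 := by
  have : c / (2 * p) = c / p / 2 := by
    rw [mul_comm, Int.ediv_ediv_of_nonneg hp.le]
  rw [this]
  omega

/-- Doubling a residual network for the capacities `c / (2 * p)` doubles the flow as well, and the
new digits are added to the capacities and to the residual capacities alike. So the new amount is `2
* F`. -/
theorem Residual.refine {N s t : ℕ} {c f : ℕ → ℕ → ℤ} {p : ℤ} (hp : 0 < p)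
    (h : Residual N s t (fun i j => c i j / (2 * p)) f) :
    Residual N s t (fun i j => c i j / p)
      (fun i j => 2 * f i j + (c i j / p - 2 * (c i j / (2 * p)))) := by
  refine ⟨fun i hi j hj => ?_, fun i hi j hj => ?_, ?_⟩
  · have h1 := h.nonneg i hi j hj
    have h2 := (ediv_sub_two_mul_ediv (c i j) hp).1
    linarith
  · have := h.symm i hi j hj
    linarith
  · obtain ⟨F, hF⟩ := h.cut_eq
    refine ⟨2 * F, fun S h1 h2 => ?_⟩
    have e : cut N (fun i j => 2 * f i j + (c i j / p - 2 * (c i j / (2 * p)))) S =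
        cut N (fun i j => (c i j / p + (-2) * (c i j / (2 * p))) + 2 * f i j) S :=
      cut_congr (fun _ _ _ _ => by ring) S
    rw [e, cut_linear, cut_linear, hF S h1 h2]
    ring

/-- Doubling keeps the cut at zero, and each of the at most `N * N` arcs gains at most one unit. -/
theorem cut_refine_le {N : ℕ} {c f : ℕ → ℕ → ℤ} {p : ℤ} (hp : 0 < p) {S : Finset ℕ}
    (h : cut N f S = 0) :
    cut N (fun i j => 2 * f i j + (c i j / p - 2 * (c i j / (2 * p)))) S ≤ N * N := by
  have e : cut N (fun i j => 2 * f i j + (c i j / p - 2 * (c i j / (2 * p)))) S =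
      cut N (fun i j => (c i j / p - 2 * (c i j / (2 * p))) + 2 * f i j) S :=
    cut_congr (fun _ _ _ _ => by ring) S
  rw [e, cut_linear, h, mul_zero, add_zero, cut]
  have : ∑ u ∈ Finset.range N, ∑ v ∈ Finset.range N, (1 : ℤ) = N * N := by simp
  rw [← this]
  refine Finset.sum_le_sum fun u _ => Finset.sum_le_sum fun v _ => ?_
  split_ifs
  · exact (ediv_sub_two_mul_ediv (c u v) hp).2
  · norm_num

/-- One phase of the scaling algorithm. -/
theorem phase_spec {m N s t : ℕ} {c f : ℕ → ℕ → ℤ} {p : ℤ} {σ : Memory} (hD : NetDim m N s t σ)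
    (hc0 : ∀ i < N, ∀ j < N, 0 ≤ c i j)
    (hsmall : ∀ i < N, ∀ j < N, ∀ z, 0 ≤ z → z ≤ c i j + c j i → Small m z)
    (hc : MatView N aCap c σ) (hf : MatView N aRes f σ) (hp : 0 < p) (hps : Small m p)
    (hpow : σ aPow 0 = 2 * p)
    (hr : Residual N s t (fun i j => c i j / (2 * p)) f)
    (hS : ∃ S, s ∈ S ∧ t ∉ S ∧ cut N f S = 0) :
    wp m (refineRes ;; forLoop cG aNN augment) (fun τ => τ aPow 0 = p ∧ ∃ f', MatView N aRes f' τ ∧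
      Residual N s t (fun i j => c i j / p) f' ∧ ∃ S, s ∈ S ∧ t ∉ S ∧ cut N f' S = 0) σ := by
  have hr' := hr.refine hp
  have hsmall' : ∀ i < N, ∀ j < N, ∀ z, 0 ≤ z → z ≤ c i j / p + c j i / p → Small m z := by
    intro i hi j hj z h1 h2
    refine hsmall i hi j hj z h1 (h2.trans (add_le_add ?_ ?_))
    · exact Int.ediv_le_self _ (hc0 i hi j hj)
    · exact Int.ediv_le_self _ (hc0 j hj i hi)
  refine wp_then (Q := fun τ => τ aPow 0 = p ∧
    MatView N aRes (fun i j => 2 * f i j + (c i j / p - 2 * (c i j / (2 * p)))) τ) ?_ ?_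
  · have hp2 : 2 * p / 2 = p := by omega
    refine wp_seq (wp_assign (fun _ => by simpa [hpow, hp2] using hps) ?_)
    set σ' := σ.write aPow ((0 : Expr).eval σ) ((var aPow / 2).eval σ) with hσ'
    have hσ : ∀ a, a ≠ aPow → σ' a = σ a := fun a ha => Memory.write_of_ne _ _ _ ha
    have hpow' : σ' aPow 0 = p := by simp [hσ', hpow, hp2]
    refine wp_for (N * N) (fun x τ => (∀ i < N, ∀ j < N, τ aRes (i * N + j) =
      if i * N + j < x then 2 * f i j + (c i j / p - 2 * (c i j / (2 * p))) else f i j)) hD.nn_le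
      (by rw [hσ _ (by norm_num), hD.nn]; push_cast; rfl) rfl rfl ?_ ?_ ?_ ?_
    · intro i τ x hI
      simpa [Memory.write_of_ne] using hI
    · intro i hi j hj
      simpa [hσ] using hf i hi j hj
    · intro x hx τ _ hcA hF hI
      obtain ⟨i, hi, j, hj, rfl⟩ := exists_index hx
      have e1 : τ aPow 0 = p := by rw [hF _ rfl, hpow']
      have e2 : τ aCap (i * N + j) = c i j := by rw [hF _ rfl, hσ _ (by norm_num), hc i hi j hj]
      have e3 : τ aRes (i * N + j) = f i j := by simpa using hI i hi j hj
      push_cast at hcA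
      have hval : (2 * rd aRes (var cA) + (rd aCap (var cA) / var aPow -
          2 * (rd aCap (var cA) / (2 * var aPow)))).eval τ =
          2 * f i j + (c i j / p - 2 * (c i j / (2 * p))) := by
        simp [e1, e2, e3, hcA]
      refine wp_assign (fun _ => ?_) ?_
      · rw [hval]
        have h1 := hr'.nonneg i hi j hj
        have h2 := hr'.nonneg j hj i hi
        have h3 := hr'.symm i hi j hj
        exact hsmall' i hi j hj _ h1 (by omega)
      · intro i' hi' j' hj'
        rw [hval]
        simp only [Memory.write_self, Expr.eval_get, Expr.eval_zero, hcA, Function.update_apply,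
          index_inj_iff hj' hj]
        split_ifs with h1 h2 h2
        · rw [h1.1, h1.2]
        · rw [h1.1, h1.2] at h2
          omega
        · rw [hI i' hi' j' hj', if_pos]
          rcases Nat.lt_succ_iff_lt_or_eq.1 h2 with h | h
          · exact h
          · exact absurd (index_inj hj' hj h) h1
        · rw [hI i' hi' j' hj', if_neg (by omega)]
    · intro τ hF hI
      refine ⟨by rw [hF _ rfl, hpow'], fun i hi j hj => ?_⟩
      rw [hI i hi j hj, if_pos (index_lt hi hj)]
  · rintro τ _ hF ⟨hpow', hf'⟩
    have hD' : NetDim m N s t τ := hD.frame hF rfl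
    -- The residual capacity of some cut is the potential. Each augmentation either exhibits a cut
    -- of capacity zero or lowers all cuts by one, so `N * N` augmentations bring some cut to zero.
    refine wp_for (N * N) (fun x τ => ∃ f', MatView N aRes f' τ ∧
      Residual N s t (fun i j => c i j / p) f' ∧
      ∃ S, s ∈ S ∧ t ∉ S ∧ cut N f' S ≤ max (0 : ℤ) ((N : ℤ) * N - x)) hD.nn_le
      (by rw [hD'.nn]; push_cast; rfl) rfl rfl ?_ ?_ ?_ ?_
    · intro i τ x hI
      simpa [MatView, Memory.write_of_ne] using hI
    · obtain ⟨S, h1, h2, h3⟩ := hS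
      refine ⟨_, hf', hr', S, h1, h2, (cut_refine_le hp h3).trans ?_⟩
      simp
    · rintro x hx υ _ _ hFυ ⟨f₁, hf₁, hr₁, S, h1, h2, h3⟩
      have hDυ : NetDim m N s t υ := hD'.frame hFυ rfl
      refine wp_mono (augment_spec hDυ hsmall' hf₁ hr₁) ?_
      rintro κ _ _ ⟨f₂, hf₂, hr₂, ⟨S', h4, h5, h6⟩ | h4⟩
      · exact ⟨f₂, hf₂, hr₂, S', h4, h5, by rw [h6]; exact le_max_left _ _⟩
      · refine ⟨f₂, hf₂, hr₂, S, h1, h2, ?_⟩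
        rw [h4 S h1 h2]
        have h6 : (x : ℤ) < N * N := by exact_mod_cast hx
        rw [max_eq_right (by linarith)] at h3
        rw [max_eq_right (by push_cast; linarith)]
        push_cast
        linarith
    · rintro υ hFυ ⟨f₁, hf₁, hr₁, S, h1, h2, h3⟩
      refine ⟨by rw [hFυ _ rfl, hpow'], f₁, hf₁, hr₁, S, h1, h2, le_antisymm ?_ (cut_nonneg hr₁.nonneg S)⟩
      simpa using h3

/-- After the last phase some cut has residual capacity zero, so a final search cannot reach `t`,
and its set `A` has residual capacity zero too. Residual capacities of cuts are non-negative and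
differ from the original ones by the same `F`, hence `A` is minimum. The largest intermediate
numbers are powers of two and sums of capacities, at most `2 * (N * N) * C`. -/
theorem minCut_spec {m N s t : ℕ} {c : ℕ → ℕ → ℤ} {C : ℤ} {σ : Memory} (hD : NetDim m N s t σ)
    (hst : s ≠ t) (hc0 : ∀ i < N, ∀ j < N, 0 ≤ c i j) (hcC : ∀ i < N, ∀ j < N, c i j ≤ C)
    (hC : 1 ≤ C) (hsm : 2 * (N * N) * C < 2 ^ m) (hc : MatView N aCap c σ) :
    wp m minCut (fun τ => ∃ A, s ∈ A ∧ t ∉ A ∧ A ⊆ Finset.range N ∧ ReachView N A τ ∧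
      ∀ S, s ∈ S → t ∉ S → cut N c A ≤ cut N c S) σ := by
  have hN : (1 : ℤ) ≤ N * N := by
    have := hD.s_lt
    have : (1 : ℤ) ≤ N := by omega
    nlinarith
  have hNC : (1 : ℤ) ≤ N * N * C := by nlinarith
  have hsmall : ∀ z, 0 ≤ z → z ≤ 2 * (N * N * C) → Small m z := by
    intro z h1 h2
    rw [Small, abs_of_nonneg h1]
    linarith
  have hCN : C ≤ N * N * C := by nlinarith
  have hsmall₂ : ∀ i < N, ∀ j < N, ∀ z, 0 ≤ z → z ≤ c i j + c j i → Small m z := by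
    intro i hi j hj z h1 h2
    have h3 := hcC i hi j hj
    have h4 := hcC j hj i hi
    exact hsmall z h1 (by linarith)
  set T : ℤ := ∑ p ∈ Finset.range (N * N), σ aCap p with hT
  have hcell : ∀ p < N * N, 0 ≤ σ aCap p ∧ σ aCap p ≤ C := by
    intro p hp
    obtain ⟨i, hi, j, hj, rfl⟩ := exists_index hp
    push_cast
    rw [hc i hi j hj]
    exact ⟨hc0 i hi j hj, hcC i hi j hj⟩
  have hpart : ∀ x ≤ N * N, 0 ≤ ∑ p ∈ Finset.range x, σ aCap p ∧
      ∑ p ∈ Finset.range x, σ aCap p ≤ N * N * C := by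
    intro x hx
    refine ⟨Finset.sum_nonneg fun p hp => (hcell p ((Finset.mem_range.1 hp).trans_le hx)).1, ?_⟩
    refine (Finset.sum_le_card_nsmul _ _ C fun p hp =>
      (hcell p ((Finset.mem_range.1 hp).trans_le hx)).2).trans ?_
    rw [Finset.card_range, nsmul_eq_mul]
    have : (x : ℤ) ≤ N * N := by exact_mod_cast hx
    nlinarith
  have hcT : ∀ i < N, ∀ j < N, c i j ≤ T := by
    intro i hi j hj
    rw [← hc i hi j hj]
    have := Finset.single_le_sum (f := fun p : ℕ => σ aCap p) (s := Finset.range (N * N))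
      (fun p hp => (hcell p (Finset.mem_range.1 hp)).1) (Finset.mem_range.2 (index_lt hi hj))
    push_cast at this
    exact this
  refine wp_seq (wp_assign (fun _ => small_zero m) ?_)
  set σ₁ := σ.write aTot ((0 : Expr).eval σ) ((0 : Expr).eval σ) with hσ₁
  have hσ : ∀ a, a ≠ aTot → σ₁ a = σ a := fun a ha => Memory.write_of_ne _ _ _ ha
  refine wp_then (Q := fun τ => τ aTot 0 = T) ?_ ?_
  · refine wp_for (N * N) (fun x τ => τ aTot 0 = ∑ p ∈ Finset.range x, σ aCap p) hD.nn_le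
      (by rw [hσ _ (by norm_num), hD.nn]; push_cast; rfl) rfl rfl ?_ ?_ ?_ ?_
    · intro i τ x hI
      simpa [Memory.write_of_ne] using hI
    · simp [hσ₁]
    · intro x hx τ _ hcA hF hI
      have e1 : τ aCap = σ aCap := by rw [hF _ rfl, hσ _ (by norm_num)]
      have hval : (var aTot + rd aCap (var cA)).eval τ = ∑ p ∈ Finset.range (x + 1), σ aCap p := by
        simp [hI, e1, hcA, Finset.sum_range_succ]
      refine wp_assign (fun _ => ?_) ?_
      · rw [hval]
        have := hpart (x + 1) hx
        exact hsmall _ this.1 (by linarith)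
      · rw [hval]
        simp
    · exact fun τ _ hI => hI
  intro τ₁ _ hF₁ hT₁
  have hτ₁ : ∀ a, a ≠ aTot → a ≠ cA → τ₁ a = σ a := by
    intro a h1 h2
    rw [hF₁ a (by simp [forLoop, Program.touches, Ne.symm h1, Ne.symm h2]), hσ a h1]
  have hT0 : 0 ≤ T ∧ T ≤ N * N * C := hpart _ le_rfl
  have h1s : Small m 1 := hD.small_one
  refine wp_seq (wp_assign (fun _ => h1s) (wp_seq (wp_assign (fun _ => small_zero m) ?_)))
  set τ₂ := (τ₁.write aPow ((0 : Expr).eval τ₁) ((1 : Expr).eval τ₁)).write aPh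
      ((0 : Expr).eval (τ₁.write aPow ((0 : Expr).eval τ₁) ((1 : Expr).eval τ₁)))
      ((0 : Expr).eval (τ₁.write aPow ((0 : Expr).eval τ₁) ((1 : Expr).eval τ₁))) with hτ₂
  -- The total capacity `T` bounds every single capacity. The doubling stops at the first power of
  -- two above `T`, which is at most `2 * (N * N * C)` because a power is doubled only while it is
  -- at most `T`.
  refine wp_then (Q := fun τ => ∃ h ≤ m, τ aPh 0 = (h : ℕ) ∧ τ aPow 0 = 2 ^ h ∧ T < 2 ^ h ∧
    (2 : ℤ) ^ h ≤ 2 * (N * N * C)) ?_ ?_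
  · refine wp_loop (fun (h : ℕ) τ => h ≤ m ∧ τ aPh 0 = (h : ℕ) ∧ τ aPow 0 = 2 ^ h ∧ τ aTot 0 = T ∧
      (2 : ℤ) ^ h ≤ 2 * (N * N * C)) ?_ ?_ ?_
    · refine ⟨Nat.zero_le _, ?_, ?_, ?_, ?_⟩
      · simp [hτ₂]
      · simp [hτ₂, Memory.write_of_ne]
      · simp [hτ₂, Memory.write_of_ne, hT₁]
      · simp
        linarith
    · rintro h τ ⟨hm, h1, h2, h3, h4⟩ hpos
      simp only [Expr.eval_add, Expr.eval_sub, Expr.eval_get, Expr.eval_zero, Expr.eval_one, h2, h3]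
        at hpos
      have h5 : (2 : ℤ) ^ h ≤ T := by linarith
      have h6 : (2 : ℤ) ^ h < 2 ^ m := by linarith
      have h7 : h < m := (pow_lt_pow_iff_right₀ (by norm_num)).1 h6
      have h8 : (2 : ℤ) ^ (h + 1) = 2 * 2 ^ h := pow_succ' _ _
      refine ⟨h7, wp_seq (wp_assign (fun _ => ?_) (wp_assign (fun _ => ?_) ⟨h7, ?_, ?_, ?_, ?_⟩))⟩
      · simp only [Expr.eval_mul, Expr.eval_get, Expr.eval_zero, Expr.eval_ofNat, h2]
        exact hsmall _ (by positivity) (by linarith)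
      · have := small_natCast (m := m) (n := h + 1) (by omega)
        simpa [Memory.write_of_ne, h1] using this
      · simp [Memory.write_of_ne, h1]
      · simp [Memory.write_of_ne, h2, h8]
      · simp [Memory.write_of_ne, h3]
      · linarith
    · rintro h τ ⟨hm, h1, h2, h3, h4⟩ hpos
      simp only [Expr.eval_add, Expr.eval_sub, Expr.eval_get, Expr.eval_zero, Expr.eval_one, h2, h3]
        at hpos
      exact ⟨h, hm, h1, h2, by linarith, h4⟩
  rintro τ₃ _ hF₃ ⟨h, hhm, hph, hpow, hTh, hhs⟩
  have hτ₃ : ∀ a, a ≠ aTot → a ≠ cA → a ≠ aPow → a ≠ aPh → τ₃ a = σ a := by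
    intro a h1 h2 h3 h4
    rw [hF₃ a (by simp [Program.touches, Ne.symm h3, Ne.symm h4]), hτ₂, Memory.write_of_ne _ _ _ h4,
      Memory.write_of_ne _ _ _ h3, hτ₁ a h1 h2]
  have hD₃ : NetDim m N s t τ₃ := by
    apply hD.congr <;> apply hτ₃ <;> norm_num
  refine wp_then (Q := fun τ => MatView N aRes (fun _ _ => 0) τ) ?_ ?_
  · refine wp_for (N * N) (fun x τ => ∀ p : ℕ, p < x → τ aRes p = 0) hD.nn_le
      (by rw [hD₃.nn]; push_cast; rfl) rfl rfl ?_ ?_ ?_ ?_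
    · intro i τ x hI
      simpa [Memory.write_of_ne] using hI
    · simp
    · intro x hx τ _ hcA hF hI
      refine wp_assign (fun _ => small_zero m) ?_
      intro p hp
      simp only [Memory.write_self, Expr.eval_get, Expr.eval_zero, hcA, Function.update_apply]
      split_ifs with hpx
      · rfl
      · exact hI p (by
          have : p ≠ x := by
            rintro rfl
            exact hpx rfl
          omega)
    · intro τ _ hI i hi j hj
      have := hI _ (index_lt hi hj)
      push_cast at this
      exact this
  intro τ₄ _ hF₄ hf₄
  have hD₄ : NetDim m N s t τ₄ := hD₃.frame hF₄ rfl
  have hc₄ : MatView N aCap c τ₄ := by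
    intro i hi j hj
    rw [hF₄ _ rfl, hτ₃ _ (by norm_num) (by norm_num) (by norm_num) (by norm_num), hc i hi j hj]
  refine wp_then (Q := fun τ => ∃ f, MatView N aRes f τ ∧ Residual N s t c f ∧
    ∃ S, s ∈ S ∧ t ∉ S ∧ cut N f S = 0) ?_ ?_
  · refine wp_for h (fun x τ => x ≤ h → τ aPow 0 = 2 ^ (h - x) ∧ ∃ f, MatView N aRes f τ ∧
      Residual N s t (fun i j => c i j / 2 ^ (h - x)) f ∧ ∃ S, s ∈ S ∧ t ∉ S ∧ cut N f S = 0) hhm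
      (by rw [hF₄ _ rfl, hph]) rfl rfl ?_ ?_ ?_ ?_
    · intro i τ x hI
      simpa [MatView, Memory.write_of_ne] using hI
    · intro _
      -- At the coarsest scale all capacities vanish, so the scaling starts from the zero network
      -- with `F = 0` and the zero cut `{s}`.
      have hzero : ∀ i < N, ∀ j < N, c i j / 2 ^ h = 0 := fun i hi j hj =>
        Int.ediv_eq_zero_of_lt (hc0 i hi j hj) ((hcT i hi j hj).trans_lt hTh)
      refine ⟨by rw [hF₄ _ rfl, hpow]; rfl, _, hf₄, ⟨fun _ _ _ _ => le_rfl, ?_, 0, ?_⟩, {s}, ?_⟩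
      · intro i hi j hj
        simp [hzero i hi j hj, hzero j hj i hi]
      · intro S _ _
        rw [sub_zero]
        exact cut_congr (fun i hi j hj => (hzero i hi j hj).symm) S
      · exact ⟨by simp, by simpa using hst.symm, cut_eq_zero fun _ _ _ _ _ _ => rfl⟩
    · rintro x hx τ _ _ hF hI
      obtain ⟨h1, f, h2, h3, h4⟩ := hI hx.le
      have hDτ : NetDim m N s t τ := hD₄.frame hF rfl
      have hcτ : MatView N aCap c τ := by
        intro i hi j hj
        rw [hF _ rfl, hc₄ i hi j hj]
      have hpe : (2 : ℤ) ^ (h - x) = 2 * 2 ^ (h - (x + 1)) := by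
        rw [← pow_succ']
        congr 1
        omega
      rw [hpe] at h1
      simp only [hpe] at h3
      refine wp_mono (phase_spec hDτ hc0 hsmall₂ hcτ h2 (by positivity) ?_ h1 h3 h4)
        fun υ _ _ hυ _ => hυ
      refine hsmall _ (by positivity) (le_trans ?_ hhs)
      exact pow_le_pow_right₀ (by norm_num) (by omega)
    · intro τ _ hI
      obtain ⟨_, f, h2, h3, h4⟩ := hI le_rfl
      refine ⟨f, h2, ?_, h4⟩
      simpa using h3
  rintro τ₅ _ hF₅ ⟨f, hf, hr, S₀, hs₀, ht₀, hS₀⟩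
  have hD₅ : NetDim m N s t τ₅ := hD₄.frame hF₅ rfl
  refine wp_mono (search_spec hD₅ hr.nonneg (fun i hi j hj z h0 hz =>
    hsmall₂ i hi j hj z h0 (by rwa [← hr.symm i hi j hj])) hf) ?_
  rintro τ₆ _ _ ⟨A, g, hS, hR, _, hcl⟩
  -- Pushing one more unit to `t` would give the cut `S₀` the residual capacity `-1`.
  have htA : t ∉ A := by
    intro ht
    have h1 := cut_nonneg (hS.nonneg t ht) S₀
    rw [hS.cut_eq t ht, if_pos hs₀, if_neg ht₀, hS₀] at h1
    norm_num at h1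
  refine ⟨A, hS.source, htA, hS.subset, hR, fun S h1 h2 => ?_⟩
  obtain ⟨F, hFl⟩ := hr.cut_eq
  have h3 := hFl A hS.source htA
  have h4 := hFl S h1 h2
  have h5 := hcl.cut_eq_zero hr.nonneg
  have h6 := cut_nonneg hr.nonneg S
  linarith

/-! ## The forest inequalities -/

namespace Instance

variable (I : Instance)

theorem rank_pos (e : Fin I.r) : 0 < I.rank e :=
  Finset.card_pos.2 ⟨I.cost e, by simp [costSet]⟩

/-- In the increasing enumeration of the costs, `rank e` is one more than the position of the cost
of `e` counted from zero, and `c (l + 1)` is the entry at position `l`. For `i = 0` both sides fail,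
since `c 0 = 0` and all costs are positive. The program can thus decide membership from ranks,
without sorting. -/
theorem mem_R_iff {i : ℕ} (hi : i ≤ I.k) (e : Fin I.r) : e ∈ I.R i ↔ I.rank e ≤ i := by
  have hmem : I.cost e ∈ I.costSet := by simp [costSet]
  obtain ⟨j, hj⟩ : I.cost e ∈ Set.range (I.costSet.orderEmbOfFin (rfl : I.costSet.card = I.k)) := by
    rw [Finset.range_orderEmbOfFin]
    exact hmem
  have hrank : I.rank e = j + 1 := by
    have : I.costSet.filter (· ≤ I.cost e) =
        (Finset.Iic j).map (I.costSet.orderEmbOfFin (rfl : I.costSet.card = I.k)).toEmbedding := by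
      ext x
      simp only [Finset.mem_filter, Finset.mem_map, Finset.mem_Iic]
      constructor
      · rintro ⟨hx, hle⟩
        obtain ⟨l, rfl⟩ : x ∈ Set.range (I.costSet.orderEmbOfFin (rfl : I.costSet.card = I.k)) := by
          rw [Finset.range_orderEmbOfFin]
          exact hx
        rw [← hj] at hle
        exact ⟨l, (OrderEmbedding.le_iff_le _).1 hle, rfl⟩
      · rintro ⟨l, hl, rfl⟩
        refine ⟨Finset.orderEmbOfFin_mem _ _ _, ?_⟩
        rw [← hj]
        exact (OrderEmbedding.le_iff_le _).2 hl
    rw [rank, this, Finset.card_map, Fin.card_Iic]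
  rcases Nat.eq_zero_or_pos i with rfl | hpos
  · have h1 : I.c 0 = 0 := by simp [c]
    have h2 := I.cost_pos e
    have h3 : ¬ e ∈ I.R 0 := by
      simp only [R, Set.mem_ofPred_eq, h1]
      exact not_le.2 h2
    have h4 := I.rank_pos e
    exact ⟨fun h => absurd h h3, fun h => by omega⟩
  · obtain ⟨l, rfl⟩ : ∃ l, i = l + 1 := ⟨i - 1, by omega⟩
    have hc : I.c (l + 1) = I.costSet.orderEmbOfFin (rfl : I.costSet.card = I.k) ⟨l, hi⟩ := by
      rw [Finset.orderEmbOfFin_apply, c, List.getD_cons_succ, List.getD_eq_getElem _ _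
        (by rw [Finset.length_sort]; exact hi)]
      rfl
    rw [hrank]
    simp only [R, Set.mem_ofPred_eq]
    rw [hc, ← hj, OrderEmbedding.le_iff_le, Fin.le_def]
    simp

/-- The labels of the vertices distinguish the components, and every component has the label of one
of its vertices. -/
structure IsLabeling (i : ℕ) (lab : Fin I.n → Fin I.n) : Prop where
  reachable : ∀ v, (I.redGraph i).Reachable v (lab v)
  eq_of_edge : ∀ e ∈ I.R i, lab (I.redEnds e).1 = lab (I.redEnds e).2

variable {I} {i : ℕ} {lab : Fin I.n → Fin I.n}

theorem IsLabeling.eq_iff (h : I.IsLabeling i lab) (u v : Fin I.n) :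
    lab u = lab v ↔ (I.redGraph i).Reachable u v := by
  constructor
  · intro huv
    exact (h.reachable u).trans (huv ▸ (h.reachable v).symm)
  · rintro ⟨p⟩
    induction p with
    | nil => rfl
    | cons hadj _ ih =>
      rw [← ih]
      rw [redGraph, SimpleGraph.fromRel_adj] at hadj
      obtain ⟨_, ⟨e, he, h1⟩ | ⟨e, he, h1⟩⟩ := hadj
      · have := h.eq_of_edge e he
        rwa [h1] at this
      · have := h.eq_of_edge e he
        rw [h1] at this
        exact this.symm

theorem IsLabeling.idem (h : I.IsLabeling i lab) (v : Fin I.n) : lab (lab v) = lab v :=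
  (h.eq_iff _ _).2 (h.reachable v).symm

variable (I)

open Classical in
/-- The forest inequality of a family of components. -/
noncomputable def forestIneq (i : Fin I.k) (𝒞 : Finset (I.Component i)) : I.Inequality where
  coeff := fun i' e => if i' = i ∧ e ∈ I.cut i 𝒞 then 1 else 0
  rhs := (𝒞.card : ℤ) - 1

open Classical in
/-- The components whose labels belong to `A`. -/
noncomputable def family (i : ℕ) (lab : Fin I.n → Fin I.n) (A : Finset ℕ) :
    Finset (I.Component i) :=
  (Finset.univ.filter fun v : Fin I.n => v.val ∈ A ∧ lab v = v).image
    (I.redGraph i).connectedComponentMk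

variable {I}

/-- Every component contains exactly one fixed point of `lab`, its label. Elements of `A` that are
not fixed points have no influence on the family. -/
theorem IsLabeling.mem_family (h : I.IsLabeling i lab) {A : Finset ℕ} (v : Fin I.n) :
    (I.redGraph i).connectedComponentMk v ∈ I.family i lab A ↔ (lab v).val ∈ A := by
  classical
  simp only [family, Finset.mem_image, Finset.mem_filter, Finset.mem_univ, true_and,
    SimpleGraph.ConnectedComponent.eq, ← h.eq_iff]
  constructor
  · rintro ⟨u, ⟨h1, h2⟩, h3⟩
    rwa [← h3, h2]
  · exact fun hv => ⟨lab v, ⟨hv, h.idem v⟩, h.idem v⟩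

theorem IsLabeling.card_family (h : I.IsLabeling i lab) (A : Finset ℕ) :
    (I.family i lab A).card =
      (Finset.univ.filter fun v : Fin I.n => v.val ∈ A ∧ lab v = v).card := by
  classical
  rw [family, Finset.card_image_of_injOn]
  intro u hu v hv huv
  simp only [Finset.coe_filter, Finset.mem_univ, true_and, Set.mem_ofPred_eq] at hu hv
  rw [← hu.2, ← hv.2, h.eq_iff]
  exact SimpleGraph.ConnectedComponent.eq.1 huv

theorem mem_cut_iff (𝒞 : Finset (I.Component i)) (e : Fin I.b) : e ∈ I.cut i 𝒞 ↔
    (I.redGraph i).connectedComponentMk (I.blueEnds e).1 ∈ 𝒞 ∧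
    (I.redGraph i).connectedComponentMk (I.blueEnds e).2 ∈ 𝒞 ∧
    (I.redGraph i).connectedComponentMk (I.blueEnds e).1 ≠
      (I.redGraph i).connectedComponentMk (I.blueEnds e).2 := by
  simp only [cut, Finset.mem_filter, Finset.mem_univ, true_and,
    SimpleGraph.ConnectedComponent.mem_supp_iff]
  constructor
  · rintro ⟨C, hC, D, hD, hne, rfl, rfl⟩
    exact ⟨hC, hD, hne⟩
  · rintro ⟨h1, h2, h3⟩
    exact ⟨_, h1, _, h2, h3, rfl, rfl⟩

theorem IsLabeling.mem_cut_family (h : I.IsLabeling i lab) {A : Finset ℕ} (e : Fin I.b) :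
    e ∈ I.cut i (I.family i lab A) ↔ (lab (I.blueEnds e).1).val ∈ A ∧
      (lab (I.blueEnds e).2).val ∈ A ∧ lab (I.blueEnds e).1 ≠ lab (I.blueEnds e).2 := by
  rw [mem_cut_iff, h.mem_family, h.mem_family, Ne, SimpleGraph.ConnectedComponent.eq, ← h.eq_iff]

/-- The labels of the members of `𝒞` form a vertex set of the same size. This is how an arbitrary
family becomes a competitor for a minimum cut in a network on vertices. -/
theorem IsLabeling.exists_family (h : I.IsLabeling i lab) (𝒞 : Finset (I.Component i)) :
    ∃ A : Finset ℕ, A ⊆ Finset.range I.n ∧ I.family i lab A = 𝒞 ∧ A.card = 𝒞.card ∧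
      ∀ v : Fin I.n, v.val ∈ A → lab v = v := by
  classical
  set S := Finset.univ.filter fun v : Fin I.n =>
    (I.redGraph i).connectedComponentMk v ∈ 𝒞 ∧ lab v = v with hS
  have hmem : ∀ v : Fin I.n, v.val ∈ S.map Fin.valEmbedding ↔ v ∈ S := by
    intro v
    simp [Fin.val_inj]
  have hfam : I.family i lab (S.map Fin.valEmbedding) = 𝒞 := by
    ext C
    refine SimpleGraph.ConnectedComponent.ind (fun v => ?_) C
    have hlv : (I.redGraph i).connectedComponentMk (lab v) =
        (I.redGraph i).connectedComponentMk v :=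
      SimpleGraph.ConnectedComponent.eq.2 (h.reachable v).symm
    rw [h.mem_family, hmem, hS, Finset.mem_filter, hlv]
    simp [h.idem]
  refine ⟨S.map Fin.valEmbedding, ?_, hfam, ?_, ?_⟩
  · intro u hu
    obtain ⟨v, _, rfl⟩ := Finset.mem_map.1 hu
    exact Finset.mem_range.2 v.2
  · rw [← hfam, h.card_family, Finset.card_map]
    congr 1
    ext v
    simp only [hmem, Finset.mem_filter, Finset.mem_univ, true_and]
    simp only [hS, Finset.mem_filter, Finset.mem_univ, true_and]
    tauto
  · intro v hv
    rw [hmem, hS, Finset.mem_filter] at hv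
    exact hv.2.2

end Instance

/-! ### The network whose minimum cuts yield the most violated forest inequalities -/

namespace Query

variable (q : Query) (i : Fin q.inst.k) (lab : Fin q.inst.n → Fin q.inst.n)

/-- The label of the first end of a blue edge. -/
def labA (e : Fin q.inst.b) : ℕ := lab (q.inst.blueEnds e).1

/-- The label of the second end of a blue edge. -/
def labB (e : Fin q.inst.b) : ℕ := lab (q.inst.blueEnds e).2

theorem labA_lt (e : Fin q.inst.b) : q.labA lab e < q.inst.n := Fin.is_lt _

theorem labB_lt (e : Fin q.inst.b) : q.labB lab e < q.inst.n := Fin.is_lt _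

/-- The contribution of a blue edge to the weights between the components. -/
def contrib (e : Fin q.inst.b) (u v : ℕ) : ℤ :=
  if q.labA lab e = u ∧ q.labB lab e = v ∧ q.labA lab e ≠ q.labB lab e then max (q.num i e) 0 else 0

/-- The contribution of a blue edge to the outgoing weights of the components. -/
def outContrib (e : Fin q.inst.b) (u : ℕ) : ℤ :=
  if q.labA lab e = u ∧ q.labA lab e ≠ q.labB lab e then max (q.num i e) 0 else 0

/-- The weight between two components. -/
def weight (u v : ℕ) : ℤ := ∑ e, q.contrib i lab e u v

/-- The outgoing weight of a component. -/
def outWeight (u : ℕ) : ℤ := ∑ e, q.outContrib i lab e u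

/-- The capacities, without those that depend on the source. -/
def baseCap (u v : ℕ) : ℤ := if u < q.inst.n ∧ v = q.inst.n then q.den else q.weight i lab u v

/-- The capacities for the source `s` and the sink `n`. -/
def capacity (s u v : ℕ) : ℤ :=
  q.baseCap i lab u v + if u = s ∧ v < q.inst.n then q.outWeight i lab v else 0

variable {q i lab}

theorem outWeight_eq (u : ℕ) :
    q.outWeight i lab u = ∑ v ∈ Finset.range q.inst.n, q.weight i lab u v := by
  simp only [outWeight, weight]
  rw [Finset.sum_comm]
  refine Finset.sum_congr rfl fun e _ => ?_
  rw [Finset.sum_eq_single_of_mem (q.labB lab e) (Finset.mem_range.2 (q.labB_lt lab e))]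
  · simp [outContrib, contrib]
  · intro v _ hv
    rw [contrib, if_neg]
    rintro ⟨_, h, _⟩
    exact hv h.symm

theorem contrib_nonneg (e : Fin q.inst.b) (u v : ℕ) : 0 ≤ q.contrib i lab e u v := by
  rw [contrib]
  split_ifs
  exacts [le_max_right _ _, le_rfl]

theorem outContrib_nonneg (e : Fin q.inst.b) (u : ℕ) : 0 ≤ q.outContrib i lab e u := by
  rw [outContrib]
  split_ifs
  exacts [le_max_right _ _, le_rfl]

theorem contrib_le (e : Fin q.inst.b) (u v : ℕ) : q.contrib i lab e u v ≤ |q.num i e| := by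
  rw [contrib]
  split_ifs
  exacts [max_le (le_abs_self _) (abs_nonneg _), abs_nonneg _]

theorem outContrib_le (e : Fin q.inst.b) (u : ℕ) : q.outContrib i lab e u ≤ |q.num i e| := by
  rw [outContrib]
  split_ifs
  exacts [max_le (le_abs_self _) (abs_nonneg _), abs_nonneg _]

theorem weight_nonneg (u v : ℕ) : 0 ≤ q.weight i lab u v :=
  Finset.sum_nonneg fun e _ => contrib_nonneg e u v

theorem outWeight_nonneg (u : ℕ) : 0 ≤ q.outWeight i lab u :=
  Finset.sum_nonneg fun e _ => outContrib_nonneg e u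

/-- The weights are directed from the first to the second end of an edge, so the sum over ordered
pairs counts every edge once. -/
theorem sum_weight (S : Finset ℕ) : ∑ u ∈ S, ∑ v ∈ S, q.weight i lab u v =
    ∑ e, if q.labA lab e ∈ S ∧ q.labB lab e ∈ S ∧ q.labA lab e ≠ q.labB lab e
      then max (q.num i e) 0 else 0 := by
  have h1 : ∑ u ∈ S, ∑ v ∈ S, q.weight i lab u v =
      ∑ e, ∑ u ∈ S, ∑ v ∈ S, q.contrib i lab e u v := by
    simp only [weight]
    rw [Finset.sum_comm]
    rw [Finset.sum_comm (s := Finset.univ)]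
    rw [Finset.sum_comm]
    refine Finset.sum_congr rfl fun u _ => ?_
    rw [Finset.sum_comm]
  rw [h1]
  refine Finset.sum_congr rfl fun e _ => ?_
  have h2 : ∀ u v, q.contrib i lab e u v = if q.labA lab e = u then
      (if q.labB lab e = v then (if q.labA lab e ≠ q.labB lab e then max (q.num i e) 0 else 0) else 0)
      else 0 := by
    intro u v
    rw [contrib]
    split_ifs <;> tauto
  simp only [h2, Finset.sum_ite_irrel, Finset.sum_ite_eq, Finset.sum_const_zero]
  split_ifs <;> tauto

/-- The value of a cut of the network with the source `s`. -/
theorem cut_capacity {s : ℕ} {S : Finset ℕ} (hs : s ∈ S) (hS : S ⊆ Finset.range q.inst.n) :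
    cut (q.inst.n + 1) (q.capacity i lab s) S =
      q.den * S.card - ∑ u ∈ S, ∑ v ∈ S, q.weight i lab u v +
        ∑ v ∈ Finset.range q.inst.n, q.outWeight i lab v := by
  have hn : q.inst.n ∉ S := fun h => by simpa using hS h
  have hfil : (Finset.range q.inst.n).filter (· ∈ S) = S := by
    ext u
    rw [Finset.mem_filter]
    exact ⟨fun h => h.2, fun h => ⟨hS h, h⟩⟩
  -- The weight leaving `S` is the sum of the outgoing weights of its members minus the weight
  -- inside `S`. The additional arcs from `s` contribute the outgoing weights of the non-members,
  -- which completes the first sum to a constant.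
  have hrow : ∀ u ∈ S, ∑ v ∈ Finset.range (q.inst.n + 1),
      (if u ∈ S ∧ v ∉ S then q.capacity i lab s u v else 0) =
      q.den + (q.outWeight i lab u - ∑ v ∈ S, q.weight i lab u v) + if u = s then
        (∑ v ∈ Finset.range q.inst.n, q.outWeight i lab v - ∑ v ∈ S, q.outWeight i lab v) else 0 := by
    intro u hu
    have hun : u < q.inst.n := Finset.mem_range.1 (hS hu)
    have hsplit : ∀ F : ℕ → ℤ, ∑ v ∈ Finset.range q.inst.n, (if v ∈ S then 0 else F v) =
        ∑ v ∈ Finset.range q.inst.n, F v - ∑ v ∈ S, F v := by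
      intro F
      nth_rewrite 3 [← hfil]
      rw [Finset.sum_filter, ← Finset.sum_sub_distrib]
      refine Finset.sum_congr rfl fun v _ => ?_
      split_ifs <;> simp
    rw [Finset.sum_range_succ, if_pos ⟨hu, hn⟩, outWeight_eq u, ← hsplit, ← hsplit]
    have hlast : q.capacity i lab s u q.inst.n = q.den := by
      simp [capacity, baseCap, hun]
    rw [hlast]
    have hin : ∑ v ∈ Finset.range q.inst.n, (if u ∈ S ∧ v ∉ S then q.capacity i lab s u v else 0) =
        ∑ v ∈ Finset.range q.inst.n, ((if v ∈ S then 0 else q.weight i lab u v) +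
          (if u = s then (if v ∈ S then 0 else q.outWeight i lab v) else 0)) := by
      refine Finset.sum_congr rfl fun v hv => ?_
      have hvn := Finset.mem_range.1 hv
      simp only [hu, true_and, capacity, baseCap, hvn.ne, and_false, if_false, hvn, and_true]
      split_ifs <;> simp_all
    rw [hin, Finset.sum_add_distrib]
    split_ifs
    · ring
    · rw [Finset.sum_const_zero]
      ring
  rw [cut]
  have h1 : ∑ u ∈ Finset.range (q.inst.n + 1), ∑ v ∈ Finset.range (q.inst.n + 1),
      (if u ∈ S ∧ v ∉ S then q.capacity i lab s u v else 0) =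
      ∑ u ∈ S, ∑ v ∈ Finset.range (q.inst.n + 1),
      (if u ∈ S ∧ v ∉ S then q.capacity i lab s u v else 0) := by
    symm
    refine Finset.sum_subset (hS.trans (Finset.range_subset_range.2 (Nat.le_succ _))) ?_
    intro u _ hu
    simp [hu]
  rw [h1, Finset.sum_congr rfl hrow, Finset.sum_add_distrib, Finset.sum_add_distrib,
    Finset.sum_sub_distrib, Finset.sum_ite_eq' S s, if_pos hs]
  simp
  ring

/-- If the sets that define minimum cuts satisfy their forest inequalities, then so do all sets. -/
theorem forest_complete (hlab : q.inst.IsLabeling i lab) (hnum : ∀ e, 0 ≤ q.num i e)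
    (h : ∀ s < q.inst.n, ∃ A : Finset ℕ, s ∈ A ∧ A ⊆ Finset.range q.inst.n ∧
      (∀ S, s ∈ S → q.inst.n ∉ S → cut (q.inst.n + 1) (q.capacity i lab s) A ≤
        cut (q.inst.n + 1) (q.capacity i lab s) S) ∧
      ((q.inst.family i lab A).Nonempty → (q.inst.forestIneq i (q.inst.family i lab A)).Satisfied q.x))
    (𝒞 : Finset (q.inst.Component i)) (h𝒞 : 𝒞.Nonempty) :
    (q.inst.forestIneq i 𝒞).Satisfied q.x := by
  classical
  have hsum : ∀ A : Finset ℕ, ∑ i', ∑ e,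
      (q.inst.forestIneq i (q.inst.family i lab A)).coeff i' e * q.num i' e =
      ∑ u ∈ A, ∑ v ∈ A, q.weight i lab u v := by
    intro A
    rw [sum_weight, Finset.sum_eq_single i]
    · refine Finset.sum_congr rfl fun e _ => ?_
      simp only [Instance.forestIneq, true_and, hlab.mem_cut_family, max_eq_left (hnum e), labA, labB,
        ne_eq, Fin.val_inj, ite_mul, one_mul, zero_mul]
    · intro i' _ hi'
      simp [Instance.forestIneq, hi']
    · simp
  obtain ⟨S, hSn, hS𝒞, hcard, hrep⟩ := hlab.exists_family 𝒞
  obtain ⟨s, hs⟩ : S.Nonempty := by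
    rw [← Finset.card_pos, hcard]
    exact h𝒞.card_pos
  have hsn : s < q.inst.n := Finset.mem_range.1 (hSn hs)
  obtain ⟨A, hsA, hAn, hmin, hsat⟩ := h s hsn
  have hmem : (q.inst.redGraph i).connectedComponentMk ⟨s, hsn⟩ ∈ q.inst.family i lab A := by
    rw [hlab.mem_family, hrep ⟨s, hsn⟩ hs]
    exact hsA
  have h1 := hsat ⟨_, hmem⟩
  rw [satisfied_iff, hsum] at h1
  have h2 := hmin S hs (fun hn => by simpa using hSn hn)
  rw [cut_capacity hsA hAn, cut_capacity hs hSn] at h2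
  -- A minimum cut may contain vertices that are not labels. They cost `den` each but contribute no
  -- component, so the comparison goes in the right direction.
  have h3 : (q.inst.family i lab A).card ≤ A.card := by
    rw [hlab.card_family]
    rw [← Finset.card_map Fin.valEmbedding]
    refine Finset.card_le_card fun u hu => ?_
    obtain ⟨v, hv, rfl⟩ := Finset.mem_map.1 hu
    exact (Finset.mem_filter.1 hv).2.1
  have h4 : (q.inst.forestIneq i (q.inst.family i lab A)).rhs =
    ((q.inst.family i lab A).card : ℤ) - 1 := rfl
  rw [← hS𝒞, satisfied_iff, hsum, hS𝒞]
  have h5 : (q.inst.forestIneq i 𝒞).rhs = (S.card : ℤ) - 1 := by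
    rw [hcard]
    rfl
  rw [h5]
  rw [h4] at h1
  have h6 : ((q.inst.family i lab A).card : ℤ) ≤ A.card := by exact_mod_cast h3
  have h7 := q.den_pos
  -- With `D = q.den`: `w(S) - D |S| ≤ w(A) - D |A| ≤ -D`, by minimality of the cut, the inequality
  -- of the family of `A`, and `h6`.
  nlinarith

end Query

/-! ## The forest stage -/

/-- Loop invariants use partial sums in this form, which avoids extending `f` beyond `Fin b`. -/
theorem sum_ite_lt_succ {b : ℕ} (f : Fin b → ℤ) {j : ℕ} (hj : j < b) :
    (∑ e : Fin b, if e.val < j + 1 then f e else 0) =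
      (∑ e : Fin b, if e.val < j then f e else 0) + f ⟨j, hj⟩ := by
  have h : ∀ e : Fin b, (if e.val < j + 1 then f e else 0) =
      (if e.val < j then f e else 0) + if e = ⟨j, hj⟩ then f e else 0 := by
    intro e
    simp only [Fin.ext_iff]
    split_ifs <;> omega
  simp only [h, Finset.sum_add_distrib, Finset.sum_ite_eq', Finset.mem_univ, if_true]

theorem sum_ite_lt_le {b : ℕ} {f g : Fin b → ℤ} (h : ∀ e, f e ≤ g e) (hg : ∀ e, 0 ≤ g e) (j : ℕ) :
    (∑ e : Fin b, if e.val < j then f e else 0) ≤ ∑ e, g e := by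
  refine Finset.sum_le_sum fun e _ => ?_
  split_ifs
  exacts [h e, hg e]

theorem sum_ite_lt_all {b : ℕ} (f : Fin b → ℤ) :
    (∑ e : Fin b, if e.val < b then f e else 0) = ∑ e, f e :=
  Finset.sum_congr rfl fun e _ => if_pos e.2

/-- The labels of the vertices stand in the array `aLab`. -/
def LabView (q : Query) (lab : Fin q.inst.n → Fin q.inst.n) (σ : Memory) : Prop :=
  ∀ v : Fin q.inst.n, σ aLab v = (lab v).val

theorem LabView.frame {q : Query} {lab : Fin q.inst.n → Fin q.inst.n} {σ τ : Memory} {P : Program}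
    (h : LabView q lab σ) (hF : Frame P σ τ) (hP : P.touches aLab = false) : LabView q lab τ :=
  fun v => by rw [hF _ hP, h v]

theorem MatView.frame {N a : ℕ} {f : ℕ → ℕ → ℤ} {σ τ : Memory} {P : Program}
    (h : MatView N a f σ) (hF : Frame P σ τ) (hP : P.touches a = false) : MatView N a f τ :=
  fun i hi j hj => by rw [hF _ hP, h i hi j hj]

theorem MatView.write {N a : ℕ} {f : ℕ → ℕ → ℤ} {σ : Memory} (h : MatView N a f σ) {u v : ℕ}
    (hv : v < N) (x : ℤ) : MatView N a (fun i j => if i = u ∧ j = v then x else f i j)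
      (σ.write a (u * N + v) x) := by
  intro i hi j hj
  simp only [Memory.write_self, Function.update_apply, index_inj_iff hj hv, h i hi j hj]

/-- The machine can only test for positivity; a square of an integer is either zero or at least one.
-/
theorem eqTest_pos {x y : ℤ} : 0 < 1 - (x - y) * (x - y) ↔ x = y := by
  constructor
  · intro h
    by_contra hne
    have : 0 < (x - y) * (x - y) := mul_self_pos.2 (sub_ne_zero.2 hne)
    omega
  · rintro rfl
    simp

theorem neTest_pos {x y : ℤ} : 0 < (x - y) * (x - y) ↔ x ≠ y := by
  rw [mul_self_pos, sub_ne_zero]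

section

variable {q : Query} {m : ℕ} {V : ℤ} {σ : Memory}

theorem relabel_spec (hB : Bounds q m V) (h : Base q σ) {lab : Fin q.inst.n → Fin q.inst.n}
    (hlab : LabView q lab σ) {x y : Fin q.inst.n} (hx : σ aLa 0 = x.val) (hy : σ aLb 0 = y.val) :
    wp m relabel (LabView q fun v => if lab v = y then x else lab v) σ := by
  refine wp_for q.inst.n (fun j τ => ∀ v : Fin q.inst.n, τ aLab v =
    ((if v.val < j then (if lab v = y then x else lab v) else lab v : Fin q.inst.n) : ℕ)) hB.n h.n
    rfl rfl ?_ ?_ ?_ ?_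
  · intro i τ x hI
    simpa [Memory.write_of_ne] using hI
  · intro v
    simpa using hlab v
  · intro j hj τ _ hcA hF hI
    have e1 : τ aLa 0 = x.val := by rw [hF _ rfl, hx]
    have e2 : τ aLb 0 = y.val := by rw [hF _ rfl, hy]
    have e3 : τ aLab j = (lab ⟨j, hj⟩).val := by simpa using hI ⟨j, hj⟩
    have key : (0 < (eqTest (rd aLab (var cA)) (var aLb)).eval τ) ↔ lab ⟨j, hj⟩ = y := by
      simp only [Expr.eval_sub, Expr.eval_mul, Expr.eval_get, Expr.eval_zero, Expr.eval_one, hcA, e2,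
        e3, eqTest_pos, Nat.cast_inj, Fin.val_inj]
    refine wp_ite (fun hpos => wp_assign (fun hb => hb _ _) fun v => ?_)
      (fun hpos => wp_skip fun v => ?_)
    · rw [key] at hpos
      simp only [Memory.write_self, Expr.eval_get, Expr.eval_zero, hcA, Function.update_apply,
        Nat.cast_inj, e1]
      by_cases hv : v.val = j
      · have : v = ⟨j, hj⟩ := Fin.ext hv
        subst this
        simp [hpos]
      · rw [if_neg hv, hI v]
        have : v.val < j + 1 ↔ v.val < j := by omega
        simp only [this]
    · rw [key] at hpos
      rw [hI v]
      by_cases hv : v.val = j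
      · have : v = ⟨j, hj⟩ := Fin.ext hv
        subst this
        simp [hpos]
      · have : v.val < j + 1 ↔ v.val < j := by omega
        simp only [this]
  · intro τ _ hI v
    rw [hI v, if_pos v.2]

/-- Merging two whole label classes keeps equal labels equal, so the edges treated earlier stay
consistent. The new label can be reached through the edge being treated. -/
theorem labels_spec (hB : Bounds q m V) (h : Base q σ) {i : ℕ} (hi : i ≤ q.inst.k)
    (hc : σ cC 0 = i) :
    wp m labels (fun τ => ∃ lab, LabView q lab τ ∧ q.inst.IsLabeling i lab) σ := by
  refine wp_then (Q := fun τ => LabView q id τ) ?_ ?_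
  · refine wp_for q.inst.n (fun j τ => ∀ v : ℕ, v < j → τ aLab v = v) hB.n h.n rfl rfl ?_ ?_ ?_ ?_
    · intro i τ x hI
      simpa [Memory.write_of_ne] using hI
    · simp
    · intro j hj τ _ hcA _ hI
      refine wp_assign (fun hb => hb _ _) fun v hv => ?_
      simp only [Memory.write_self, Expr.eval_get, Expr.eval_zero, hcA, Function.update_apply,
        Nat.cast_inj]
      split_ifs with hvj
      · rw [hvj]
      · exact hI v (by omega)
    · exact fun τ _ hI v => hI v v.2
  intro τ₁ _ hF₁ h1
  have hb₁ : Base q τ₁ := h.frame hF₁ (by decide)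
  refine wp_for q.inst.r (fun j τ => ∃ lab, LabView q lab τ ∧
    (∀ v, (q.inst.redGraph i).Reachable v (lab v)) ∧ ∀ e : Fin q.inst.r, e.val < j →
      e ∈ q.inst.R i → lab (q.inst.redEnds e).1 = lab (q.inst.redEnds e).2) hB.r hb₁.r rfl rfl
    ?_ ?_ ?_ ?_
  · intro i τ x hI
    simpa [LabView, Memory.write_of_ne] using hI
  · exact ⟨id, h1, fun v => .refl _, by simp⟩
  · rintro j hj τ _ hcD hF ⟨lab, hl, hreach, hedge⟩
    have hb : Base q τ := hb₁.frame hF (by decide)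
    have hcC : τ cC 0 = i := by rw [hF _ rfl, hF₁ _ rfl, hc]
    have e1 := hb.rank ⟨j, hj⟩
    have key : (0 < (1 + var cC - rd aRank (var cD)).eval τ) ↔ ⟨j, hj⟩ ∈ q.inst.R i := by
      rw [q.inst.mem_R_iff hi]
      simp only [Expr.eval_add, Expr.eval_sub, Expr.eval_get, Expr.eval_zero, Expr.eval_one, hcC, hcD]
      rw [e1]
      omega
    refine wp_ite (fun hpos => ?_) (fun hpos => wp_skip ⟨lab, hl, hreach, fun e he hR => ?_⟩)
    · rw [key] at hpos
      set a := (q.inst.redEnds ⟨j, hj⟩).1 with ha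
      set c := (q.inst.redEnds ⟨j, hj⟩).2 with hcdef
      refine wp_seq (wp_assign (fun hb => hb _ _) (wp_seq (wp_assign (fun hb => hb _ _) ?_)))
      set υ := (τ.write aLa ((0 : Expr).eval τ) ((rd aLab (rd aEA (var cD))).eval τ)).write aLb
        ((0 : Expr).eval (τ.write aLa ((0 : Expr).eval τ) ((rd aLab (rd aEA (var cD))).eval τ)))
        ((rd aLab (rd aEB (var cD))).eval
          (τ.write aLa ((0 : Expr).eval τ) ((rd aLab (rd aEA (var cD))).eval τ))) with hυ
      have hbυ : Base q υ := (hb.write (by norm_num) _ _).write (by norm_num) _ _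
      have hlυ : LabView q lab υ := fun v => by simp [hυ, Memory.write_of_ne, hl v]
      have hea : τ aEA j = a.val := hb.redA ⟨j, hj⟩
      have hec : τ aEB j = c.val := hb.redB ⟨j, hj⟩
      have hx : υ aLa 0 = (lab a).val := by simp [hυ, Memory.write_of_ne, hcD, hea, hl a]
      have hy : υ aLb 0 = (lab c).val := by simp [hυ, Memory.write_of_ne, hcD, hec, hl c]
      have hac : (q.inst.redGraph i).Reachable a c := by
        by_cases hne : a = c
        · rw [hne]
        · refine SimpleGraph.Adj.reachable ?_
          rw [Instance.redGraph, SimpleGraph.fromRel_adj]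
          exact ⟨hne, Or.inl ⟨_, hpos, rfl⟩⟩
      refine wp_mono (relabel_spec hB hbυ hlυ hx hy) fun κ _ _ hκ => ⟨_, hκ, fun v => ?_, ?_⟩
      · split_ifs with hv
        · have h2 := hreach v
          rw [hv] at h2
          exact h2.trans ((hreach c).symm.trans (hac.symm.trans (hreach a)))
        · exact hreach v
      · intro e he hR
        rcases Nat.lt_succ_iff_lt_or_eq.1 he with hlt | heq
        · simp only [hedge e hlt hR]
        · have : e = ⟨j, hj⟩ := Fin.ext heq
          rw [this, ← ha, ← hcdef]
          split_ifs <;> simp_all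
    · rcases Nat.lt_succ_iff_lt_or_eq.1 he with hlt | heq
      · exact hedge e hlt hR
      · have : e = ⟨j, hj⟩ := Fin.ext heq
        rw [this] at hR
        exact absurd (key.2 hR) hpos
  · rintro τ _ ⟨lab, hl, hreach, hedge⟩
    exact ⟨lab, hl, hreach, fun e he => hedge e e.2 he⟩

theorem loadEnds_spec (h : Base q σ) {lab : Fin q.inst.n → Fin q.inst.n}
    (hlab : LabView q lab σ) {e : Fin q.inst.b} (he : σ cD 0 = e.val) :
    wp m loadEnds (fun τ => τ aLa 0 = q.labA lab e ∧ τ aLb 0 = q.labB lab e) σ := by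
  refine wp_seq (wp_assign (fun hb => hb _ _) (wp_assign (fun hb => hb _ _) ?_))
  simp [Memory.write_of_ne, h.r, he, h.blueA e, h.blueB e, hlab _, Query.labA, Query.labB]

theorem Bounds.sum_num_le (hB : Bounds q m V) (i : Fin q.inst.k) : ∑ e, |q.num i e| ≤ V :=
  (Finset.single_le_sum (f := fun i => ∑ e, |q.num i e|)
      (fun _ _ => Finset.sum_nonneg fun _ _ => abs_nonneg _) (Finset.mem_univ i)).trans hB.num

/-- Labels are smaller than `n`, so no blue edge writes to column `n`, which holds the capacities to
the sink. Coordinates that are not positive are skipped, in accordance with `max _ 0`. The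
capacities are therefore non-negative for every point, feasible or not. -/
theorem weights_spec (hB : Bounds q m V) (h : Base q σ) {lab : Fin q.inst.n → Fin q.inst.n}
    (hlab : LabView q lab σ) {i : Fin q.inst.k} (hc : σ cC 0 = i.val) :
    wp m weights (fun τ => MatView (q.inst.n + 1) aWt (q.baseCap i lab) τ ∧
      ∀ u : ℕ, u < q.inst.n → τ aOutW u = q.outWeight i lab u) σ := by
  have hsmall : ∀ z, 0 ≤ z → z ≤ V → Small m z := fun z h1 h2 =>
    hB.small_of_le (by rw [abs_of_nonneg h1]; linarith)
  refine wp_then (Q := fun τ => MatView (q.inst.n + 1) aWt (fun _ _ => 0) τ) ?_ ?_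
  · refine wp_for ((q.inst.n + 1) * (q.inst.n + 1)) (fun x τ => ∀ p : ℕ, p < x → τ aWt p = 0) hB.nn
      (by rw [h.nn]; push_cast; rfl) rfl rfl ?_ ?_ ?_ ?_
    · intro i τ x hI
      simpa [Memory.write_of_ne] using hI
    · simp
    · intro x hx τ _ hcA hF hI
      refine wp_assign (fun _ => small_zero m) ?_
      intro p hp
      simp only [Memory.write_self, Expr.eval_get, Expr.eval_zero, hcA, Function.update_apply,
        Nat.cast_inj]
      split_ifs with hpx
      · rfl
      · exact hI p (by omega)
    · intro τ _ hI i hi j hj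
      have := hI _ (index_lt hi hj)
      push_cast at this ⊢
      exact this
  intro τ₁ _ hF₁ hw₁
  have hb₁ : Base q τ₁ := h.frame hF₁ (by decide)
  refine wp_then (Q := fun τ => MatView (q.inst.n + 1) aWt
    (fun u v => if u < q.inst.n ∧ v = q.inst.n then q.den else 0) τ ∧
      ∀ u : ℕ, u < q.inst.n → τ aOutW u = 0) ?_ ?_
  · refine wp_for q.inst.n (fun x τ => MatView (q.inst.n + 1) aWt
      (fun u v => if u < x ∧ v = q.inst.n then q.den else 0) τ ∧
      ∀ u : ℕ, u < x → τ aOutW u = 0) hB.n hb₁.n rfl rfl ?_ ?_ ?_ ?_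
    · intro i τ x hI
      simpa [MatView, Memory.write_of_ne] using hI
    · exact ⟨by simpa using hw₁, by simp⟩
    · rintro x hx τ _ hcA hF ⟨hI₁, hI₂⟩
      have hb : Base q τ := hb₁.frame hF (by decide)
      refine wp_seq (wp_assign (fun _ => ?_) (wp_assign (fun _ => small_zero m) ⟨?_, ?_⟩))
      · simp only [Expr.eval_get, Expr.eval_zero, hb.den]
        exact hsmall _ q.den_pos.le hB.den
      · have := hI₁.write (u := x) (v := q.inst.n) (Nat.lt_succ_self _) q.den
        intro u hu v hv
        have h2 := this u hu v hv
        rw [Memory.write_of_ne _ _ _ (by norm_num)]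
        simp only [Expr.eval_add, Expr.eval_mul, Expr.eval_get, Expr.eval_zero, hcA, hb.n1, hb.n,
          hb.den]
        push_cast at h2
        push_cast
        rw [h2]
        split_ifs <;> first | rfl | omega
      · intro u hu
        simp only [Memory.write_self, Expr.eval_get, Expr.eval_zero, Function.update_apply,
          Memory.write_of_ne _ _ _ (show cA ≠ aWt by norm_num),
          Memory.write_of_ne _ _ _ (show aOutW ≠ aWt by norm_num), hcA, Nat.cast_inj]
        split_ifs with hux
        · rfl
        · exact hI₂ u (by omega)
    · exact fun τ _ hI => hI
  rintro τ₂ _ hF₂ ⟨hw₂, ho₂⟩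
  have hb₂ : Base q τ₂ := hb₁.frame hF₂ (by decide)
  refine wp_for q.inst.b (fun x τ => MatView (q.inst.n + 1) aWt
      (fun u v => if u < q.inst.n ∧ v = q.inst.n then q.den else
        ∑ e : Fin q.inst.b, if e.val < x then q.contrib i lab e u v else 0) τ ∧
      ∀ u : ℕ, u < q.inst.n → τ aOutW u =
        ∑ e : Fin q.inst.b, if e.val < x then q.outContrib i lab e u else 0)
    hB.b hb₂.b rfl rfl ?_ ?_ ?_ ?_
  · intro i τ x hI
    simpa [MatView, Memory.write_of_ne] using hI
  · exact ⟨by simpa using hw₂, by simpa using ho₂⟩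
  · rintro x hx τ _ hcD hF ⟨hI₁, hI₂⟩
    have hb : Base q τ := hb₂.frame hF (by decide)
    have hl : LabView q lab τ := ((hlab.frame hF₁ rfl).frame hF₂ rfl).frame hF rfl
    have hcC : τ cC 0 = i.val := by rw [hF _ rfl, hF₂ _ rfl, hF₁ _ rfl, hc]
    refine wp_then (loadEnds_spec hb hl (e := ⟨x, hx⟩) hcD) ?_
    rintro υ _ hFυ ⟨hla, hlb⟩
    have hbυ : Base q υ := hb.frame hFυ (by decide)
    have hcDυ : υ cD 0 = x := by rw [hFυ _ rfl, hcD]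
    have hcCυ : υ cC 0 = i.val := by rw [hFυ _ rfl, hcC]
    have hnum : υ aX (i * q.inst.b + x) = q.num i ⟨x, hx⟩ := hbυ.num i ⟨x, hx⟩
    have hw : MatView (q.inst.n + 1) aWt (fun u v => if u < q.inst.n ∧ v = q.inst.n then q.den else
        ∑ e : Fin q.inst.b, if e.val < x then q.contrib i lab e u v else 0) υ := hI₁.frame hFυ rfl
    have ho : ∀ u : ℕ, u < q.inst.n → υ aOutW u =
        ∑ e : Fin q.inst.b, if e.val < x then q.outContrib i lab e u else 0 := by
      intro u hu
      rw [hFυ _ rfl, hI₂ u hu]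
    refine wp_seq (wp_assign (fun hbd => hbd _ _) ?_)
    set κ := υ.write aXv ((0 : Expr).eval υ) ((rd aX (var cC * var aB + var cD)).eval υ) with hκ
    have hκne : ∀ a, a ≠ aXv → κ a = υ a := fun a ha => Memory.write_of_ne _ _ _ ha
    have hxv : κ aXv 0 = q.num i ⟨x, hx⟩ := by
      simp [hκ, hcCυ, hbυ.b, hcDυ, hnum]
    have hzero : (q.labA lab ⟨x, hx⟩ ≠ q.labB lab ⟨x, hx⟩ → q.num i ⟨x, hx⟩ ≤ 0) →
        wp m .skip (fun τ => MatView (q.inst.n + 1) aWt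
          (fun u v => if u < q.inst.n ∧ v = q.inst.n then q.den else
            ∑ e : Fin q.inst.b, if e.val < x + 1 then q.contrib i lab e u v else 0) τ ∧
          ∀ u : ℕ, u < q.inst.n → τ aOutW u =
            ∑ e : Fin q.inst.b, if e.val < x + 1 then q.outContrib i lab e u else 0) κ := by
      intro hz
      have z1 : ∀ u v, q.contrib i lab ⟨x, hx⟩ u v = 0 := by
        intro u v
        rw [Query.contrib]
        split_ifs with hc
        · exact max_eq_right (hz hc.2.2)
        · rfl
      have z2 : ∀ u, q.outContrib i lab ⟨x, hx⟩ u = 0 := by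
        intro u
        rw [Query.outContrib]
        split_ifs with hc
        · exact max_eq_right (hz hc.2)
        · rfl
      refine wp_skip ⟨fun u hu v hv => ?_, fun u hu => ?_⟩
      · rw [hκne _ (by norm_num), hw u hu v hv]
        beta_reduce
        rw [sum_ite_lt_succ _ hx, z1, add_zero]
      · rw [hκne _ (by norm_num), ho u hu, sum_ite_lt_succ _ hx, z2, add_zero]
    have k1 : 0 < (neTest (var aLa) (var aLb)).eval κ ↔
        q.labA lab ⟨x, hx⟩ ≠ q.labB lab ⟨x, hx⟩ := by
      simp only [Expr.eval_sub, Expr.eval_mul, Expr.eval_get, Expr.eval_zero,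
        hκne aLa (by norm_num), hκne aLb (by norm_num), hla, hlb, neTest_pos, ne_eq, Nat.cast_inj]
    have k2 : 0 < (var aXv).eval κ ↔ 0 < q.num i ⟨x, hx⟩ := by
      simp only [Expr.eval_get, Expr.eval_zero, hxv]
    refine wp_ite (fun h1 => wp_ite (fun h2 => ?_) fun h2 => ?_) fun h1 => ?_
    · rw [k1] at h1
      rw [k2] at h2
      set la := q.labA lab ⟨x, hx⟩ with hladef
      set lb := q.labB lab ⟨x, hx⟩ with hlbdef
      have hlan : la < q.inst.n := q.labA_lt lab _
      have hlbn : lb < q.inst.n := q.labB_lt lab _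
      have c1 : ∀ u v, q.contrib i lab ⟨x, hx⟩ u v =
          if u = la ∧ v = lb then q.num i ⟨x, hx⟩ else 0 := by
        intro u v
        rw [Query.contrib, max_eq_left h2.le, ← hladef, ← hlbdef]
        by_cases hc : u = la ∧ v = lb
        · rw [if_pos hc, if_pos ⟨hc.1.symm, hc.2.symm, h1⟩]
        · rw [if_neg hc, if_neg]
          rintro ⟨h3, h4, _⟩
          exact hc ⟨h3.symm, h4.symm⟩
      have c2 : ∀ u, q.outContrib i lab ⟨x, hx⟩ u = if u = la then q.num i ⟨x, hx⟩ else 0 := by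
        intro u
        rw [Query.outContrib, max_eq_left h2.le, ← hladef, ← hlbdef]
        by_cases hc : u = la
        · rw [if_pos hc, if_pos ⟨hc.symm, h1⟩]
        · rw [if_neg hc, if_neg]
          rintro ⟨h3, _⟩
          exact hc h3.symm
      have v1 : κ aWt (la * (q.inst.n + 1) + lb) + q.num i ⟨x, hx⟩ =
          ∑ e : Fin q.inst.b, if e.val < x + 1 then q.contrib i lab e la lb else 0 := by
        have := hw la (by omega) lb (by omega)
        push_cast at this
        rw [hκne _ (by norm_num), this, if_neg (by omega), sum_ite_lt_succ _ hx, c1,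
          if_pos ⟨rfl, rfl⟩]
      have v2 : κ aOutW la + q.num i ⟨x, hx⟩ =
          ∑ e : Fin q.inst.b, if e.val < x + 1 then q.outContrib i lab e la else 0 := by
        rw [hκne _ (by norm_num), ho la hlan, sum_ite_lt_succ _ hx, c2, if_pos rfl]
      have g1 : κ aLa 0 = la := by rw [hκne _ (by norm_num), hla]
      have g2 : κ aLb 0 = lb := by rw [hκne _ (by norm_num), hlb]
      have g3 : κ aN1 0 = q.inst.n + 1 := by rw [hκne _ (by norm_num), hbυ.n1]
      refine wp_seq (wp_assign (fun _ => ?_) (wp_assign (fun _ => ?_) ⟨?_, ?_⟩))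
      · simp only [Expr.eval_add, Expr.eval_mul, Expr.eval_get, Expr.eval_zero, g1, g2, g3, hxv]
        rw [v1]
        refine hsmall _ (Finset.sum_nonneg fun e _ => ?_)
          ((sum_ite_lt_le (fun e => Query.contrib_le e la lb) (fun _ => abs_nonneg _) _).trans
            (hB.sum_num_le i))
        split_ifs
        exacts [Query.contrib_nonneg _ _ _, le_rfl]
      · simp only [Expr.eval_add, Expr.eval_get, Expr.eval_zero, g1, hxv,
          Memory.write_of_ne _ _ _ (show aOutW ≠ aWt by norm_num),
          Memory.write_of_ne _ _ _ (show aLa ≠ aWt by norm_num),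
          Memory.write_of_ne _ _ _ (show aXv ≠ aWt by norm_num)]
        rw [v2]
        refine hsmall _ (Finset.sum_nonneg fun e _ => ?_)
          ((sum_ite_lt_le (fun e => Query.outContrib_le e la) (fun _ => abs_nonneg _) _).trans
            (hB.sum_num_le i))
        split_ifs
        exacts [Query.outContrib_nonneg _ _, le_rfl]
      · intro u hu v hv
        rw [Memory.write_of_ne _ _ _ (by norm_num)]
        simp only [Expr.eval_add, Expr.eval_mul, Expr.eval_get, Expr.eval_zero, g1, g2, g3, hxv]
        rw [v1]
        have hwκ : MatView (q.inst.n + 1) aWt (fun u v => if u < q.inst.n ∧ v = q.inst.n then q.den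
            else ∑ e : Fin q.inst.b, if e.val < x then q.contrib i lab e u v else 0) κ := by
          intro u hu v hv
          rw [hκne _ (by norm_num), hw u hu v hv]
        have := hwκ.write (u := la) (v := lb) (by omega)
          (∑ e : Fin q.inst.b, if e.val < x + 1 then q.contrib i lab e la lb else 0) u hu v hv
        push_cast at this ⊢
        rw [this]
        by_cases huv : u = la ∧ v = lb
        · rw [if_pos huv, huv.1, huv.2, if_neg (by omega)]
        · rw [if_neg huv, sum_ite_lt_succ _ hx, c1, if_neg huv, add_zero]
      · intro u hu
        simp only [Memory.write_self, Expr.eval_add, Expr.eval_get, Expr.eval_zero, g1, hxv,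
          Memory.write_of_ne _ _ _ (show aOutW ≠ aWt by norm_num),
          Memory.write_of_ne _ _ _ (show aLa ≠ aWt by norm_num),
          Memory.write_of_ne _ _ _ (show aXv ≠ aWt by norm_num), Function.update_apply, Nat.cast_inj]
        rw [v2]
        by_cases hu' : u = la
        · rw [if_pos hu', hu']
        · rw [if_neg hu', hκne _ (by norm_num), ho u hu, sum_ite_lt_succ _ hx, c2, if_neg hu',
            add_zero]
    · rw [k2] at h2
      exact hzero fun _ => not_lt.1 h2
    · rw [k1] at h1
      exact hzero fun h => absurd h h1
  · rintro τ _ ⟨hI₁, hI₂⟩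
    refine ⟨fun u hu v hv => ?_, fun u hu => ?_⟩
    · rw [hI₁ u hu v hv]
      beta_reduce
      rw [Query.baseCap, Query.weight, sum_ite_lt_all]
    · rw [hI₂ u hu, Query.outWeight, sum_ite_lt_all]

theorem Query.baseCap_nonneg {i : Fin q.inst.k} {lab : Fin q.inst.n → Fin q.inst.n} (u v : ℕ) :
    0 ≤ q.baseCap i lab u v := by
  rw [Query.baseCap]
  split_ifs
  exacts [q.den_pos.le, Query.weight_nonneg u v]

theorem Bounds.outWeight_le (hB : Bounds q m V) {i : Fin q.inst.k}
    {lab : Fin q.inst.n → Fin q.inst.n} (u : ℕ) : q.outWeight i lab u ≤ V :=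
  (Finset.sum_le_sum fun e _ => Query.outContrib_le e u).trans (hB.sum_num_le i)

theorem Bounds.baseCap_le (hB : Bounds q m V) {i : Fin q.inst.k}
    {lab : Fin q.inst.n → Fin q.inst.n} (u v : ℕ) : q.baseCap i lab u v ≤ V := by
  rw [Query.baseCap]
  split_ifs
  · exact hB.den
  · exact (Finset.sum_le_sum fun e _ => Query.contrib_le e u v).trans (hB.sum_num_le i)

theorem Query.capacity_nonneg {i : Fin q.inst.k} {lab : Fin q.inst.n → Fin q.inst.n} (s u v : ℕ) :
    0 ≤ q.capacity i lab s u v := by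
  rw [Query.capacity]
  have := Query.baseCap_nonneg (i := i) (lab := lab) u v
  have := Query.outWeight_nonneg (i := i) (lab := lab) v
  split_ifs <;> omega

theorem Bounds.capacity_le (hB : Bounds q m V) {i : Fin q.inst.k}
    {lab : Fin q.inst.n → Fin q.inst.n} (s u v : ℕ) : q.capacity i lab s u v ≤ 2 * V := by
  rw [Query.capacity]
  have := hB.baseCap_le (i := i) (lab := lab) u v
  have := hB.outWeight_le (i := i) (lab := lab) v
  have := hB.V_pos
  split_ifs <;> omega

theorem capacities_spec (hB : Bounds q m V) (h : Base q σ) {lab : Fin q.inst.n → Fin q.inst.n}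
    {i : Fin q.inst.k} (hw : MatView (q.inst.n + 1) aWt (q.baseCap i lab) σ)
    (ho : ∀ u : ℕ, u < q.inst.n → σ aOutW u = q.outWeight i lab u) {s : ℕ} (hs : s < q.inst.n)
    (hcE : σ cE 0 = s) :
    wp m capacities (MatView (q.inst.n + 1) aCap (q.capacity i lab s)) σ := by
  refine wp_then (Q := fun τ => MatView (q.inst.n + 1) aCap (q.baseCap i lab) τ) ?_ ?_
  · refine wp_for ((q.inst.n + 1) * (q.inst.n + 1)) (fun x τ => ∀ p : ℕ, p < x → τ aCap p = σ aWt p)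
      hB.nn (by rw [h.nn]; push_cast; rfl) rfl rfl ?_ ?_ ?_ ?_
    · intro i τ x hI
      simpa [Memory.write_of_ne] using hI
    · simp
    · intro x hx τ _ hcA hF hI
      refine wp_assign (fun hb => hb _ _) ?_
      intro p hp
      have e1 : τ aWt = σ aWt := hF _ rfl
      simp only [Memory.write_self, Expr.eval_get, Expr.eval_zero, hcA, Function.update_apply,
        Nat.cast_inj, e1]
      split_ifs with hpx
      · rw [hpx]
      · exact hI p (by omega)
    · intro τ _ hI u hu v hv
      have := hI _ (index_lt hu hv)
      rw [← hw u hu v hv]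
      push_cast at this ⊢
      exact this
  intro τ₁ _ hF₁ h1
  have hb₁ : Base q τ₁ := h.frame hF₁ (by decide)
  refine wp_for q.inst.n (fun x τ => MatView (q.inst.n + 1) aCap
    (fun u v => q.baseCap i lab u v + if u = s ∧ v < x then q.outWeight i lab v else 0) τ)
    hB.n hb₁.n rfl rfl ?_ ?_ ?_ ?_
  · intro i τ x hI
    simpa [MatView, Memory.write_of_ne] using hI
  · simpa using h1
  · intro x hx τ _ hcA hF hI
    have hb : Base q τ := hb₁.frame hF (by decide)
    have e1 : τ cE 0 = s := by rw [hF _ rfl, hF₁ _ rfl, hcE]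
    have e2 : τ aOutW x = q.outWeight i lab x := by rw [hF _ rfl, hF₁ _ rfl, ho x hx]
    have e3 : τ aCap (s * (q.inst.n + 1) + x) = q.baseCap i lab s x := by
      have := hI s (by omega) x (by omega)
      push_cast at this
      simpa using this
    have hval : (rd aCap (var cE * var aN1 + var cA) + rd aOutW (var cA)).eval τ =
        q.baseCap i lab s x + q.outWeight i lab x := by
      simp only [Expr.eval_add, Expr.eval_mul, Expr.eval_get, Expr.eval_zero, e1, e2, e3, hb.n1, hcA]
    refine wp_assign (fun _ => ?_) ?_
    · rw [hval]
      have t1 := Query.baseCap_nonneg (i := i) (lab := lab) s x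
      have t2 := Query.outWeight_nonneg (i := i) (lab := lab) x
      have t3 := hB.baseCap_le (i := i) (lab := lab) s x
      have t4 := hB.outWeight_le (i := i) (lab := lab) x
      have t5 := hB.V_pos
      refine hB.small_of_le ?_
      rw [abs_of_nonneg (by omega)]
      omega
    · rw [hval]
      intro u hu v hv
      have := hI.write (u := s) (v := x) (by omega)
        (q.baseCap i lab s x + q.outWeight i lab x) u hu v hv
      simp only [Expr.eval_add, Expr.eval_mul, Expr.eval_get, Expr.eval_zero, e1, hb.n1, hcA]
      push_cast at this ⊢
      rw [this]
      by_cases c1 : u = s ∧ v = x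
      · rw [if_pos c1, if_pos ⟨c1.1, by omega⟩, c1.1, c1.2]
      · rw [if_neg c1]
        have : u = s ∧ v < x + 1 ↔ u = s ∧ v < x := by omega
        simp only [this]
  · exact fun τ _ hI => hI

end

section

variable {q : Query} {m : ℕ} {V : ℤ} {σ : Memory}

/-- The right-hand side starts at `-1` and counts the fixed points of the labeling in `A`, one for
each component of the family. -/
theorem forestCand_spec (hB : Bounds q m V) (h : Base q σ) {lab : Fin q.inst.n → Fin q.inst.n}
    (hlab : LabView q lab σ) {i : Fin q.inst.k} (hc : σ cC 0 = i.val)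
    (hL : q.inst.IsLabeling i lab) {A : Finset ℕ} (hR : ReachView (q.inst.n + 1) A σ) :
    wp m forestCand (Cand q (q.inst.forestIneq i (q.inst.family i lab A))) σ := by
  classical
  set F : Fin q.inst.n → ℤ := fun v => if v.val ∈ A ∧ lab v = v then 1 else 0 with hF
  have hF0 : ∀ v, 0 ≤ F v ∧ F v ≤ 1 := by
    intro v
    simp only [hF]
    split_ifs <;> simp
  have hneg : Small m (-1) := by simpa [Small] using hB.small_one
  have hsum : ∑ v, F v = (q.inst.family i lab A).card := by
    rw [hL.card_family, Finset.card_filter]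
    push_cast
    rfl
  refine wp_seq (wp_assign (fun _ => hneg) ?_)
  set σ₁ := σ.write aRhs ((0 : Expr).eval σ) ((0 - 1 : Expr).eval σ) with hσ₁
  have hσ : ∀ a, a ≠ aRhs → σ₁ a = σ a := fun a ha => Memory.write_of_ne _ _ _ ha
  have hb₁ : Base q σ₁ := h.write (by norm_num) _ _
  refine wp_then (Q := fun τ => τ aRhs 0 = ∑ v, F v - 1) ?_ ?_
  · refine wp_for q.inst.n (fun j τ => τ aRhs 0 =
      (∑ v : Fin q.inst.n, if v.val < j then F v else 0) - 1) hB.n hb₁.n rfl rfl ?_ ?_ ?_ ?_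
    · intro i τ x hI
      simpa [Memory.write_of_ne] using hI
    · simp [hσ₁]
    · intro j hj τ _ hcA hFτ hI
      have e1 : τ aReach j = if j ∈ A then 1 else 0 := by
        rw [hFτ _ rfl, hσ _ (by norm_num), hR j (by omega)]
      have e2 : τ aLab j = (lab ⟨j, hj⟩).val := by
        rw [hFτ _ rfl, hσ _ (by norm_num)]
        exact hlab ⟨j, hj⟩
      have k1 : 0 < (rd aReach (var cA)).eval τ ↔ j ∈ A := by
        simp only [Expr.eval_get, Expr.eval_zero, hcA, e1]
        split_ifs with hjA <;> simp [hjA]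
      have k2 : 0 < (eqTest (rd aLab (var cA)) (var cA)).eval τ ↔ lab ⟨j, hj⟩ = ⟨j, hj⟩ := by
        simp only [Expr.eval_sub, Expr.eval_mul, Expr.eval_get, Expr.eval_zero, Expr.eval_one, hcA, e2,
          eqTest_pos, Nat.cast_inj, Fin.ext_iff]
      have hskip : ¬ (j ∈ A ∧ lab ⟨j, hj⟩ = ⟨j, hj⟩) → wp m .skip (fun τ => τ aRhs 0 =
          (∑ v : Fin q.inst.n, if v.val < j + 1 then F v else 0) - 1) τ := by
        intro hn
        refine wp_skip ?_
        rw [hI, sum_ite_lt_succ _ hj]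
        simp only [hF, if_neg hn, add_zero]
      refine wp_ite (fun h1 => wp_ite (fun h2 => ?_) fun h2 => ?_) fun h1 => ?_
      · have hFj : F ⟨j, hj⟩ = 1 := if_pos ⟨k1.1 h1, k2.1 h2⟩
        have hval : (var aRhs + 1 : Expr).eval τ =
            (∑ v : Fin q.inst.n, if v.val < j + 1 then F v else 0) - 1 := by
          rw [sum_ite_lt_succ _ hj, hFj]
          simp only [Expr.eval_add, Expr.eval_get, Expr.eval_zero, Expr.eval_one, hI]
          ring
        refine wp_assign (fun _ => ?_) ?_
        · rw [hval]
          have b1 := sum_ite_lt_le (fun v => (hF0 v).2) (fun _ => zero_le_one) (j + 1)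
          have b2 : 0 ≤ ∑ v : Fin q.inst.n, if v.val < j + 1 then F v else 0 :=
            Finset.sum_nonneg fun v _ => by split_ifs; exacts [(hF0 v).1, le_rfl]
          have b3 : ∑ v : Fin q.inst.n, (1 : ℤ) = q.inst.n := by simp
          rw [b3] at b1
          have b4 := hB.n1
          refine small_of_le ?_
          rw [abs_le]
          constructor <;> omega
        · rw [hval]
          simp
      · exact hskip fun hn => h2 (k2.2 hn.2)
      · exact hskip fun hn => h1 (k1.2 hn.1)
    · intro τ _ hI
      rw [hI, sum_ite_lt_all]
  intro τ₁ _ hF₁ hrhs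
  have hb₂ : Base q τ₁ := hb₁.frame hF₁ (by decide)
  refine wp_then (clearCand_spec hB hb₂) ?_
  intro τ₂ _ hF₂ hz
  have hb₃ : Base q τ₂ := hb₂.frame hF₂ (by decide)
  have hτ₂ : ∀ a, a ≠ aRhs → a ≠ cA → a ≠ aCf → τ₂ a = σ a := by
    intro a h1 h2 h3
    rw [hF₂ a (by simp [clearCand, forLoop, Program.touches, Ne.symm h2, Ne.symm h3]),
      hF₁ a (by simp [forLoop, Program.touches, Ne.symm h1, Ne.symm h2]), hσ a h1]
  refine wp_for q.inst.b (fun j τ => ∀ (i' : Fin q.inst.k) (e : Fin q.inst.b),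
    τ aCf (i' * q.inst.b + e) = if e.val < j then
      (q.inst.forestIneq i (q.inst.family i lab A)).coeff i' e else 0) hB.b hb₃.b rfl rfl ?_ ?_ ?_ ?_
  · intro i τ x hI
    simpa [Memory.write_of_ne] using hI
  · simpa using hz
  · intro j hj τ _ hcD hFτ hI
    have hb : Base q τ := hb₃.frame hFτ (by decide)
    have hl : LabView q lab τ := by
      intro v
      rw [hFτ _ rfl, hτ₂ _ (by norm_num) (by norm_num) (by norm_num), hlab v]
    refine wp_then (loadEnds_spec hb hl (e := ⟨j, hj⟩) hcD) ?_
    rintro υ _ hFυ ⟨hla, hlb⟩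
    have hbυ : Base q υ := hb.frame hFυ (by decide)
    have hcDυ : υ cD 0 = j := by rw [hFυ _ rfl, hcD]
    have hcCυ : υ cC 0 = i.val := by
      rw [hFυ _ rfl, hFτ _ rfl, hτ₂ _ (by norm_num) (by norm_num) (by norm_num), hc]
    have hRυ : ReachView (q.inst.n + 1) A υ := by
      intro v hv
      rw [hFυ _ rfl, hFτ _ rfl, hτ₂ _ (by norm_num) (by norm_num) (by norm_num), hR v hv]
    have hIυ : ∀ (i' : Fin q.inst.k) (e : Fin q.inst.b), υ aCf (i' * q.inst.b + e) =
        if e.val < j then (q.inst.forestIneq i (q.inst.family i lab A)).coeff i' e else 0 := by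
      intro i' e
      rw [hFυ _ rfl, hI i' e]
    have hcoeff : ∀ i', (q.inst.forestIneq i (q.inst.family i lab A)).coeff i' ⟨j, hj⟩ =
        if i' = i ∧ (q.labA lab ⟨j, hj⟩ ∈ A ∧ q.labB lab ⟨j, hj⟩ ∈ A ∧
          q.labA lab ⟨j, hj⟩ ≠ q.labB lab ⟨j, hj⟩) then 1 else 0 := by
      intro i'
      simp only [Instance.forestIneq, hL.mem_cut_family, Query.labA, Query.labB, ne_eq, Fin.val_inj]
    have k1 : 0 < (neTest (var aLa) (var aLb)).eval υ ↔
        q.labA lab ⟨j, hj⟩ ≠ q.labB lab ⟨j, hj⟩ := by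
      simp only [Expr.eval_sub, Expr.eval_mul, Expr.eval_get, Expr.eval_zero, hla, hlb, neTest_pos,
        ne_eq, Nat.cast_inj]
    have hreach : ∀ x < q.inst.n, 0 < υ aReach x ↔ x ∈ A := by
      intro x hx
      rw [hRυ x (by omega)]
      split_ifs with hxA <;> simp [hxA]
    have k2 : 0 < (rd aReach (var aLa)).eval υ ↔ q.labA lab ⟨j, hj⟩ ∈ A := by
      simp only [Expr.eval_get, Expr.eval_zero, hla, hreach _ (q.labA_lt lab ⟨j, hj⟩)]
    have k3 : 0 < (rd aReach (var aLb)).eval υ ↔ q.labB lab ⟨j, hj⟩ ∈ A := by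
      simp only [Expr.eval_get, Expr.eval_zero, hlb, hreach _ (q.labB_lt lab ⟨j, hj⟩)]
    have hskip : ¬ (q.labA lab ⟨j, hj⟩ ∈ A ∧ q.labB lab ⟨j, hj⟩ ∈ A ∧
          q.labA lab ⟨j, hj⟩ ≠ q.labB lab ⟨j, hj⟩) → wp m .skip (fun τ => ∀ (i' : Fin q.inst.k)
          (e : Fin q.inst.b), τ aCf (i' * q.inst.b + e) = if e.val < j + 1 then
            (q.inst.forestIneq i (q.inst.family i lab A)).coeff i' e else 0) υ := by
      intro hn
      refine wp_skip fun i' e => ?_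
      rw [hIυ i' e]
      by_cases hej : e.val = j
      · have : e = ⟨j, hj⟩ := Fin.ext hej
        have h0 := hcoeff i'
        rw [if_neg (fun h => hn h.2)] at h0
        rw [this, h0]
        simp
      · have : e.val < j + 1 ↔ e.val < j := by omega
        simp only [this]
    refine wp_ite (fun h1 => wp_ite (fun h2 => wp_ite (fun h3 => ?_) fun h3 => ?_) fun h2 => ?_)
      fun h1 => ?_
    · rw [k1] at h1
      rw [k2] at h2
      rw [k3] at h3
      refine wp_assign (fun _ => hB.small_one) fun i' e => ?_
      simp only [Memory.write_self, Expr.eval_add, Expr.eval_mul, Expr.eval_get, Expr.eval_zero,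
        Expr.eval_one, hcCυ, hcDυ, hbυ.b, Function.update_apply, index_inj_iff e.2 hj, hIυ i' e]
      by_cases hej : e.val = j
      · have : e = ⟨j, hj⟩ := Fin.ext hej
        subst this
        simp only [hcoeff, h1, h2, h3, and_true, Fin.ext_iff, lt_irrefl, if_false, Nat.lt_succ_self,
          if_true, ne_eq, not_false_eq_true]
      · have : e.val < j + 1 ↔ e.val < j := by omega
        simp only [this, hej, and_false, if_false]
    · exact hskip fun hn => h3 (k3.2 hn.2.1)
    · exact hskip fun hn => h2 (k2.2 hn.1)
    · exact hskip fun hn => h1 (k1.2 hn.2.2)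
  · intro τ hFτ hI
    refine ⟨fun i' e => by rw [hI i' e, if_pos e.2], ?_, fun i' e => ?_⟩
    · rw [hFτ _ rfl, hF₂ _ rfl, hrhs, hsum]
      rfl
    · simp only [Instance.forestIneq]
      split_ifs <;> simp

/-- Every candidate is a constraint, whatever the earlier tests have shown. Non-negativity of the
point enters only afterwards, when the tested families are shown to decide all others. -/
theorem forestStage_spec (hB : Bounds q m V) (h : Base q σ) {Φ : Prop} (hO : Ok q Φ σ)
    (hΦ : Φ → ∀ i e, 0 ≤ q.num i e) :
    wp m forestStage (Ok q (Φ ∧ ∀ (i : Fin q.inst.k) (𝒞 : Finset (q.inst.Component i)), 𝒞.Nonempty →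
      (q.inst.forestIneq i 𝒞).Satisfied q.x)) σ := by
  refine wp_for q.inst.k (fun j τ => Ok q (Φ ∧ ∀ (i : Fin q.inst.k), i.val < j →
    ∀ (𝒞 : Finset (q.inst.Component i)), 𝒞.Nonempty → (q.inst.forestIneq i 𝒞).Satisfied q.x) τ)
    hB.k h.k rfl rfl (fun _ _ _ hI => hI.write (by norm_num) _ _)
    (hO.mono fun h => ⟨h, by simp⟩) ?_
    (fun τ _ hI => hI.mono fun h => ⟨h.1, fun i => h.2 i i.2⟩)
  intro j hj τ _ hcC hF hI
  have hb : Base q τ := h.frame hF (by decide)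
  set i : Fin q.inst.k := ⟨j, hj⟩ with hi
  refine wp_then (labels_spec hB hb hj.le hcC) ?_
  rintro τ₁ _ hF₁ ⟨lab, hlab, hL⟩
  have hb₁ : Base q τ₁ := hb.frame hF₁ (by decide)
  have hc₁ : τ₁ cC 0 = i.val := by rw [hF₁ _ rfl, hcC]
  refine wp_then (weights_spec hB hb₁ hlab hc₁) ?_
  rintro τ₂ _ hF₂ ⟨hw, ho⟩
  have hb₂ : Base q τ₂ := hb₁.frame hF₂ (by decide)
  have hc₂ : τ₂ cC 0 = i.val := by rw [hF₂ _ rfl, hc₁]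
  have hl₂ : LabView q lab τ₂ := hlab.frame hF₂ rfl
  have hI₂ := (hI.frame hF₁ rfl).frame hF₂ rfl
  refine wp_for q.inst.n (fun x τ => Ok q ((Φ ∧ ∀ (i : Fin q.inst.k), i.val < j →
    ∀ (𝒞 : Finset (q.inst.Component i)), 𝒞.Nonempty → (q.inst.forestIneq i 𝒞).Satisfied q.x) ∧
    ∀ s < x, ∃ A : Finset ℕ, s ∈ A ∧ A ⊆ Finset.range q.inst.n ∧
      (∀ S, s ∈ S → q.inst.n ∉ S → cut (q.inst.n + 1) (q.capacity i lab s) A ≤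
        cut (q.inst.n + 1) (q.capacity i lab s) S) ∧
      ((q.inst.family i lab A).Nonempty →
        (q.inst.forestIneq i (q.inst.family i lab A)).Satisfied q.x)) τ)
    hB.n hb₂.n rfl rfl (fun _ _ _ hI => hI.write (by norm_num) _ _)
    (hI₂.mono fun h => ⟨h, by simp⟩) ?_ ?_
  · intro s hs τ₃ _ hcE hF₃ hI₃
    have hb₃ : Base q τ₃ := hb₂.frame hF₃ (by decide)
    have hc₃ : τ₃ cC 0 = i.val := by rw [hF₃ _ rfl, hc₂]
    have hl₃ : LabView q lab τ₃ := hl₂.frame hF₃ rfl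
    refine wp_then (capacities_spec hB hb₃ (hw.frame hF₃ rfl)
      (fun u hu => by rw [hF₃ _ rfl, ho u hu]) hs hcE) ?_
    intro τ₄ _ hF₄ hcap
    have hb₄ : Base q τ₄ := hb₃.frame hF₄ (by decide)
    have hc₄ : τ₄ cC 0 = i.val := by rw [hF₄ _ rfl, hc₃]
    have hl₄ : LabView q lab τ₄ := hl₃.frame hF₄ rfl
    have hcE₄ : τ₄ cE 0 = s := by rw [hF₄ _ rfl, hcE]
    have hI₄ := hI₃.frame hF₄ rfl
    have hV := hB.V_pos
    have hD : NetDim m (q.inst.n + 1) s q.inst.n τ₄ :=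
      ⟨by rw [hb₄.n1]; push_cast; rfl, by rw [hb₄.nn]; push_cast; rfl, hcE₄, hb₄.n, by omega, by omega,
        hB.nn⟩
    -- The capacities are at most `2 * V`, so `4 * (n + 1) ^ 2 * V` suffices, well below the bound
    -- in `Bounds.value`.
    have hsm : 2 * (((q.inst.n + 1 : ℕ) : ℤ) * ((q.inst.n + 1 : ℕ) : ℤ)) * (2 * V) < 2 ^ m := by
      refine lt_of_le_of_lt ?_ hB.value
      push_cast
      have : (0 : ℤ) ≤ ((q.inst.n : ℤ) + 1) * (q.inst.n + 1) * V := by positivity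
      linarith
    refine wp_then (minCut_spec hD hs.ne (fun u _ v _ => Query.capacity_nonneg s u v)
      (fun u _ v _ => hB.capacity_le s u v) (by omega) hsm hcap) ?_
    rintro τ₅ _ hF₅ ⟨A, hsA, htA, hAN, hR, hmin⟩
    have hAn : A ⊆ Finset.range q.inst.n := by
      intro u hu
      have := Finset.mem_range.1 (hAN hu)
      have hne : u ≠ q.inst.n := by
        rintro rfl
        exact htA hu
      exact Finset.mem_range.2 (by omega)
    have hb₅ : Base q τ₅ := hb₄.frame hF₅ (by decide)
    have hc₅ : τ₅ cC 0 = i.val := by rw [hF₅ _ rfl, hc₄]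
    have hl₅ : LabView q lab τ₅ := hl₄.frame hF₅ rfl
    have hI₅ := hI₄.frame hF₅ rfl
    refine wp_then (forestCand_spec hB hb₅ hl₅ hc₅ hL hR) ?_
    intro τ₆ _ hF₆ hcand
    have hb₆ : Base q τ₆ := hb₅.frame hF₆ (by decide)
    have hI₆ := hI₅.frame hF₆ rfl
    have hrhs : (var aRhs + 1 : Expr).eval τ₆ = (q.inst.family i lab A).card := by
      simp [hcand.rhs, Instance.forestIneq]
    -- When the source is not a label, the family may be empty, and the candidate is then no
    -- constraint. The right-hand side is `-1` exactly in this case.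
    refine wp_ite (fun hpos => ?_) (fun hpos => wp_skip (hI₆.mono ?_))
    · have hne : (q.inst.family i lab A).Nonempty := by
        rw [hrhs] at hpos
        exact Finset.card_pos.1 (by exact_mod_cast hpos)
      refine wp_mono (check_spec hB hb₆ (Instance.IsConstraint.forest i _ hne) hcand hI₆)
        fun τ₇ _ _ hOk => hOk.mono ?_
      rintro ⟨⟨h1, h2⟩, h3⟩
      refine ⟨h1, fun s' hs' => ?_⟩
      rcases Nat.lt_succ_iff_lt_or_eq.1 hs' with hlt | rfl
      · exact h2 s' hlt
      · exact ⟨A, hsA, hAn, hmin, fun _ => h3⟩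
    · rintro ⟨h1, h2⟩
      refine ⟨h1, fun s' hs' => ?_⟩
      rcases Nat.lt_succ_iff_lt_or_eq.1 hs' with hlt | rfl
      · exact h2 s' hlt
      · refine ⟨A, hsA, hAn, hmin, fun hne => absurd ?_ hpos⟩
        rw [hrhs]
        exact_mod_cast hne.card_pos
  · intro τ₃ _ hI₃
    refine hI₃.mono ?_
    rintro ⟨⟨h1, h2⟩, h3⟩
    refine ⟨h1, fun i' hi' => ?_⟩
    rcases Nat.lt_succ_iff_lt_or_eq.1 hi' with hlt | heq
    · exact h2 i' hlt
    · have : i' = i := Fin.ext heq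
      subst this
      exact Query.forest_complete hL (hΦ h1 _) h3

end

/-! ## Shortest paths and the cycle inequalities -/

namespace Instance

variable {I : Instance} {A : Set I.Edge}

theorem IsPath.head_mem {u w : Fin I.n} {P : List I.Edge} {W : List (Fin I.n)}
    (h : I.IsPath A u w P W) : u ∈ W := by
  cases h <;> simp

theorem IsPath.ends_mem {u w : Fin I.n} {P : List I.Edge} {W : List (Fin I.n)}
    (h : I.IsPath A u w P W) : ∀ e ∈ P, (I.ends e).1 ∈ W ∧ (I.ends e).2 ∈ W := by
  induction h with
  | nil => simp
  | cons he hends hu hp ih =>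
    intro e' he'
    rcases List.mem_cons.1 he' with rfl | he'
    · have := hp.head_mem
      rcases hends with h | h <;> simp [h, this]
    · exact ⟨List.mem_cons_of_mem _ (ih e' he').1, List.mem_cons_of_mem _ (ih e' he').2⟩

/-- Needed because the bound `x_{1,e} ≤ 1` is not available for loops. -/
theorem IsPath.not_loop {u w : Fin I.n} {P : List I.Edge} {W : List (Fin I.n)}
    (h : I.IsPath A u w P W) : ∀ e ∈ P, (I.ends e).1 ≠ (I.ends e).2 := by
  induction h with
  | nil => simp
  | @cons u v w e P W he hends hu hp ih =>
    intro e' he'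
    rcases List.mem_cons.1 he' with rfl | he'
    · have hne : u ≠ v := by
        rintro rfl
        exact hu hp.head_mem
      rcases hends with h | h <;> simp [h, hne, hne.symm]
    · exact ih e' he'

theorem IsPath.not_mem_cons {u v w : Fin I.n} {e : I.Edge} {P : List I.Edge} {W : List (Fin I.n)}
    (h : I.IsPath A v w P W) (hends : I.ends e = (u, v) ∨ I.ends e = (v, u)) (hu : u ∉ W) :
    e ∉ P := by
  intro he
  have := h.ends_mem e he
  rcases hends with h' | h' <;> rw [h'] at this <;> exact hu (by simp_all)

theorem IsPath.nodup {u w : Fin I.n} {P : List I.Edge} {W : List (Fin I.n)}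
    (h : I.IsPath A u w P W) : W.Nodup ∧ W.length = P.length + 1 := by
  induction h with
  | nil => simp
  | cons he hends hu hp ih => exact ⟨List.nodup_cons.2 ⟨hu, ih.1⟩, by simp [ih.2]⟩

theorem IsPath.length_lt {u w : Fin I.n} {P : List I.Edge} {W : List (Fin I.n)}
    (h : I.IsPath A u w P W) : P.length < I.n := by
  obtain ⟨h1, h2⟩ := h.nodup
  have := h1.length_le_card
  rw [Fintype.card_fin] at this
  omega

theorem mem_blueEdges {P : List I.Edge} {e : Fin I.b} : e ∈ I.blueEdges P ↔ Sum.inr e ∈ P := by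
  simp only [blueEdges, List.mem_toFinset, List.mem_filterMap, Sum.getRight?_eq_some_iff]
  constructor
  · rintro ⟨_, h, rfl⟩
    exact h
  · exact fun h => ⟨_, h, rfl⟩

/-- A new first edge has an end outside the rest of the path and so cannot occur there. No edge is
repeated, and the sum over the list agrees with the sum over the set. -/
theorem IsPath.sum_len {u w : Fin I.n} {P : List I.Edge} {W : List (Fin I.n)}
    (h : I.IsPath A u w P W) {len : I.Edge → ℤ} (hlen : ∀ e, len (Sum.inl e) = 0) :
    (P.map len).sum = ∑ e ∈ I.blueEdges P, len (Sum.inr e) := by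
  induction h with
  | nil => simp [blueEdges]
  | @cons u v w e P W he hends hu hp ih =>
    rw [List.map_cons, List.sum_cons, ih]
    cases e with
    | inl g =>
      rw [hlen, zero_add]
      rfl
    | inr g =>
      have hg : g ∉ I.blueEdges P := fun hg => hp.not_mem_cons hends hu (mem_blueEdges.1 hg)
      have : I.blueEdges (Sum.inr g :: P) = insert g (I.blueEdges P) := by
        ext x
        simp [mem_blueEdges]
      rw [this, Finset.sum_insert hg]

open Classical in
/-- The invariant of the computation of shortest paths to `t`: `d v` is the length of some path,
unless it is `Z`, and `us v` marks the edges of this path. -/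
structure PathInv (A : Set I.Edge) (len : I.Edge → ℤ) (Z : ℤ) (t : Fin I.n) (d : Fin I.n → ℤ)
    (us : Fin I.n → I.Edge → ℤ) : Prop where
  nonneg : ∀ v, 0 ≤ d v
  le : ∀ v, d v ≤ Z
  path : ∀ v, d v < Z → ∃ (P : List I.Edge) (W : List (Fin I.n)), I.IsPath A v t P W ∧
    (∀ y ∈ W, d y ≤ d v) ∧ d v = (P.map len).sum ∧ ∀ e : I.Edge, us v e = if e ∈ P then 1 else 0

/-- The stored path of `v` visits only vertices whose distance is at most `d v`. As `d v ≤ d v + len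
e < d u`, the vertex `u` is not among them, so the extension is again a simple path, even if lengths
are zero. Distances never increase, and therefore the paths stored for the other vertices keep this
property. -/
theorem PathInv.relax {len : I.Edge → ℤ} {Z : ℤ} {t : Fin I.n} {d : Fin I.n → ℤ}
    {us : Fin I.n → I.Edge → ℤ} (h : PathInv A len Z t d us) (hlen : ∀ e, 0 ≤ len e) {u v : Fin I.n}
    {e : I.Edge} (he : e ∈ A) (hends : I.ends e = (u, v) ∨ I.ends e = (v, u))
    (hlt : d v + len e < d u) :
    PathInv A len Z t (Function.update d u (d v + len e))
      (Function.update us u (Function.update (us v) e 1)) := by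
  have hle : ∀ y, Function.update d u (d v + len e) y ≤ d y := by
    intro y
    rw [Function.update_apply]
    split_ifs with hy
    · rw [hy]
      exact hlt.le
    · exact le_rfl
  have h0 := hlen e
  refine ⟨fun y => ?_, fun y => (hle y).trans (h.le y), fun y hy => ?_⟩
  · rw [Function.update_apply]
    split_ifs
    · linarith [h.nonneg v]
    · exact h.nonneg y
  · by_cases hyu : y = u
    · subst hyu
      obtain ⟨P, W, h1, h2, h3, h4⟩ := h.path v (by linarith [h.le y])
      have hyW : y ∉ W := by
        intro hW
        linarith [h2 y hW]
      refine ⟨e :: P, y :: W, .cons he hends hyW h1, ?_, ?_, fun e' => ?_⟩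
      · intro z hz
        rw [Function.update_self]
        rcases List.mem_cons.1 hz with rfl | hz
        · rw [Function.update_self]
        · linarith [hle z, h2 z hz]
      · rw [Function.update_self, h3, List.map_cons, List.sum_cons]
        ring
      · rw [Function.update_self, Function.update_apply, h4]
        by_cases hee : e' = e
        · simp [hee]
        · rw [if_neg hee]
          by_cases heP : e' ∈ P <;> simp [hee, heP]
    · rw [Function.update_of_ne hyu] at hy
      obtain ⟨P, W, h1, h2, h3, h4⟩ := h.path y hy
      refine ⟨P, W, h1, fun z hz => ?_, ?_, fun e' => ?_⟩
      · rw [Function.update_of_ne hyu]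
        exact (hle z).trans (h2 z hz)
      · rw [Function.update_of_ne hyu, h3]
      · rw [Function.update_of_ne hyu, h4]

variable (I)

/-- The position of an edge in the arrays. -/
def idx : I.Edge → ℕ := Sum.elim (fun e => e.val) fun e => I.r + e.val

variable {I}

theorem idx_lt (e : I.Edge) : I.idx e < I.r + I.b := by
  cases e
  · simp [idx]
    omega
  · simp [idx]

theorem idx_inj {e e' : I.Edge} : I.idx e = I.idx e' ↔ e = e' := by
  cases e <;> cases e' <;> simp [idx, Fin.ext_iff] <;> omega

theorem exists_idx {x : ℕ} (hx : x < I.r + I.b) : ∃ e, I.idx e = x := by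
  by_cases h : x < I.r
  · exact ⟨Sum.inl ⟨x, h⟩, rfl⟩
  · exact ⟨Sum.inr ⟨x - I.r, by omega⟩, by simp [idx]; omega⟩

/-- The cycle inequality of a blue edge and a path. -/
def cycleIneq (f : Fin I.b) (i : Fin I.k) (P : List I.Edge) : I.Inequality where
  coeff := fun i' e =>
    (if i'.val = 0 ∧ e ∈ I.blueEdges P then 1 else 0) + (if i' = i ∧ e = f then 1 else 0)
  rhs := ((I.blueEdges P).card : ℤ)

theorem isConstraint_cycleIneq {f : Fin I.b} {i : Fin I.k} (hi : 1 ≤ i.val) {P : List I.Edge}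
    {W : List (Fin I.n)}
    (hP : I.IsPath (I.edgesWithout i f) (I.blueEnds f).1 (I.blueEnds f).2 P W) :
    I.IsConstraint (I.cycleIneq f i P) := by
  convert IsConstraint.cycle f i hi P W hP using 1
  ext i' e
  · simp only [cycleIneq]
  · rfl

end Instance

/-! ### Completeness of the shortest path test, and bounds drawn from the earlier stages -/

namespace Query

variable (q : Query)

/-- The lengths of the edges: blue edges have the length `1 - x_{1,e}`, scaled. -/
def edgeLen : q.inst.Edge → ℤ :=
  Sum.elim (fun _ => 0) fun e => if h : 0 < q.inst.k then max (q.den - q.num ⟨0, h⟩ e) 0 else 0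

theorem edgeLen_nonneg (e : q.inst.Edge) : 0 ≤ q.edgeLen e := by
  cases e with
  | inl e => exact le_rfl
  | inr e =>
    simp only [edgeLen, Sum.elim_inr]
    split_ifs
    exacts [le_max_right _ _, le_rfl]

variable {q}

theorem sum_cycleIneq (h0 : 0 < q.inst.k) (f : Fin q.inst.b) (i : Fin q.inst.k)
    (P : List q.inst.Edge) :
    ∑ i', ∑ e, (q.inst.cycleIneq f i P).coeff i' e * q.num i' e =
      ∑ e ∈ q.inst.blueEdges P, q.num ⟨0, h0⟩ e + q.num i f := by
  have h : ∀ (i' : Fin q.inst.k) (e : Fin q.inst.b),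
      (q.inst.cycleIneq f i P).coeff i' e * q.num i' e =
      (if i' = ⟨0, h0⟩ then (if e ∈ q.inst.blueEdges P then q.num i' e else 0) else 0) +
      if i' = i then (if e = f then q.num i' e else 0) else 0 := by
    intro i' e
    have : i'.val = 0 ↔ i' = ⟨0, h0⟩ := by simp [Fin.ext_iff]
    simp only [Instance.cycleIneq, this]
    rw [add_mul]
    congr 1
    · by_cases h1 : i' = ⟨0, h0⟩ <;> by_cases h2 : e ∈ q.inst.blueEdges P <;> simp [h1, h2]
    · by_cases h1 : i' = i <;> by_cases h2 : e = f <;> simp [h1, h2]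
  simp only [h, Finset.sum_add_distrib, Finset.sum_ite_irrel, Finset.sum_const_zero,
    Finset.sum_ite_eq', Finset.mem_univ, if_true, Finset.sum_ite_mem, Finset.univ_inter]

/-- The right-hand side is the length of the path before truncation at zero. -/
theorem cycle_satisfied_iff (h0 : 0 < q.inst.k) (f : Fin q.inst.b) (i : Fin q.inst.k)
    (P : List q.inst.Edge) : (q.inst.cycleIneq f i P).Satisfied q.x ↔
      q.num i f ≤ ∑ e ∈ q.inst.blueEdges P, (q.den - q.num ⟨0, h0⟩ e) := by
  rw [satisfied_iff, sum_cycleIneq h0, Finset.sum_sub_distrib, Finset.sum_const, nsmul_eq_mul]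
  simp only [Instance.cycleIneq]
  constructor <;> intro h <;> linarith

theorem sum_edgeLen (h0 : 0 < q.inst.k) {A : Set q.inst.Edge} {u w : Fin q.inst.n}
    {P : List q.inst.Edge} {W : List (Fin q.inst.n)} (h : q.inst.IsPath A u w P W) :
    (P.map q.edgeLen).sum = ∑ e ∈ q.inst.blueEdges P, max (q.den - q.num ⟨0, h0⟩ e) 0 := by
  rw [h.sum_len fun _ => rfl]
  simp [edgeLen, h0]

/-- If the shortest path satisfies its cycle inequality, then so do all paths. -/
theorem cycle_complete {i : Fin q.inst.k} (h0 : 0 < q.inst.k) {f : Fin q.inst.b}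
    {A : Set q.inst.Edge} {a t : Fin q.inst.n} {d : ℤ}
    (hnum : ∀ e, (q.inst.blueEnds e).1 ≠ (q.inst.blueEnds e).2 → q.num ⟨0, h0⟩ e ≤ q.den)
    (h1 : ∀ P W, q.inst.IsPath A a t P W → d ≤ (P.map q.edgeLen).sum)
    (h2 : d < max (q.num i f) 0 → ∃ P W, q.inst.IsPath A a t P W ∧ d = (P.map q.edgeLen).sum ∧
      (q.inst.cycleIneq f i P).Satisfied q.x)
    {P : List q.inst.Edge} {W : List (Fin q.inst.n)} (hP : q.inst.IsPath A a t P W) :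
    (q.inst.cycleIneq f i P).Satisfied q.x := by
  rw [cycle_satisfied_iff h0]
  -- Truncation at zero has no effect on a path, because a path contains no loops.
  have hsum : ∑ e ∈ q.inst.blueEdges P, (q.den - q.num ⟨0, h0⟩ e) = (P.map q.edgeLen).sum := by
    rw [sum_edgeLen h0 hP]
    refine Finset.sum_congr rfl fun e he => (max_eq_left ?_).symm
    have := hP.not_loop _ (Instance.mem_blueEdges.1 he)
    linarith [hnum e this]
  rw [hsum]
  by_contra hlt
  rw [not_le] at hlt
  have h3 := h1 P W hP
  obtain ⟨P', W', hP', hd, hs⟩ := h2 (lt_of_lt_of_le (h3.trans_lt hlt) (le_max_left _ _))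
  rw [cycle_satisfied_iff h0] at hs
  rw [sum_edgeLen h0 hP'] at hd
  have h4 : ∑ e ∈ q.inst.blueEdges P', (q.den - q.num ⟨0, h0⟩ e) ≤
      ∑ e ∈ q.inst.blueEdges P', max (q.den - q.num ⟨0, h0⟩ e) 0 :=
    Finset.sum_le_sum fun e _ => le_max_left _ _
  linarith

/-- The forest inequalities for `j = 1` bound the variables of the edges that are not loops. -/
theorem num_le_den (h0 : 0 < q.inst.k) (hnum : ∀ i e, 0 ≤ q.num i e)
    (h : ∀ 𝒞 : Finset (q.inst.Component (⟨0, h0⟩ : Fin q.inst.k)), 𝒞.Nonempty →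
      (q.inst.forestIneq ⟨0, h0⟩ 𝒞).Satisfied q.x) (e : Fin q.inst.b)
    (he : (q.inst.blueEnds e).1 ≠ (q.inst.blueEnds e).2) : q.num ⟨0, h0⟩ e ≤ q.den := by
  classical
  let j0 : Fin q.inst.k := ⟨0, h0⟩
  set G := q.inst.redGraph (⟨0, h0⟩ : Fin q.inst.k) with hG
  -- For `j = 1` no red edges are available, so every component is a single vertex.
  have hbot : G = ⊥ := by
    ext u v
    simp only [hG, Instance.redGraph, SimpleGraph.fromRel_adj, SimpleGraph.bot_adj, iff_false]
    have hR : ∀ g, g ∉ q.inst.R ((⟨0, h0⟩ : Fin q.inst.k) : ℕ) := by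
      intro g hg
      rw [q.inst.mem_R_iff (Nat.zero_le _)] at hg
      exact absurd (q.inst.rank_pos g) (by simpa using hg)
    rintro ⟨_, ⟨g, hg, _⟩ | ⟨g, hg, _⟩⟩ <;> exact hR g hg
  have hne : G.connectedComponentMk (q.inst.blueEnds e).1 ≠
      G.connectedComponentMk (q.inst.blueEnds e).2 := by
    rw [Ne, SimpleGraph.ConnectedComponent.eq, hbot, SimpleGraph.reachable_bot]
    exact he
  -- The two ends form a family with right-hand side one. The cut may also contain edges parallel to
  -- `e`, whose non-negative terms are dropped.
  have h1 := h {G.connectedComponentMk (q.inst.blueEnds e).1,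
      G.connectedComponentMk (q.inst.blueEnds e).2} (Finset.insert_nonempty _ _)
  rw [satisfied_iff] at h1
  simp only [Instance.forestIneq, Finset.card_pair hne] at h1
  have h2 : q.num ⟨0, h0⟩ e ≤ ∑ i', ∑ e', (if i' = (⟨0, h0⟩ : Fin q.inst.k) ∧ e' ∈ q.inst.cut
      (⟨0, h0⟩ : Fin q.inst.k) {G.connectedComponentMk (q.inst.blueEnds e).1,
      G.connectedComponentMk (q.inst.blueEnds e).2} then (1 : ℤ) else 0) * q.num i' e' := by
    have hpos : ∀ i' e', 0 ≤ (if i' = (⟨0, h0⟩ : Fin q.inst.k) ∧ e' ∈ q.inst.cut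
      (⟨0, h0⟩ : Fin q.inst.k) {G.connectedComponentMk (q.inst.blueEnds e).1,
      G.connectedComponentMk (q.inst.blueEnds e).2} then (1 : ℤ) else 0) * q.num i' e' := by
      intro i' e'
      split_ifs
      · simpa using hnum i' e'
      · simp
    refine le_trans (le_trans (le_of_eq ?_)
      (Finset.single_le_sum (fun e' _ => hpos j0 e') (Finset.mem_univ e)))
      (Finset.single_le_sum (fun i' _ => Finset.sum_nonneg fun e' _ => hpos i' e')
        (Finset.mem_univ j0))
    rw [if_pos, one_mul]
    refine ⟨rfl, ?_⟩
    rw [Instance.mem_cut_iff]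
    exact ⟨Finset.mem_insert_self _ _, Finset.mem_insert_of_mem (Finset.mem_singleton_self _), hne⟩
  have h3 := h2.trans h1
  simpa using h3

/-- Monotonicity and non-negativity bound all variables below. -/
theorem num_nonneg (h : ∀ i e, (q.inst.monoIneq i e).Satisfied q.x) (i : Fin q.inst.k)
    (e : Fin q.inst.b) : 0 ≤ q.num i e := by
  have key : ∀ i e, (if h : i.val + 1 < q.inst.k then q.num ⟨i.val + 1, h⟩ e else 0) ≤ q.num i e := by
    intro i e
    have h1 := h i e
    rw [satisfied_iff] at h1
    have h2 : ∀ (i' : Fin q.inst.k) (e' : Fin q.inst.b),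
        (q.inst.monoIneq i e).coeff i' e' * q.num i' e' =
        (if i'.val = i.val + 1 then (if e' = e then q.num i' e' else 0) else 0) -
        (if i' = i then (if e' = e then q.num i' e' else 0) else 0) := by
      intro i' e'
      simp only [Instance.monoIneq]
      rw [sub_mul]
      congr 1
      · by_cases h1 : i'.val = i.val + 1 <;> by_cases h2 : e' = e <;> simp [h1, h2]
      · by_cases h1 : i' = i <;> by_cases h2 : e' = e <;> simp [h1, h2]
    simp only [h2, Finset.sum_sub_distrib, Finset.sum_ite_irrel, Finset.sum_const_zero,
      Finset.sum_ite_eq', Finset.mem_univ, if_true] at h1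
    have h3 : (q.inst.monoIneq i e).rhs = 0 := rfl
    rw [h3, zero_mul] at h1
    split_ifs with hlt
    · have h4 : ∀ i' : Fin q.inst.k, i'.val = i.val + 1 ↔ i' = ⟨i.val + 1, hlt⟩ := by
        intro i'
        simp [Fin.ext_iff]
      simp only [h4, Finset.sum_ite_eq', Finset.mem_univ, if_true] at h1
      linarith
    · have h4 : ∀ i' : Fin q.inst.k, ¬ i'.val = i.val + 1 := by
        intro i'
        omega
      simp only [h4, if_false, Finset.sum_const_zero] at h1
      linarith
  -- Induction on the distance from the last level, where the bound is zero.
  obtain ⟨d, hd⟩ : ∃ d, i.val + d + 1 = q.inst.k := ⟨q.inst.k - 1 - i.val, by omega⟩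
  induction d generalizing i with
  | zero =>
    have := key i e
    rwa [dif_neg (by omega)] at this
  | succ d ih =>
    have := key i e
    rw [dif_pos (by omega)] at this
    exact (ih ⟨i.val + 1, by omega⟩ (by simp; omega)).trans this

end Query

/-! ## The cycle stage -/

section

variable {q : Query} {m : ℕ} {V : ℤ} {σ : Memory}

theorem Base.endA (h : Base q σ) (e : q.inst.Edge) : σ aEA (q.inst.idx e) = (q.inst.ends e).1.val := by
  cases e with
  | inl e => exact h.redA e
  | inr e =>
    have := h.blueA e
    simp only [Instance.idx, Instance.ends, Sum.elim_inr]
    push_cast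
    exact this

theorem Base.endB (h : Base q σ) (e : q.inst.Edge) : σ aEB (q.inst.idx e) = (q.inst.ends e).2.val := by
  cases e with
  | inl e => exact h.redB e
  | inr e =>
    have := h.blueB e
    simp only [Instance.idx, Instance.ends, Sum.elim_inr]
    push_cast
    exact this

theorem inl_mem_edgesWithout {I : Instance} {i : ℕ} {f : Fin I.b} {g : Fin I.r} :
    Sum.inl g ∈ I.edgesWithout i f ↔ g ∈ I.R i := by
  simp [Instance.edgesWithout]

theorem inr_mem_edgesWithout {I : Instance} {i : ℕ} {f g : Fin I.b} :
    Sum.inr g ∈ I.edgesWithout i f ↔ g ≠ f := by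
  simp [Instance.edgesWithout]

/-- The lengths of the edges stand in the memory, and the edges in `A` are marked. -/
def EdgeView (q : Query) (A : Set q.inst.Edge) (σ : Memory) : Prop :=
  ∀ e, σ aLen (q.inst.idx e) = q.edgeLen e ∧ (0 < σ aOk (q.inst.idx e) ↔ e ∈ A)

theorem EdgeView.frame {A : Set q.inst.Edge} {τ : Memory} {P : Program} (h : EdgeView q A σ)
    (hF : Frame P σ τ) (h1 : P.touches aLen = false) (h2 : P.touches aOk = false) :
    EdgeView q A τ := by
  intro e
  rw [hF _ h1, hF _ h2]
  exact h e

theorem EdgeView.write {A : Set q.inst.Edge} (h : EdgeView q A σ) {a : ℕ} (h1 : aLen ≠ a)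
    (h2 : aOk ≠ a) (i v : ℤ) : EdgeView q A (σ.write a i v) := by
  intro e
  rw [Memory.write_of_ne _ _ _ h1, Memory.write_of_ne _ _ _ h2]
  exact h e

theorem lengths_spec (hB : Bounds q m V) (h : Base q σ) {i : Fin q.inst.k} {f : Fin q.inst.b}
    (hc : σ cC 0 = i.val) (hf : σ cB 0 = f.val) :
    wp m lengths (fun τ => τ aLim 0 = max (q.num i f) 0 ∧
      EdgeView q (q.inst.edgesWithout i f) τ) σ := by
  have h0 : 0 < q.inst.k := i.pos
  refine wp_seq (wp_assign (fun hb => hb _ _) ?_)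
  set σ₁ := σ.write aLim ((0 : Expr).eval σ) ((rd aX (var cC * var aB + var cB)).eval σ) with hσ₁
  have e1 : σ₁ aLim 0 = q.num i f := by
    simp [hσ₁, hc, hf, h.b, h.num]
  have hσ : ∀ a, a ≠ aLim → σ₁ a = σ a := fun a ha => Memory.write_of_ne _ _ _ ha
  refine wp_then (Q := fun τ => τ aLim 0 = max (q.num i f) 0) (wp_ite (fun hpos => wp_skip ?_)
    fun hpos => wp_assign (fun _ => small_zero m) ?_) ?_
  · simp only [Expr.eval_get, Expr.eval_zero, e1] at hpos
    rw [e1, max_eq_left hpos.le]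
  · simp only [Expr.eval_get, Expr.eval_zero, e1, not_lt] at hpos
    rw [max_eq_right hpos]
    simp
  intro τ₂ _ hF₂ hlim
  have hτ₂ : ∀ a, a ≠ aLim → τ₂ a = σ a := fun a ha => by
    rw [hF₂ a (by simp [Program.touches, ha.symm]), hσ a ha]
  have hb₂ : Base q τ₂ := h.congr fun a h1 _ => hτ₂ a (by omega)
  -- For blue edges the condition on the mark is vacuous, so all of them are first admitted; the
  -- mark of `f` is removed at the very end.
  set L : Memory → q.inst.Edge → Prop := fun τ e => τ aLen (q.inst.idx e) = q.edgeLen e ∧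
    (0 < τ aOk (q.inst.idx e) ↔ ∀ g, e = Sum.inl g → g ∈ q.inst.R i) with hL
  have hLw : ∀ (τ : Memory) (x : ℤ) (e), L τ e → L (τ.write cA 0 x) e := by
    intro τ x e hI
    simpa [hL, Memory.write_of_ne] using hI
  refine wp_then (Q := fun τ => ∀ e, q.inst.idx e < q.inst.r → L τ e) ?_ ?_
  · refine wp_for q.inst.r (fun j τ => ∀ e, q.inst.idx e < j → L τ e) hB.r hb₂.r rfl rfl
      (fun j τ x hI e he => hLw τ x e (hI e he)) (by simp) ?_ (fun τ _ hI => hI)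
    intro j hj τ _ hcA hF hI
    have hb : Base q τ := hb₂.frame hF (by decide)
    have hcC : τ cC 0 = i.val := by rw [hF _ rfl, hτ₂ _ (by norm_num), hc]
    refine wp_seq (wp_assign (fun _ => small_zero m) ?_)
    set υ := τ.write aLen ((var cA).eval τ) ((0 : Expr).eval τ) with hυ
    have hυ' : ∀ a, a ≠ aLen → υ a = τ a := fun a ha => Memory.write_of_ne _ _ _ ha
    have k1 : (0 < (1 + var cC - rd aRank (var cA)).eval υ) ↔ ⟨j, hj⟩ ∈ q.inst.R i := by
      have e1 := hb.rank ⟨j, hj⟩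
      rw [q.inst.mem_R_iff i.2.le]
      simp only [Expr.eval_add, Expr.eval_sub, Expr.eval_get, Expr.eval_zero, Expr.eval_one,
        hυ' cC (by norm_num), hυ' cA (by norm_num), hυ' aRank (by norm_num), hcC, hcA]
      rw [e1]
      omega
    have hend : ∀ y : ℤ, (0 < y ↔ (⟨j, hj⟩ : Fin q.inst.r) ∈ q.inst.R i) →
        ∀ e, q.inst.idx e < j + 1 → L (υ.write aOk ((var cA).eval υ) y) e := by
      intro y hy e he
      rcases Nat.lt_succ_iff_lt_or_eq.1 he with hlt | heq
      · have := hI e hlt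
        simpa [hL, hυ, Memory.write_of_ne, Function.update_apply, hcA, hlt.ne] using this
      · have : e = Sum.inl ⟨j, hj⟩ := Instance.idx_inj.1 (by rw [heq]; rfl)
        subst this
        simp [hL, hυ, Memory.write_of_ne, Function.update_apply, hcA, heq, hy, Query.edgeLen]
    refine wp_ite (fun hpos => wp_assign (fun _ => hB.small_one) (hend _ ?_))
      (fun hpos => wp_assign (fun _ => small_zero m) (hend _ ?_))
    · simpa using k1.1 hpos
    · simpa using fun h => hpos (k1.2 h)
  intro τ₃ _ hF₃ hL₃
  have hb₃ : Base q τ₃ := hb₂.frame hF₃ (by decide)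
  refine wp_then (Q := fun τ => ∀ e, L τ e) ?_ ?_
  · refine wp_for q.inst.b (fun j τ => ∀ e, q.inst.idx e < q.inst.r + j → L τ e) hB.b hb₃.b rfl rfl
      (fun j τ x hI e he => hLw τ x e (hI e he)) hL₃ ?_
      (fun τ _ hI e => hI e (Instance.idx_lt e))
    intro j hj τ _ hcA hF hI
    have hb : Base q τ := hb₃.frame hF (by decide)
    refine wp_seq (wp_assign (fun _ => hB.small_one) ?_)
    set υ := τ.write aOk ((var aR + var cA).eval τ) ((1 : Expr).eval τ) with hυ
    have hυ' : ∀ a, a ≠ aOk → υ a = τ a := fun a ha => Memory.write_of_ne _ _ _ ha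
    have hx : (var aDen - rd aX (var cA)).eval υ = q.den - q.num ⟨0, h0⟩ ⟨j, hj⟩ := by
      have := hb.num ⟨0, h0⟩ ⟨j, hj⟩
      simp only [Nat.cast_zero, zero_mul, zero_add] at this
      simp [hυ' aDen (by norm_num), hυ' aX (by norm_num), hυ' cA (by norm_num), hcA, hb.den, this]
    have hend : ∀ y : ℤ, y = q.edgeLen (Sum.inr ⟨j, hj⟩) →
        ∀ e, q.inst.idx e < q.inst.r + (j + 1) →
          L (υ.write aLen ((var aR + var cA).eval υ) y) e := by
      intro y hy e he
      have hrA : (var aR + var cA).eval υ = ((q.inst.r + j : ℕ) : ℤ) := by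
        simp [hυ' aR (by norm_num), hυ' cA (by norm_num), hcA, hb.r]
      have hrA' : (var aR + var cA).eval τ = ((q.inst.r + j : ℕ) : ℤ) := by
        simp [hcA, hb.r]
      rcases Nat.lt_succ_iff_lt_or_eq.1 he with hlt | heq
      · have := hI e hlt
        simp only [hL] at this ⊢
        rw [hrA, Memory.write_self, Function.update_apply, if_neg (by exact_mod_cast hlt.ne),
          Memory.write_of_ne _ _ _ (by norm_num), hυ, hrA', Memory.write_self, Function.update_apply,
          if_neg (by exact_mod_cast hlt.ne), Memory.write_of_ne _ _ _ (by norm_num)]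
        exact this
      · have : e = Sum.inr ⟨j, hj⟩ := Instance.idx_inj.1 (by rw [heq]; rfl)
        subst this
        simp only [hL]
        rw [hrA, Memory.write_self, Function.update_apply, if_pos (by exact_mod_cast heq),
          Memory.write_of_ne _ _ _ (by norm_num), hυ, hrA', Memory.write_self, Function.update_apply,
          if_pos (by exact_mod_cast heq)]
        exact ⟨hy, by simp⟩
    have hlen : q.edgeLen (Sum.inr ⟨j, hj⟩) = max (q.den - q.num ⟨0, h0⟩ ⟨j, hj⟩) 0 := by
      simp [Query.edgeLen, h0]
    refine wp_ite (fun hpos => wp_assign (fun _ => ?_) (hend _ ?_))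
      (fun hpos => wp_assign (fun _ => small_zero m) (hend _ ?_))
    · rw [hx]
      refine hB.small_of_le ((abs_sub _ _).trans ?_)
      have := hB.num_le ⟨0, h0⟩ ⟨j, hj⟩
      have h2 := hB.den
      rw [abs_of_pos q.den_pos]
      linarith [hB.V_pos]
    · rw [hx] at hpos
      rw [hx, hlen, max_eq_left hpos.le]
    · rw [hx, not_lt] at hpos
      rw [hlen, max_eq_right hpos]
      rfl
  intro τ₄ _ hF₄ hL₄
  have hb₄ : Base q τ₄ := hb₃.frame hF₄ (by decide)
  refine wp_assign (fun _ => small_zero m) ⟨?_, fun e => ?_⟩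
  · rw [Memory.write_of_ne _ _ _ (by norm_num), hF₄ _ rfl, hF₃ _ rfl, hlim]
  · have hcB : τ₄ cB 0 = f.val := by
      rw [hF₄ _ rfl, hF₃ _ rfl, hτ₂ _ (by norm_num), hf]
    have hrB : (var aR + var cB).eval τ₄ = ((q.inst.idx (Sum.inr f) : ℕ) : ℤ) := by
      simp [hcB, hb₄.r, Instance.idx]
    have := hL₄ e
    simp only [hL] at this
    rw [hrB, Memory.write_self, Function.update_apply, Memory.write_of_ne _ _ _ (by norm_num)]
    refine ⟨this.1, ?_⟩
    simp only [Nat.cast_inj, Instance.idx_inj]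
    cases e with
    | inl g => simpa [inl_mem_edgesWithout] using this.2
    | inr g =>
      rw [inr_mem_edgesWithout]
      by_cases hgf : g = f
      · simp [hgf]
      · simpa [hgf] using this.2

/-- The distances and the edge sets of the paths stand in the memory. -/
def PathView (q : Query) (d : Fin q.inst.n → ℤ) (us : Fin q.inst.n → q.inst.Edge → ℤ)
    (σ : Memory) : Prop :=
  (∀ v : Fin q.inst.n, σ aDist v = d v) ∧
    ∀ (v : Fin q.inst.n) (e : q.inst.Edge),
      σ aUsed (v * ((q.inst.r + q.inst.b : ℕ) : ℤ) + q.inst.idx e) = us v e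

theorem PathView.write {d : Fin q.inst.n → ℤ} {us : Fin q.inst.n → q.inst.Edge → ℤ}
    (h : PathView q d us σ) {a : ℕ} (h1 : aDist ≠ a) (h2 : aUsed ≠ a) (i v : ℤ) :
    PathView q d us (σ.write a i v) := by
  rw [PathView, Memory.write_of_ne _ _ _ h1, Memory.write_of_ne _ _ _ h2]
  exact h

theorem relax_spec (hB : Bounds q m V) (h : Base q σ) {A : Set q.inst.Edge} (hE : EdgeView q A σ)
    {Z : ℤ} (hZ : Z ≤ V) {t : Fin q.inst.n} {d : Fin q.inst.n → ℤ}
    {us : Fin q.inst.n → q.inst.Edge → ℤ} (hP : PathView q d us σ)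
    (hI : Instance.PathInv A q.edgeLen Z t d us) {u v : Fin q.inst.n} {e : q.inst.Edge} (he : e ∈ A)
    (hends : q.inst.ends e = (u, v) ∨ q.inst.ends e = (v, u)) (hu : σ aRu 0 = u.val)
    (hv : σ aRv 0 = v.val) (hc : σ cI 0 = q.inst.idx e) :
    wp m relax (fun τ => ∃ d' us', PathView q d' us' τ ∧ Instance.PathInv A q.edgeLen Z t d' us' ∧
      (∀ y, d' y ≤ d y) ∧ d' u ≤ d v + q.edgeLen e) σ := by
  have hval : (rd aDist (var aRv) + rd aLen (var cI)).eval σ = d v + q.edgeLen e := by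
    simp [hv, hc, hP.1, hE e]
  have hdu : (rd aDist (var aRu)).eval σ = d u := by simp [hu, hP.1]
  have hlen := q.edgeLen_nonneg
  refine wp_ite (fun hpos => ?_) fun hpos => wp_skip ⟨d, us, hP, hI, fun _ => le_rfl, ?_⟩
  · rw [Expr.eval_sub, hval, hdu, sub_pos] at hpos
    refine wp_seq (wp_assign (fun _ => ?_) ?_)
    · rw [hval]
      refine hB.small_of_le ?_
      rw [abs_of_nonneg (by linarith [hI.nonneg v, hlen e])]
      linarith [hI.le u, hB.V_pos]
    rw [hval]
    set υ := σ.write aDist ((var aRu).eval σ) (d v + q.edgeLen e) with hυ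
    have hυ' : ∀ a, a ≠ aDist → υ a = σ a := fun a ha => Memory.write_of_ne _ _ _ ha
    have hbυ : Base q υ := h.write (by norm_num) _ _
    have hdist : ∀ y : Fin q.inst.n, υ aDist y = Function.update d u (d v + q.edgeLen e) y := by
      intro y
      simp [hυ, hu, Function.update_apply, hP.1, Fin.ext_iff]
    refine wp_then (Q := fun τ => ∀ (y : Fin q.inst.n) (e' : q.inst.Edge),
      τ aUsed (y * ((q.inst.r + q.inst.b : ℕ) : ℤ) + q.inst.idx e') =
        if y = u then us v e' else us y e') ?_ ?_
    · refine wp_for (q.inst.r + q.inst.b) (fun j τ => ∀ (y : Fin q.inst.n) (e' : q.inst.Edge),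
        τ aUsed (y * ((q.inst.r + q.inst.b : ℕ) : ℤ) + q.inst.idx e') =
          if y = u ∧ q.inst.idx e' < j then us v e' else us y e') hB.rb
        (by rw [hbυ.rb]; push_cast; rfl) rfl rfl ?_ ?_ ?_ ?_
      · intro i τ x hI
        simpa [Memory.write_of_ne] using hI
      · intro y e'
        rw [hυ' _ (by norm_num), hP.2]
        simp
      · intro j hj τ _ hcA hF hJ
        obtain ⟨g, rfl⟩ := Instance.exists_idx hj
        have hb : Base q τ := hbυ.frame hF (by decide)
        have hrb : τ aRB 0 = ((q.inst.r + q.inst.b : ℕ) : ℤ) := by rw [hb.rb]; push_cast; rfl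
        have hu' : τ aRu 0 = u.val := by rw [hF _ rfl, hυ' _ (by norm_num), hu]
        have hv' : τ aRv 0 = v.val := by rw [hF _ rfl, hυ' _ (by norm_num), hv]
        refine wp_assign (fun hb => hb _ _) fun y e' => ?_
        simp only [Memory.write_self, Expr.eval_add, Expr.eval_mul, Expr.eval_get, Expr.eval_zero,
          hcA, hu', hv', hrb, Function.update_apply, index_inj_iff (Instance.idx_lt e') hj, hJ,
          Fin.val_inj, Instance.idx_inj, lt_irrefl, and_false, if_false]
        by_cases hy : y = u <;> by_cases hg : e' = g
        · simp [hy, hg]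
        · have : q.inst.idx e' ≠ q.inst.idx g := fun h => hg (Instance.idx_inj.1 h)
          have : q.inst.idx e' < q.inst.idx g + 1 ↔ q.inst.idx e' < q.inst.idx g := by omega
          simp [hy, hg, this]
        · simp [hy, hg]
        · simp [hy, hg]
      · intro τ _ hJ y e'
        rw [hJ]
        simp [Instance.idx_lt]
    intro τ _ hF hJ
    have hb : Base q τ := hbυ.frame hF (by decide)
    have hrb : τ aRB 0 = ((q.inst.r + q.inst.b : ℕ) : ℤ) := by rw [hb.rb]; push_cast; rfl
    have hu' : τ aRu 0 = u.val := by rw [hF _ rfl, hυ' _ (by norm_num), hu]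
    have hc' : τ cI 0 = q.inst.idx e := by rw [hF _ rfl, hυ' _ (by norm_num), hc]
    refine wp_assign (fun _ => hB.small_one) ⟨_, _, ⟨fun y => ?_, fun y e' => ?_⟩,
      hI.relax hlen he hends hpos, fun y => ?_, ?_⟩
    · rw [Memory.write_of_ne _ _ _ (by norm_num), hF _ rfl, hdist]
    · simp only [Memory.write_self, Expr.eval_add, Expr.eval_mul, Expr.eval_get, Expr.eval_zero,
        Expr.eval_one, hu', hrb, hc', Function.update_apply,
        index_inj_iff (Instance.idx_lt e') (Instance.idx_lt e), hJ, Fin.val_inj, Instance.idx_inj]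
      by_cases hy : y = u <;> by_cases hg : e' = e <;> simp [hy, hg, Function.update_apply]
    · rw [Function.update_apply]
      split_ifs with hy
      · rw [hy]
        exact hpos.le
      · exact le_rfl
    · rw [Function.update_self]
  · rw [Expr.eval_sub, hval, hdu, sub_pos, not_lt] at hpos
    exact hpos

/-- The updates are made in place, so a value read later may already have been improved, which only
helps: the bound refers to the distances before the round. Each edge is relaxed in both directions,
as the graph is undirected. -/
theorem relaxRound_spec (hB : Bounds q m V) (h : Base q σ) {A : Set q.inst.Edge}
    (hE : EdgeView q A σ) {Z : ℤ} (hZ : Z ≤ V) {t : Fin q.inst.n} {d : Fin q.inst.n → ℤ}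
    {us : Fin q.inst.n → q.inst.Edge → ℤ} (hP : PathView q d us σ)
    (hI : Instance.PathInv A q.edgeLen Z t d us) :
    wp m relaxRound (fun τ => ∃ d' us', PathView q d' us' τ ∧
      Instance.PathInv A q.edgeLen Z t d' us' ∧ (∀ y, d' y ≤ d y) ∧ ∀ e ∈ A, ∀ u v,
        (q.inst.ends e = (u, v) ∨ q.inst.ends e = (v, u)) → d' u ≤ d v + q.edgeLen e) σ := by
  refine wp_for (q.inst.r + q.inst.b) (fun j τ => ∃ d' us', PathView q d' us' τ ∧
      Instance.PathInv A q.edgeLen Z t d' us' ∧ (∀ y, d' y ≤ d y) ∧ ∀ e ∈ A, q.inst.idx e < j →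
        ∀ u v, (q.inst.ends e = (u, v) ∨ q.inst.ends e = (v, u)) → d' u ≤ d v + q.edgeLen e) hB.rb
      (by rw [h.rb]; push_cast; rfl) rfl rfl ?_ ⟨d, us, hP, hI, fun _ => le_rfl, by simp⟩ ?_ ?_
  · rintro i τ x ⟨d', us', h1, h2⟩
    exact ⟨d', us', h1.write (by norm_num) (by norm_num) _ _, h2⟩
  · rintro j hj τ _ hcI hF ⟨d', us', h1, h2, h3, h4⟩
    obtain ⟨e, rfl⟩ := Instance.exists_idx hj
    have hb : Base q τ := h.frame hF (by decide)
    have hEτ : EdgeView q A τ := hE.frame hF rfl rfl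
    have key : (0 < (rd aOk (var cI)).eval τ) ↔ e ∈ A := by
      simp only [Expr.eval_get, Expr.eval_zero, hcI]
      exact (hEτ e).2
    refine wp_ite (fun hpos => ?_) fun hpos => wp_skip ⟨d', us', h1, h2, h3, fun e' he' hlt => ?_⟩
    · have heA := key.1 hpos
      refine wp_seq (wp_assign (fun hb => hb _ _) (wp_seq (wp_assign (fun hb => hb _ _) ?_)))
      set τ₁ := (τ.write aRu ((0 : Expr).eval τ) ((rd aEA (var cI)).eval τ)) with hτ₁
      set τ₂ := τ₁.write aRv ((0 : Expr).eval τ₁) ((rd aEB (var cI)).eval τ₁) with hτ₂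
      have hb₂ : Base q τ₂ := (hb.write (by norm_num) _ _).write (by norm_num) _ _
      have hE₂ : EdgeView q A τ₂ := (hEτ.write (by norm_num) (by norm_num) _ _).write (by norm_num)
        (by norm_num) _ _
      have hP₂ : PathView q d' us' τ₂ := (h1.write (by norm_num) (by norm_num) _ _).write (by norm_num)
        (by norm_num) _ _
      have hu₂ : τ₂ aRu 0 = (q.inst.ends e).1.val := by
        simp [hτ₂, hτ₁, Memory.write_of_ne, hcI, hb.endA e]
      have hv₂ : τ₂ aRv 0 = (q.inst.ends e).2.val := by
        simp [hτ₂, hτ₁, Memory.write_of_ne, hcI, hb.endB e]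
      have hc₂ : τ₂ cI 0 = q.inst.idx e := by
        simp [hτ₂, hτ₁, Memory.write_of_ne, hcI]
      refine wp_then (relax_spec hB hb₂ hE₂ hZ hP₂ h2 heA (u := (q.inst.ends e).1)
        (v := (q.inst.ends e).2) (Or.inl rfl) hu₂ hv₂ hc₂) ?_
      rintro τ₃ _ hF₃ ⟨d₃, us₃, hP₃, hI₃, hle₃, hd₃⟩
      have hb₃ : Base q τ₃ := hb₂.frame hF₃ (by decide)
      have hE₃ : EdgeView q A τ₃ := hE₂.frame hF₃ rfl rfl
      have hc₃ : τ₃ cI 0 = q.inst.idx e := by rw [hF₃ _ rfl, hc₂]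
      refine wp_seq (wp_assign (fun hb => hb _ _) (wp_seq (wp_assign (fun hb => hb _ _) ?_)))
      set τ₄ := (τ₃.write aRu ((0 : Expr).eval τ₃) ((rd aEB (var cI)).eval τ₃)) with hτ₄
      set τ₅ := τ₄.write aRv ((0 : Expr).eval τ₄) ((rd aEA (var cI)).eval τ₄) with hτ₅
      have hb₅ : Base q τ₅ := (hb₃.write (by norm_num) _ _).write (by norm_num) _ _
      have hE₅ : EdgeView q A τ₅ := (hE₃.write (by norm_num) (by norm_num) _ _).write (by norm_num)
        (by norm_num) _ _
      have hP₅ : PathView q d₃ us₃ τ₅ := (hP₃.write (by norm_num) (by norm_num) _ _).write (by norm_num)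
        (by norm_num) _ _
      have hu₅ : τ₅ aRu 0 = (q.inst.ends e).2.val := by
        simp [hτ₅, hτ₄, Memory.write_of_ne, hc₃, hb₃.endB e]
      have hv₅ : τ₅ aRv 0 = (q.inst.ends e).1.val := by
        simp [hτ₅, hτ₄, Memory.write_of_ne, hc₃, hb₃.endA e]
      have hc₅ : τ₅ cI 0 = q.inst.idx e := by
        simp [hτ₅, hτ₄, Memory.write_of_ne, hc₃]
      refine wp_mono (relax_spec hB hb₅ hE₅ hZ hP₅ hI₃ heA (u := (q.inst.ends e).2)
        (v := (q.inst.ends e).1) (Or.inr rfl) hu₅ hv₅ hc₅) ?_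
      rintro τ₆ _ _ ⟨d₆, us₆, hP₆, hI₆, hle₆, hd₆⟩
      refine ⟨d₆, us₆, hP₆, hI₆, fun y => (hle₆ y).trans ((hle₃ y).trans (h3 y)), ?_⟩
      intro e' he' hlt u v huv
      rcases Nat.lt_succ_iff_lt_or_eq.1 hlt with hlt | heq
      · exact ((hle₆ u).trans (hle₃ u)).trans (h4 e' he' hlt u v huv)
      · have := Instance.idx_inj.1 heq
        subst this
        rcases huv with huv | huv
        · rw [huv] at hd₃
          have := hle₆ u
          have := h3 v
          simp only at hd₃
          linarith
        · rw [huv] at hd₆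
          have := hle₃ v
          have := h3 v
          simp only at hd₆
          linarith
    · rcases Nat.lt_succ_iff_lt_or_eq.1 hlt with hlt | heq
      · exact h4 e' he' hlt
      · have := Instance.idx_inj.1 heq
        subst this
        exact absurd (key.2 he') hpos
  · rintro τ _ ⟨d', us', h1, h2, h3, h4⟩
    exact ⟨d', us', h1, h2, h3, fun e he => h4 e he (Instance.idx_lt e)⟩

/-- After `j` rounds `d v` is at most the length of every path with at most `j` edges, and a path
has fewer than `n` edges. The initial value `Z` replaces infinity: a path of length at least `Z`
satisfies its cycle inequality anyway, and all distances remain small. -/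
theorem shortestPaths_spec (hB : Bounds q m V) (h : Base q σ) {A : Set q.inst.Edge}
    (hE : EdgeView q A σ) {Z : ℤ} (hZ : Z ≤ V) (hZ0 : 0 ≤ Z) (hlim : σ aLim 0 = Z)
    {f : Fin q.inst.b} (hf : σ cB 0 = f.val) :
    wp m shortestPaths (fun τ => ∃ d us, PathView q d us τ ∧
      Instance.PathInv A q.edgeLen Z (q.inst.blueEnds f).2 d us ∧
      ∀ v P W, q.inst.IsPath A v (q.inst.blueEnds f).2 P W → d v ≤ (P.map q.edgeLen).sum) σ := by
  set t := (q.inst.blueEnds f).2 with ht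
  refine wp_then (Q := fun τ => ∀ v : Fin q.inst.n, τ aDist v = Z) ?_ ?_
  · refine wp_for q.inst.n (fun j τ => ∀ v : Fin q.inst.n, v.val < j → τ aDist v = Z) hB.n h.n rfl rfl
      ?_ (by simp) ?_ (fun τ _ hI v => hI v v.2)
    · intro i τ x hI
      simpa [Memory.write_of_ne] using hI
    · intro j hj τ _ hcA hF hI
      refine wp_assign (fun hb => hb _ _) fun v hv => ?_
      simp only [Memory.write_self, Expr.eval_get, Expr.eval_zero, hcA, Function.update_apply,
        Nat.cast_inj]
      split_ifs with hvj
      · rw [hF _ rfl, hlim]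
      · exact hI v (by omega)
  intro τ₁ _ hF₁ hd₁
  have hb₁ : Base q τ₁ := h.frame hF₁ (by decide)
  have hf₁ : τ₁ cB 0 = f.val := by rw [hF₁ _ rfl, hf]
  have hE₁ : EdgeView q A τ₁ := hE.frame hF₁ rfl rfl
  refine wp_seq (wp_assign (fun _ => small_zero m) ?_)
  have hend : ∀ τ : Memory, Base q τ → τ cB 0 = f.val →
      (rd aEB (var aR + var cB)).eval τ = t.val := by
    intro τ hb hfτ
    simp [hfτ, hb.r, hb.blueB, ht]
  rw [hend _ hb₁ hf₁]
  set τ₂ := τ₁.write aDist t.val ((0 : Expr).eval τ₁) with hτ₂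
  have hb₂ : Base q τ₂ := hb₁.write (by norm_num) _ _
  have hf₂ : τ₂ cB 0 = f.val := by rw [hτ₂, Memory.write_of_ne _ _ _ (by norm_num), hf₁]
  have hE₂ : EdgeView q A τ₂ := hE₁.write (by norm_num) (by norm_num) _ _
  have hd₂ : ∀ v : Fin q.inst.n, τ₂ aDist v = if v = t then 0 else Z := by
    intro v
    simp [hτ₂, Function.update_apply, hd₁, Fin.ext_iff]
  refine wp_then (Q := fun τ => ∀ e, τ aUsed (t * ((q.inst.r + q.inst.b : ℕ) : ℤ) + q.inst.idx e) = 0)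
    ?_ ?_
  · refine wp_for (q.inst.r + q.inst.b) (fun j τ => ∀ e, q.inst.idx e < j →
      τ aUsed (t * ((q.inst.r + q.inst.b : ℕ) : ℤ) + q.inst.idx e) = 0) hB.rb
        (by rw [hb₂.rb]; push_cast; rfl) rfl rfl ?_ (by simp) ?_
        (fun τ _ hI e => hI e (Instance.idx_lt e))
    · intro i τ x hI
      simpa [Memory.write_of_ne] using hI
    · intro j hj τ _ hcA hF hI
      have hb : Base q τ := hb₂.frame hF (by decide)
      have hrb : τ aRB 0 = ((q.inst.r + q.inst.b : ℕ) : ℤ) := by rw [hb.rb]; push_cast; rfl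
      refine wp_assign (fun _ => small_zero m) fun e he => ?_
      rw [Expr.eval_add, Expr.eval_mul, hend τ hb (by rw [hF _ rfl, hf₂])]
      simp only [Memory.write_self, Expr.eval_get, Expr.eval_zero, hcA, hrb, Function.update_apply,
        index_inj_iff (Instance.idx_lt e) hj, true_and]
      split_ifs with hej
      · rfl
      · exact hI e (by omega)
  intro τ₃ _ hF₃ hu₃
  have hb₃ : Base q τ₃ := hb₂.frame hF₃ (by decide)
  have hE₃ : EdgeView q A τ₃ := hE₂.frame hF₃ rfl rfl
  refine wp_for q.inst.n (fun j τ => ∃ d us, PathView q d us τ ∧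
      Instance.PathInv A q.edgeLen Z t d us ∧ ∀ v P W, q.inst.IsPath A v t P W → P.length ≤ j →
      d v ≤ (P.map q.edgeLen).sum) hB.n hb₃.n rfl rfl ?_ ?_ ?_ ?_
  · rintro i τ x ⟨d, us, h1, h2⟩
    exact ⟨d, us, h1.write (by norm_num) (by norm_num) _ _, h2⟩
  · refine ⟨fun v => if v = t then 0 else Z,
      fun v e => τ₃ aUsed (v * ((q.inst.r + q.inst.b : ℕ) : ℤ) + q.inst.idx e),
      ⟨fun v => by rw [hF₃ _ rfl, hd₂], fun _ _ => rfl⟩, ⟨fun v => ?_, fun v => ?_, fun v hv => ?_⟩, ?_⟩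
    · split_ifs
      exacts [le_rfl, hZ0]
    · split_ifs
      exacts [hZ0, le_rfl]
    · by_cases hvt : v = t
      · subst hvt
        exact ⟨[], [t], .nil _, by simp, by simp, fun e => by simpa using hu₃ e⟩
      · simp [hvt] at hv
    · intro v P W hP hlen
      have : P = [] := List.length_eq_zero_iff.1 (by omega)
      subst this
      cases hP
      simp
  · rintro j hj τ _ _ hF ⟨d, us, h1, h2, h3⟩
    have hb : Base q τ := hb₃.frame hF (by decide)
    refine wp_mono (relaxRound_spec hB hb (hE₃.frame hF rfl rfl) hZ h1 h2) ?_
    rintro τ' _ _ ⟨d', us', h1', h2', h3', h4'⟩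
    refine ⟨d', us', h1', h2', fun v P W hP hlen => ?_⟩
    -- The paths end in `t`, so a path is split at its first edge, and the hypothesis of the
    -- previous round applies to the rest.
    cases hP with
    | nil => exact (h3' _).trans (h3 _ _ _ (.nil _) (by simp))
    | cons he hends hu hp =>
      have h5 := h3 _ _ _ hp (by simpa using hlen)
      have h6 := h4' _ he _ _ hends
      rw [List.map_cons, List.sum_cons]
      linarith
  · rintro τ _ ⟨d, us, h1, h2, h3⟩
    exact ⟨d, us, h1, h2, fun v P W hP => h3 v P W hP hP.length_lt.le⟩

end

section

variable {q : Query} {m : ℕ} {V : ℤ} {σ : Memory}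

/-- Since `1 ≤ i`, the entry of `f` on level `i` lies outside the row of level `0`, and no
coefficient exceeds one. -/
theorem cycleCand_spec (hB : Bounds q m V) (h : Base q σ) {i : Fin q.inst.k} (hi : 1 ≤ i.val)
    {f : Fin q.inst.b} (hc : σ cC 0 = i.val) (hf : σ cB 0 = f.val) {P : List q.inst.Edge}
    (hused : ∀ e : Fin q.inst.b, σ aUsed ((q.inst.blueEnds f).1 *
      ((q.inst.r + q.inst.b : ℕ) : ℤ) + q.inst.idx (Sum.inr e)) =
        if e ∈ q.inst.blueEdges P then 1 else 0) :
    wp m cycleCand (Cand q (q.inst.cycleIneq f i P)) σ := by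
  classical
  set F : Fin q.inst.b → ℤ := fun e => if e ∈ q.inst.blueEdges P then 1 else 0 with hF
  have hF0 : ∀ e, 0 ≤ F e ∧ F e ≤ 1 := by
    intro e
    simp only [hF]
    split_ifs <;> simp
  refine wp_then (clearCand_spec hB h) fun τ₁ _ hF₁ hz => ?_
  have hb₁ : Base q τ₁ := h.frame hF₁ (by decide)
  refine wp_seq (wp_assign (fun _ => small_zero m) ?_)
  set τ₂ := τ₁.write aRhs ((0 : Expr).eval τ₁) ((0 : Expr).eval τ₁) with hτ₂
  have hb₂ : Base q τ₂ := hb₁.write (by norm_num) _ _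
  have hσ : ∀ a, a ≠ aRhs → a ≠ cA → a ≠ aCf → τ₂ a = σ a := by
    intro a h1 h2 h3
    rw [hτ₂, Memory.write_of_ne _ _ _ h1,
      hF₁ a (by simp [clearCand, forLoop, Program.touches, Ne.symm h2, Ne.symm h3])]
  refine wp_then (Q := fun τ => τ aRhs 0 = ∑ e, F e ∧ ∀ (i' : Fin q.inst.k) (e : Fin q.inst.b),
    τ aCf (i' * q.inst.b + e) = if i'.val = 0 then F e else 0) ?_ ?_
  · refine wp_for q.inst.b (fun j τ => (τ aRhs 0 = ∑ e : Fin q.inst.b, if e.val < j then F e else 0) ∧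
      ∀ (i' : Fin q.inst.k) (e : Fin q.inst.b),
        τ aCf (i' * q.inst.b + e) = if i'.val = 0 ∧ e.val < j then F e else 0) hB.b hb₂.b rfl rfl
      ?_ ?_ ?_ ?_
    · intro i τ x hI
      simpa [Memory.write_of_ne] using hI
    · refine ⟨by simp [hτ₂], fun i' e => ?_⟩
      rw [hτ₂, Memory.write_of_ne _ _ _ (by norm_num), hz]
      simp
    · rintro j hj τ _ hcA hFτ ⟨h1, h2⟩
      have hb : Base q τ := hb₂.frame hFτ (by decide)
      have hval : (rd aUsed (rd aEA (var aR + var cB) * var aRB + (var aR + var cA))).eval τ =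
          F ⟨j, hj⟩ := by
        have hcB : τ cB 0 = f.val := by
          rw [hFτ _ rfl, hσ _ (by norm_num) (by norm_num) (by norm_num), hf]
        have hu : τ aUsed = σ aUsed := by
          rw [hFτ _ rfl, hσ _ (by norm_num) (by norm_num) (by norm_num)]
        have := hused ⟨j, hj⟩
        simp only [Expr.eval_add, Expr.eval_mul, Expr.eval_get, Expr.eval_zero, hcB, hcA, hb.r, hb.rb,
          hb.blueA, hu]
        refine Eq.trans ?_ this
        simp [Instance.idx]
      refine wp_seq (wp_assign (fun hb => hb _ _) ?_)
      rw [hval]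
      have hcA' : (var cA).eval τ = j := by simp [hcA]
      rw [hcA']
      set υ := τ.write aCf j (F ⟨j, hj⟩) with hυ
      have hsum : (var aRhs + rd aCf (var cA)).eval υ =
          ∑ e : Fin q.inst.b, if e.val < j + 1 then F e else 0 := by
        rw [sum_ite_lt_succ _ hj]
        simp [hυ, Memory.write_of_ne, hcA, h1]
      refine wp_assign (fun _ => ?_) ?_
      · rw [hsum]
        have b1 := sum_ite_lt_le (fun v => (hF0 v).2) (fun _ => zero_le_one) (j + 1)
        have b2 : 0 ≤ ∑ e : Fin q.inst.b, if e.val < j + 1 then F e else 0 :=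
          Finset.sum_nonneg fun v _ => by split_ifs; exacts [(hF0 v).1, le_rfl]
        have b3 : ∑ e : Fin q.inst.b, (1 : ℤ) = q.inst.b := by simp
        rw [b3] at b1
        have b4 := hB.b
        refine small_of_le ?_
        rw [abs_of_nonneg b2]
        omega
      · rw [hsum]
        refine ⟨by simp, fun i' e => ?_⟩
        have hij : (i' : ℤ) * q.inst.b + e = j ↔ i'.val = 0 ∧ e.val = j := by
          rw [← index_inj_iff e.2 hj]
          simp
        simp only [hυ, Memory.write_of_ne _ _ _ (show aCf ≠ aRhs by norm_num), Memory.write_self,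
          Function.update_apply, hij, h2]
        by_cases he : e.val = j
        · have : e = ⟨j, hj⟩ := Fin.ext he
          subst this
          simp
        · have : e.val < j + 1 ↔ e.val < j := by omega
          simp only [he, this, and_false, if_false]
    · rintro τ _ ⟨h1, h2⟩
      refine ⟨by rw [h1, sum_ite_lt_all], fun i' e => ?_⟩
      rw [h2]
      simp
  rintro τ₃ _ hF₃ ⟨hr, hcf⟩
  have hb₃ : Base q τ₃ := hb₂.frame hF₃ (by decide)
  have hcC : τ₃ cC 0 = i.val := by
    rw [hF₃ _ rfl, hσ _ (by norm_num) (by norm_num) (by norm_num), hc]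
  have hcB : τ₃ cB 0 = f.val := by
    rw [hF₃ _ rfl, hσ _ (by norm_num) (by norm_num) (by norm_num), hf]
  refine wp_assign (fun _ => hB.small_one) ⟨fun i' e => ?_, ?_, fun i' e => ?_⟩
  · simp only [Memory.write_self, Expr.eval_add, Expr.eval_mul, Expr.eval_get, Expr.eval_zero,
      Expr.eval_one, hcC, hcB, hb₃.b, Function.update_apply, index_inj_iff e.2 f.2, hcf,
      Instance.cycleIneq, hF, Fin.val_inj]
    by_cases hie : i' = i ∧ e = f
    · have : i.val ≠ 0 := by omega
      simp [hie, this]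
    · by_cases h0 : i'.val = 0 <;> simp [hie, h0]
  · rw [Memory.write_of_ne _ _ _ (by norm_num), hr]
    simp [hF, Instance.cycleIneq]
  · simp only [Instance.cycleIneq]
    by_cases hie : i' = i ∧ e = f
    · have : i.val ≠ 0 := by omega
      simp [hie, this]
    · simp only [hie, if_false, add_zero]
      split_ifs <;> simp

/-- If the distance does not fall below the limit `max (q.num i f) 0`, all paths satisfy their
inequality and nothing has to be tested. Otherwise the stored path is a shortest one, and its
inequality decides all others. -/
theorem cycleStage_spec (hB : Bounds q m V) (h : Base q σ) {Φ : Prop} (hO : Ok q Φ σ)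
    (hΦ : Φ → ∀ (h0 : 0 < q.inst.k) (e : Fin q.inst.b),
      (q.inst.blueEnds e).1 ≠ (q.inst.blueEnds e).2 → q.num ⟨0, h0⟩ e ≤ q.den) :
    wp m cycleStage (Ok q (Φ ∧ ∀ (f : Fin q.inst.b) (i : Fin q.inst.k), 1 ≤ i.val → ∀ P W,
      q.inst.IsPath (q.inst.edgesWithout i f) (q.inst.blueEnds f).1 (q.inst.blueEnds f).2 P W →
      (q.inst.cycleIneq f i P).Satisfied q.x)) σ := by
  set G : Fin q.inst.b → Fin q.inst.k → Prop := fun f i => 1 ≤ i.val → ∀ P W,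
      q.inst.IsPath (q.inst.edgesWithout i f) (q.inst.blueEnds f).1 (q.inst.blueEnds f).2 P W →
      (q.inst.cycleIneq f i P).Satisfied q.x with hG
  refine wp_for q.inst.b (fun j τ => Ok q (Φ ∧ ∀ f : Fin q.inst.b, f.val < j → ∀ i, G f i) τ) hB.b h.b
    rfl rfl (fun _ _ _ hI => hI.write (by norm_num) _ _) (hO.mono fun h => ⟨h, by simp⟩) ?_
    (fun τ _ hI => hI.mono fun h => ⟨h.1, fun f => h.2 f f.2⟩)
  intro y hy τ _ hcB hF hI
  have hb : Base q τ := h.frame hF (by decide)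
  set f : Fin q.inst.b := ⟨y, hy⟩ with hf
  refine wp_for q.inst.k (fun j τ => Ok q ((Φ ∧ ∀ f : Fin q.inst.b, f.val < y → ∀ i, G f i) ∧
      ∀ i : Fin q.inst.k, i.val < j → G f i) τ) hB.k hb.k
    rfl rfl (fun _ _ _ hI => hI.write (by norm_num) _ _) (hI.mono fun h => ⟨h, by simp⟩) ?_ ?_
  · intro x hx τ₁ _ hcC hF₁ hI₁
    have hb₁ : Base q τ₁ := hb.frame hF₁ (by decide)
    have hcB₁ : τ₁ cB 0 = f.val := by rw [hF₁ _ rfl, hcB]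
    set i : Fin q.inst.k := ⟨x, hx⟩ with hi
    have h0 : 0 < q.inst.k := i.pos
    have hnext : ((Φ ∧ ∀ f : Fin q.inst.b, f.val < y → ∀ i, G f i) ∧
        ∀ i : Fin q.inst.k, i.val < x → G f i) → G f i →
        ((Φ ∧ ∀ f : Fin q.inst.b, f.val < y → ∀ i, G f i) ∧
          ∀ i : Fin q.inst.k, i.val < x + 1 → G f i) := by
      rintro ⟨h1, h2⟩ h3
      refine ⟨h1, fun i' hi' => ?_⟩
      rcases Nat.lt_succ_iff_lt_or_eq.1 hi' with hlt | heq
      · exact h2 i' hlt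
      · have : i' = i := Fin.ext heq
        rwa [this]
    refine wp_ite (fun hpos => ?_) fun hpos => wp_skip (hI₁.mono fun h => hnext h fun h1 => ?_)
    · have hi1 : 1 ≤ i.val := by
        simp only [Expr.eval_get, Expr.eval_zero, hcC] at hpos
        have : 0 < x := by exact_mod_cast hpos
        exact this
      refine wp_then (lengths_spec hB hb₁ (i := i) hcC hcB₁) ?_
      rintro τ₂ _ hF₂ ⟨hlim, hE⟩
      have hb₂ : Base q τ₂ := hb₁.frame hF₂ (by decide)
      have hcB₂ : τ₂ cB 0 = f.val := by rw [hF₂ _ rfl, hcB₁]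
      have hcC₂ : τ₂ cC 0 = i.val := by rw [hF₂ _ rfl, hcC]
      have hI₂ := hI₁.frame hF₂ rfl
      have hZ : max (q.num i f) 0 ≤ V :=
        max_le ((le_abs_self _).trans (hB.num_le i f)) hB.V_pos.le
      refine wp_then (shortestPaths_spec hB hb₂ hE hZ (le_max_right _ _) hlim hcB₂) ?_
      rintro τ₃ _ hF₃ ⟨d, us, hPV, hPI, hmin⟩
      have hb₃ : Base q τ₃ := hb₂.frame hF₃ (by decide)
      have hcB₃ : τ₃ cB 0 = f.val := by rw [hF₃ _ rfl, hcB₂]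
      have hcC₃ : τ₃ cC 0 = i.val := by rw [hF₃ _ rfl, hcC₂]
      have hI₃ := hI₂.frame hF₃ rfl
      have key : 0 < (var aLim - rd aDist (rd aEA (var aR + var cB))).eval τ₃ ↔
          d (q.inst.blueEnds f).1 < max (q.num i f) 0 := by
        have h1 := hPV.1 (q.inst.blueEnds f).1
        simp only [Expr.eval_sub, Expr.eval_add, Expr.eval_get, Expr.eval_zero, hcB₃, hb₃.r,
          hb₃.blueA, h1, sub_pos]
        rw [hF₃ _ rfl, hlim]
      refine wp_ite (fun hpos => ?_) fun hpos => wp_skip (hI₃.mono fun h => hnext h fun _ P W hP => ?_)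
      · rw [key] at hpos
        obtain ⟨P, W, hP, _, hd, hus⟩ := hPI.path _ hpos
        refine wp_then (cycleCand_spec hB hb₃ hi1 hcC₃ hcB₃ (P := P) fun e => ?_) ?_
        · rw [hPV.2, hus]
          by_cases he : (Sum.inr e : q.inst.Edge) ∈ P <;> simp [he, Instance.mem_blueEdges]
        intro τ₄ _ hF₄ hcand
        have hb₄ : Base q τ₄ := hb₃.frame hF₄ (by decide)
        refine wp_mono (check_spec hB hb₄ (Instance.isConstraint_cycleIneq hi1 hP) hcand
          (hI₃.frame hF₄ rfl)) fun τ₅ _ _ hOk => hOk.mono ?_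
        rintro ⟨h1, h2⟩
        exact hnext h1 fun _ P' W' hP' => Query.cycle_complete h0 (hΦ h1.1.1 h0) (hmin _)
          (fun _ => ⟨P, W, hP, hd, h2⟩) hP'
      · rw [key] at hpos
        exact Query.cycle_complete h0 (hΦ h.1.1 h0) (hmin _) (fun h => absurd h hpos) hP
    -- Level `0` stands for `j = 1`, for which there are no cycle inequalities.
    · refine absurd ?_ hpos
      simp only [Expr.eval_get, Expr.eval_zero, hcC]
      exact_mod_cast h1
  · intro τ₁ _ hI₁
    refine hI₁.mono ?_
    rintro ⟨⟨h1, h2⟩, h3⟩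
    refine ⟨h1, fun f' hf' => ?_⟩
    rcases Nat.lt_succ_iff_lt_or_eq.1 hf' with hlt | heq
    · exact h2 f' hlt
    · have : f' = f := Fin.ext heq
      rw [this]
      exact fun i => h3 i i.2

end

/-! ## The preparations -/

/-- The rule for assignments, with the values of the expressions computed. -/
theorem wp_write {m a : ℕ} {i e : Expr} {σ : Memory} {Q : Memory → Prop} {x y : ℤ}
    (hi : i.eval σ = x) (he : e.eval σ = y) (hs : σ.Bdd m → Small m y) (h : Q (σ.write a x y)) :
    wp m (.assign a i e) Q σ := by
  subst hi he
  exact wp_assign hs h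

theorem prod_range_mul {M : Type*} [CommMonoid M] (k b : ℕ) (f : ℕ → M) :
    ∏ p ∈ Finset.range (k * b), f p = ∏ i : Fin k, ∏ e : Fin b, f (i * b + e) :=
  sum_range_mul (M := Additive M) k b f

/-- The input stands in the memory. -/
structure Input (q : Query) (σ : Memory) : Prop where
  n : σ aIn 1 = q.inst.n
  r : σ aIn 2 = q.inst.r
  b : σ aIn 3 = q.inst.b
  redA : ∀ e : Fin q.inst.r, σ aIn (4 + 4 * e) = (q.inst.redEnds e).1
  redB : ∀ e : Fin q.inst.r, σ aIn (5 + 4 * e) = (q.inst.redEnds e).2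
  costNum : ∀ e : Fin q.inst.r, σ aIn (6 + 4 * e) = (q.inst.cost e).num
  costDen : ∀ e : Fin q.inst.r, σ aIn (7 + 4 * e) = (q.inst.cost e).den
  blueA : ∀ e : Fin q.inst.b, σ aIn (4 + 4 * q.inst.r + 2 * e) = (q.inst.blueEnds e).1
  blueB : ∀ e : Fin q.inst.b, σ aIn (5 + 4 * q.inst.r + 2 * e) = (q.inst.blueEnds e).2
  xNum : ∀ (i : Fin q.inst.k) (e : Fin q.inst.b),
    σ aIn (4 + 4 * q.inst.r + 2 * q.inst.b + 2 * (i * q.inst.b + e)) = (q.x i e).num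
  xDen : ∀ (i : Fin q.inst.k) (e : Fin q.inst.b),
    σ aIn (4 + 4 * q.inst.r + 2 * q.inst.b + 2 * (i * q.inst.b + e) + 1) = (q.x i e).den

theorem Input.congr {q : Query} {σ τ : Memory} (h : Input q σ) (hτ : τ aIn = σ aIn) : Input q τ := by
  constructor <;> rw [hτ]
  exacts [h.n, h.r, h.b, h.redA, h.redB, h.costNum, h.costDen, h.blueA, h.blueB, h.xNum, h.xDen]

theorem initialMemory_succ (w : List ℤ) (p : ℕ) : initialMemory w 0 ((p : ℤ) + 1) = w[p]?.getD 0 := by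
  have h1 : ((p : ℤ) + 1) ≠ 0 := by omega
  have h2 : 0 < ((p : ℤ) + 1) := by omega
  have h3 : ((p : ℤ) + 1).toNat - 1 = p := by omega
  simp [initialMemory, h1, h2, h3]

/-- Position `p` of the word stands in cell `p + 1`. After the three dimensions, the red edges begin
in cell `4` with four cells each; the blue edges and the coordinates follow with two cells each. -/
theorem input_initialMemory (q : Query) : Input q (initialMemory q.encode) := by
  have hcell : ∀ (z : ℤ) (p : ℕ) (v : ℤ), z = (p : ℤ) + 1 → q.encode[p]? = some v →
      initialMemory q.encode aIn z = v := by
    rintro z p v rfl h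
    rw [initialMemory_succ, h]
    rfl
  set A : List ℤ := [(q.inst.n : ℤ), (q.inst.r : ℤ), (q.inst.b : ℤ)] with hA
  set R : List ℤ := (List.finRange q.inst.r).flatMap fun e =>
    encodeEnds (q.inst.redEnds e) ++ encodeRat (q.inst.cost e) with hR
  set B : List ℤ := (List.finRange q.inst.b).flatMap fun e => encodeEnds (q.inst.blueEnds e) with hB
  set X : List ℤ := (List.finRange q.inst.k).flatMap fun i =>
    (List.finRange q.inst.b).flatMap fun e => encodeRat (q.x i e) with hX
  have henc : q.encode = A ++ (R ++ (B ++ X)) := by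
    simp only [Query.encode, List.append_assoc, hA, hR, hB, hX]
  have hRl : R.length = q.inst.r * 4 := length_flatMap_finRange _ fun _ => rfl
  have hBl : B.length = q.inst.b * 2 := length_flatMap_finRange _ fun _ => rfl
  have hr : ∀ (e : Fin q.inst.r) (c : ℕ) (hc : c < 4), q.encode[3 + (e.val * 4 + c)]? =
      (encodeEnds (q.inst.redEnds e) ++ encodeRat (q.inst.cost e))[c]? := by
    intro e c hc
    rw [henc, List.getElem?_append_right (by simp [hA]), List.getElem?_append_left]
    · have : 3 + (e.val * 4 + c) - A.length = e.val * 4 + c := by simp [hA]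
      rw [this]
      exact getElem?_flatMap_finRange (b := 4)
        (fun e => encodeEnds (q.inst.redEnds e) ++ encodeRat (q.inst.cost e)) (fun _ => rfl) e hc
    · have := e.2
      simp [hA, hRl]
      omega
  have hb : ∀ (e : Fin q.inst.b) (c : ℕ) (hc : c < 2),
      q.encode[3 + (q.inst.r * 4 + (e.val * 2 + c))]? = (encodeEnds (q.inst.blueEnds e))[c]? := by
    intro e c hc
    have h3 : 3 + (q.inst.r * 4 + (e.val * 2 + c)) - A.length - R.length = e.val * 2 + c := by
      rw [hRl]
      simp [hA]
    rw [henc, List.getElem?_append_right (by simp [hA]), List.getElem?_append_right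
      (by rw [hRl]; simp [hA]), h3, List.getElem?_append_left]
    · exact getElem?_flatMap_finRange (b := 2) (fun e => encodeEnds (q.inst.blueEnds e))
        (fun _ => rfl) e hc
    · have := e.2
      rw [hBl]
      omega
  have hx : ∀ (i : Fin q.inst.k) (e : Fin q.inst.b) (c : ℕ) (hc : c < 2),
      q.encode[3 + (q.inst.r * 4 + (q.inst.b * 2 + (i.val * (q.inst.b * 2) + (e.val * 2 + c))))]? =
        (encodeRat (q.x i e))[c]? := by
    intro i e c hc
    have h3 : 3 + (q.inst.r * 4 + (q.inst.b * 2 + (i.val * (q.inst.b * 2) + (e.val * 2 + c))))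
        - A.length - R.length - B.length = i.val * (q.inst.b * 2) + (e.val * 2 + c) := by
      rw [hRl, hBl]
      simp [hA]
    rw [henc, List.getElem?_append_right (by simp [hA]), List.getElem?_append_right
      (by rw [hRl]; simp [hA]), List.getElem?_append_right (by rw [hRl, hBl]; simp [hA]), h3, hX,
      getElem?_flatMap_finRange (b := q.inst.b * 2)
        (fun i => (List.finRange q.inst.b).flatMap fun e => encodeRat (q.x i e))
        (fun _ => length_flatMap_finRange _ fun _ => rfl) i]
    · exact getElem?_flatMap_finRange (b := 2) (fun e => encodeRat (q.x i e)) (fun _ => rfl) e hc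
    · have := e.2
      omega
  refine ⟨?_, ?_, ?_, fun e => ?_, fun e => ?_, fun e => ?_, fun e => ?_, fun e => ?_, fun e => ?_,
    fun i e => ?_, fun i e => ?_⟩
  · exact hcell _ 0 _ (by norm_num) (by simp [Query.encode])
  · exact hcell _ 1 _ (by norm_num) (by simp [Query.encode])
  · exact hcell _ 2 _ (by norm_num) (by simp [Query.encode])
  · exact hcell _ _ _ (by push_cast; ring) (hr e 0 (by norm_num))
  · exact hcell _ _ _ (by push_cast; ring) (hr e 1 (by norm_num))
  · exact hcell _ _ _ (by push_cast; ring) (hr e 2 (by norm_num))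
  · exact hcell _ _ _ (by push_cast; ring) (hr e 3 (by norm_num))
  · exact hcell _ _ _ (by push_cast; ring) (hb e 0 (by norm_num))
  · exact hcell _ _ _ (by push_cast; ring) (hb e 1 (by norm_num))
  · exact hcell _ _ _ (by push_cast; ring) (hx i e 0 (by norm_num))
  · exact hcell _ _ _ (by push_cast; ring) (hx i e 1 (by norm_num))

/-! ### Counting different costs without sorting -/

namespace Instance

variable (I : Instance)

/-- No edge of smaller index has the same cost. -/
def IsFirst (e : Fin I.r) : Prop := ∀ e' < e, I.cost e' ≠ I.cost e

-- Each cost is represented by the edge of least index that has it.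
open Classical in
theorem card_costSet_filter (p : ℚ → Prop) [DecidablePred p] : (I.costSet.filter p).card =
    (Finset.univ.filter fun e => I.IsFirst e ∧ p (I.cost e)).card := by
  rw [← Finset.card_image_of_injOn (f := I.cost)]
  · congr 1
    ext x
    simp only [costSet, Finset.mem_filter, Finset.mem_image, Finset.mem_univ, true_and]
    constructor
    · rintro ⟨⟨e, rfl⟩, hp⟩
      obtain ⟨e', he', hmin⟩ := WellFounded.has_min (wellFounded_lt (α := Fin I.r))
        {e' | I.cost e' = I.cost e} ⟨e, rfl⟩
      have he'' : I.cost e' = I.cost e := he'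
      refine ⟨e', ⟨fun y hy hc => hmin y ?_ hy, by rwa [he'']⟩, he''⟩
      exact hc.trans he''
    · rintro ⟨e, ⟨_, hp⟩, rfl⟩
      exact ⟨⟨e, rfl⟩, hp⟩
  · intro e he e' he' h
    simp only [Finset.coe_filter, Finset.mem_univ, true_and, Set.mem_ofPred_eq] at he he'
    rcases lt_trichotomy e e' with hlt | heq | hlt
    · exact absurd h (he'.1 e hlt)
    · exact heq
    · exact absurd h.symm (he.1 e' hlt)

open Classical in
theorem k_eq_sum : (I.k : ℤ) = ∑ e, if I.IsFirst e then 1 else 0 := by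
  have := I.card_costSet_filter fun _ => True
  simp only [Finset.filter_true, and_true] at this
  rw [k, this, Finset.card_filter]
  push_cast
  rfl

open Classical in
theorem rank_eq_sum (e : Fin I.r) : (I.rank e : ℤ) =
    ∑ e', if I.IsFirst e' ∧ I.cost e' ≤ I.cost e then 1 else 0 := by
  rw [rank, I.card_costSet_filter, Finset.card_filter]
  push_cast
  rfl

end Instance

/-- The decoded input stands in the memory. -/
structure Decoded (q : Query) (σ : Memory) : Prop where
  input : Input q σ
  out0 : σ aOut 0 = 1
  out1 : σ aOut 1 = 0
  n : σ aN 0 = q.inst.n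
  r : σ aR 0 = q.inst.r
  b : σ aB 0 = q.inst.b
  rb : σ aRB 0 = q.inst.r + q.inst.b
  n1 : σ aN1 0 = q.inst.n + 1
  nn : σ aNN 0 = (q.inst.n + 1) * (q.inst.n + 1)
  redA : ∀ e : Fin q.inst.r, σ aEA e = (q.inst.redEnds e).1
  redB : ∀ e : Fin q.inst.r, σ aEB e = (q.inst.redEnds e).2
  costNum : ∀ e : Fin q.inst.r, σ aCN e = (q.inst.cost e).num
  costDen : ∀ e : Fin q.inst.r, σ aCD e = (q.inst.cost e).den
  blueA : ∀ e : Fin q.inst.b, σ aEA (q.inst.r + e) = (q.inst.blueEnds e).1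
  blueB : ∀ e : Fin q.inst.b, σ aEB (q.inst.r + e) = (q.inst.blueEnds e).2

theorem Decoded.congr {q : Query} {σ τ : Memory} (h : Decoded q σ)
    (hτ : ∀ a ∈ [0, 1, 2, 3, 4, 10, 11, 12, 13, 14, 20, 21], τ a = σ a) : Decoded q τ := by
  refine ⟨h.input.congr (hτ _ (by simp)), ?_, ?_, ?_, ?_, ?_, ?_, ?_, ?_, fun e => ?_, fun e => ?_,
    fun e => ?_, fun e => ?_, fun e => ?_, fun e => ?_⟩ <;> rw [hτ _ (by simp)]
  exacts [h.out0, h.out1, h.n, h.r, h.b, h.rb, h.n1, h.nn, h.redA e, h.redB e, h.costNum e,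
    h.costDen e, h.blueA e, h.blueB e]

theorem Decoded.frame {q : Query} {σ τ : Memory} {P : Program} (h : Decoded q σ) (hF : Frame P σ τ)
    (hP : ∀ a ∈ [0, 1, 2, 3, 4, 10, 11, 12, 13, 14, 20, 21], P.touches a = false) : Decoded q τ :=
  h.congr fun a ha => hF a (hP a ha)

section

variable {q : Query} {m : ℕ} {V : ℤ} {σ : Memory}

theorem readEdges_spec (hB : Bounds q m V) (h : Input q σ) : wp m readEdges (Decoded q) σ := by
  have hm : ∀ z : ℕ, z ≤ m → ∀ y : ℤ, y = z → Small m y := by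
    rintro z hz _ rfl
    exact small_natCast hz
  refine wp_seq (wp_write (x := 0) (y := q.inst.n) rfl h.n (fun _ => hm _ hB.n _ rfl) ?_)
  refine wp_seq (wp_write (x := 0) (y := q.inst.r) rfl
    (by simp [Memory.write_of_ne, h.r]) (fun _ => hm _ hB.r _ rfl) ?_)
  refine wp_seq (wp_write (x := 0) (y := q.inst.b) rfl
    (by simp [Memory.write_of_ne, h.b]) (fun _ => hm _ hB.b _ rfl) ?_)
  refine wp_seq (wp_write (x := 0) (y := q.inst.r + q.inst.b) rfl
    (by simp [Memory.write_of_ne]) (fun _ => hm _ hB.rb _ (by push_cast; rfl)) ?_)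
  refine wp_seq (wp_write (x := 0) (y := q.inst.n + 1) rfl
    (by simp [Memory.write_of_ne]) (fun _ => hm _ hB.n1 _ (by push_cast; rfl)) ?_)
  refine wp_seq (wp_write (x := 0) (y := (q.inst.n + 1) * (q.inst.n + 1)) rfl
    (by simp [Memory.write_of_ne]) (fun _ => hm _ hB.nn _ (by push_cast; rfl)) ?_)
  refine wp_seq (wp_write (x := 0) (y := 1) rfl rfl (fun _ => hB.small_one) ?_)
  refine wp_seq (wp_write (x := 1) (y := 0) rfl rfl (fun _ => small_zero m) ?_)
  obtain ⟨υ, hυ⟩ : ∃ υ, υ = (((((((σ.write aN 0 q.inst.n).write aR 0 q.inst.r).write aB 0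
    q.inst.b).write aRB 0 (q.inst.r + q.inst.b)).write aN1 0 (q.inst.n + 1)).write aNN 0
    ((q.inst.n + 1) * (q.inst.n + 1))).write aOut 0 1).write aOut 1 0 := ⟨_, rfl⟩
  rw [← hυ]
  have hin : Input q υ := h.congr (by simp [hυ, Memory.write_of_ne])
  have hout : υ aOut 0 = 1 ∧ υ aOut 1 = 0 ∧ υ aN 0 = q.inst.n ∧ υ aR 0 = q.inst.r ∧
      υ aB 0 = q.inst.b ∧ υ aRB 0 = q.inst.r + q.inst.b ∧ υ aN1 0 = q.inst.n + 1 ∧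
      υ aNN 0 = (q.inst.n + 1) * (q.inst.n + 1) := by
    simp [hυ, Memory.write_of_ne]
  clear hυ
  obtain ⟨h1, h2, h3, h4, h5, h6, h7, h8⟩ := hout
  refine wp_then (Q := fun τ => ∀ e : Fin q.inst.r, τ aEA e = (q.inst.redEnds e).1 ∧
    τ aEB e = (q.inst.redEnds e).2 ∧ τ aCN e = (q.inst.cost e).num ∧
    τ aCD e = (q.inst.cost e).den) ?_ ?_
  · refine wp_for q.inst.r (fun j τ => ∀ e : Fin q.inst.r, e.val < j → τ aEA e =
      (q.inst.redEnds e).1 ∧ τ aEB e = (q.inst.redEnds e).2 ∧ τ aCN e = (q.inst.cost e).num ∧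
      τ aCD e = (q.inst.cost e).den) hB.r h4 rfl rfl ?_ (by simp) ?_ (fun τ _ hI e => hI e e.2)
    · intro i τ x hI
      simpa [Memory.write_of_ne] using hI
    · intro j hj τ hbd hcA hF hI
      have hinτ : Input q τ := hin.congr (hF _ rfl)
      refine wp_seq (wp_write (x := j) (by simp [hcA]) (by simpa [hcA] using hinτ.redA ⟨j, hj⟩)
        (fun hb => by simpa only [← hinτ.redA ⟨j, hj⟩] using hb _ _) ?_)
      refine wp_seq (wp_write (x := j) (by simp [hcA, Memory.write_of_ne])
        (by simpa [hcA, Memory.write_of_ne] using hinτ.redB ⟨j, hj⟩)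
        (fun _ => by simpa only [← hinτ.redB ⟨j, hj⟩] using hbd _ _) ?_)
      refine wp_seq (wp_write (x := j) (by simp [hcA, Memory.write_of_ne])
        (by simpa [hcA, Memory.write_of_ne] using hinτ.costNum ⟨j, hj⟩)
        (fun _ => by simpa only [← hinτ.costNum ⟨j, hj⟩] using hbd _ _) ?_)
      refine wp_write (x := j) (by simp [hcA, Memory.write_of_ne])
        (by simpa [hcA, Memory.write_of_ne] using hinτ.costDen ⟨j, hj⟩)
        (fun _ => by simpa only [← hinτ.costDen ⟨j, hj⟩] using hbd _ _) ?_
      intro e he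
      simp only [Memory.write_self, Memory.write_of_ne _ _ _ (show aEA ≠ aEB by norm_num),
        Memory.write_of_ne _ _ _ (show aEA ≠ aCN by norm_num),
        Memory.write_of_ne _ _ _ (show aEA ≠ aCD by norm_num),
        Memory.write_of_ne _ _ _ (show aEB ≠ aEA by norm_num),
        Memory.write_of_ne _ _ _ (show aEB ≠ aCN by norm_num),
        Memory.write_of_ne _ _ _ (show aEB ≠ aCD by norm_num),
        Memory.write_of_ne _ _ _ (show aCN ≠ aEA by norm_num),
        Memory.write_of_ne _ _ _ (show aCN ≠ aEB by norm_num),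
        Memory.write_of_ne _ _ _ (show aCN ≠ aCD by norm_num),
        Memory.write_of_ne _ _ _ (show aCD ≠ aEA by norm_num),
        Memory.write_of_ne _ _ _ (show aCD ≠ aEB by norm_num),
        Memory.write_of_ne _ _ _ (show aCD ≠ aCN by norm_num), Function.update_apply, Nat.cast_inj]
      by_cases hej : e.val = j
      · have : e = ⟨j, hj⟩ := Fin.ext hej
        subst this
        simp
      · simpa only [hej, if_false] using hI e (by omega)
  intro τ₁ _ hF₁ hred
  have hin₁ : Input q τ₁ := hin.congr (hF₁ _ rfl)
  have hr₁ : τ₁ aR 0 = q.inst.r := by rw [hF₁ _ rfl, h4]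
  refine wp_for q.inst.b (fun j τ => (∀ e : Fin q.inst.r, τ aEA e = (q.inst.redEnds e).1 ∧
    τ aEB e = (q.inst.redEnds e).2) ∧ ∀ e : Fin q.inst.b, e.val < j →
      τ aEA (q.inst.r + e) = (q.inst.blueEnds e).1 ∧ τ aEB (q.inst.r + e) = (q.inst.blueEnds e).2)
    hB.b (by rw [hF₁ _ rfl, h5]) rfl rfl ?_ ⟨fun e => ⟨(hred e).1, (hred e).2.1⟩, by simp⟩ ?_ ?_
  · intro i τ x hI
    simpa [Memory.write_of_ne] using hI
  · rintro j hj τ hbd hcA hF ⟨hI, hJ⟩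
    have hinτ : Input q τ := hin₁.congr (hF _ rfl)
    have hr : τ aR 0 = q.inst.r := by rw [hF _ rfl, hr₁]
    refine wp_seq (wp_write (x := q.inst.r + j) (by simp [hcA, hr])
      (by simpa [hcA, hr] using hinτ.blueA ⟨j, hj⟩)
      (fun hb => by simpa only [← hinτ.blueA ⟨j, hj⟩] using hb _ _) ?_)
    refine wp_write (x := q.inst.r + j) (by simp [hcA, hr, Memory.write_of_ne])
      (by simpa [hcA, hr, Memory.write_of_ne] using hinτ.blueB ⟨j, hj⟩)
      (fun _ => by simpa only [← hinτ.blueB ⟨j, hj⟩] using hbd _ _) ?_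
    simp only [Memory.write_self, Memory.write_of_ne _ _ _ (show aEA ≠ aEB by norm_num),
      Memory.write_of_ne _ _ _ (show aEB ≠ aEA by norm_num), Function.update_apply, add_right_inj,
      Nat.cast_inj]
    refine ⟨fun e => ?_, fun e he => ?_⟩
    · have : (e : ℤ) ≠ q.inst.r + j := by
        have := e.2
        omega
      simpa only [this, if_false] using hI e
    · by_cases hej : e.val = j
      · have : e = ⟨j, hj⟩ := Fin.ext hej
        subst this
        simp
      · simpa only [hej, if_false] using hJ e (by omega)
  · rintro τ hF ⟨hI, hJ⟩
    refine ⟨hin₁.congr (hF _ rfl), ?_, ?_, ?_, ?_, ?_, ?_, ?_, ?_, fun e => (hI e).1, fun e => (hI e).2,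
      fun e => ?_, fun e => ?_, fun e => (hJ e e.2).1, fun e => (hJ e e.2).2⟩
    · rw [hF _ rfl, hF₁ _ rfl, h1]
    · rw [hF _ rfl, hF₁ _ rfl, h2]
    · rw [hF _ rfl, hF₁ _ rfl, h3]
    · rw [hF _ rfl, hr₁]
    · rw [hF _ rfl, hF₁ _ rfl, h5]
    · rw [hF _ rfl, hF₁ _ rfl, h6]
    · rw [hF _ rfl, hF₁ _ rfl, h7]
    · rw [hF _ rfl, hF₁ _ rfl, h8]
    · rw [hF _ rfl, (hred e).2.2.1]
    · rw [hF _ rfl, (hred e).2.2.2]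

open Classical in
/-- The first edges of every cost are marked. -/
def FirstView (q : Query) (σ : Memory) : Prop :=
  ∀ e : Fin q.inst.r, σ aFst e = if q.inst.IsFirst e then 1 else 0

theorem markFirst_spec (hB : Bounds q m V) (h : Decoded q σ) : wp m markFirst (FirstView q) σ := by
  classical
  refine wp_for q.inst.r (fun j τ => ∀ e : Fin q.inst.r, e.val < j →
    τ aFst e = if q.inst.IsFirst e then 1 else 0) hB.r h.r rfl rfl ?_ (by simp) ?_
    (fun τ _ hI e => by rw [hI e e.2])
  · intro i τ x hI
    simpa [Memory.write_of_ne] using hI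
  intro j hj τ _ hcA hF hI
  have hd : Decoded q τ := h.frame hF (by decide)
  refine wp_seq (wp_write (x := j) (y := 1) (by simp [hcA]) rfl (fun _ => hB.small_one) ?_)
  set υ := τ.write aFst j 1 with hυ
  have hdυ : Decoded q υ := hd.congr fun a ha => Memory.write_of_ne _ _ _ (by rintro rfl; simp at ha)
  have hcAυ : υ cA 0 = j := by rw [hυ, Memory.write_of_ne _ _ _ (by norm_num), hcA]
  set e₀ : Fin q.inst.r := ⟨j, hj⟩ with he₀
  refine wp_for j (fun x τ => (∀ e : Fin q.inst.r, e.val < j →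
    τ aFst e = if q.inst.IsFirst e then 1 else 0) ∧ τ aFst j =
      if ∀ e : Fin q.inst.r, e.val < x → q.inst.cost e ≠ q.inst.cost e₀ then 1 else 0)
    (hj.le.trans hB.r) hcAυ rfl rfl ?_ ?_ ?_ ?_
  · intro i τ x hI
    simpa [Memory.write_of_ne] using hI
  · refine ⟨fun e he => ?_, by simp [hυ]⟩
    rw [hυ, Memory.write_self, Function.update_of_ne (by exact_mod_cast he.ne), hI e he]
  · rintro x hx κ _ hcB hFκ ⟨h1, h2⟩
    have hdκ : Decoded q κ := hdυ.frame hFκ (by decide)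
    have hcAκ : κ cA 0 = j := by rw [hFκ _ rfl, hcAυ]
    have hxr : x < q.inst.r := hx.trans hj
    -- Fractions are compared by cross multiplication. The products appear only in the test and need
    -- not fit into `m` bits.
    have key : 0 < (eqTest (rd aCN (var cB) * rd aCD (var cA)) (rd aCN (var cA) * rd aCD (var cB))).eval
        κ ↔ q.inst.cost ⟨x, hxr⟩ = q.inst.cost e₀ := by
      have e1 := hdκ.costNum ⟨x, hxr⟩
      have e2 := hdκ.costNum e₀
      have e3 := hdκ.costDen ⟨x, hxr⟩
      have e4 := hdκ.costDen e₀
      simp only [he₀] at e1 e2 e3 e4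
      rw [Rat.eq_iff_mul_eq_mul]
      simp only [Expr.eval_sub, Expr.eval_mul, Expr.eval_get, Expr.eval_zero, Expr.eval_one, hcB, hcAκ,
        eqTest_pos, e1, e2, e3, e4, he₀]
    have hsucc : (∀ e : Fin q.inst.r, e.val < x + 1 → q.inst.cost e ≠ q.inst.cost e₀) ↔
        (∀ e : Fin q.inst.r, e.val < x → q.inst.cost e ≠ q.inst.cost e₀) ∧
          q.inst.cost ⟨x, hxr⟩ ≠ q.inst.cost e₀ := by
      constructor
      · exact fun h => ⟨fun e he => h e (by omega), h ⟨x, hxr⟩ (Nat.lt_succ_self x)⟩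
      · rintro ⟨h1, h2⟩ e he
        rcases Nat.lt_succ_iff_lt_or_eq.1 he with hlt | heq
        · exact h1 e hlt
        · have : e = ⟨x, hxr⟩ := Fin.ext heq
          rwa [this]
    refine wp_ite (fun hpos => ?_) fun hpos => wp_skip ⟨h1, ?_⟩
    · rw [key] at hpos
      refine wp_write (x := j) (y := 0) (by simp [hcAκ]) rfl (fun _ => small_zero m) ⟨fun e he => ?_, ?_⟩
      · rw [Memory.write_self, Function.update_of_ne (by exact_mod_cast he.ne), h1 e he]
      · rw [if_neg (fun h => (hsucc.1 h).2 hpos)]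
        simp
    · rw [key] at hpos
      rw [h2]
      simp only [hsucc, ne_eq, hpos, not_false_eq_true, and_true]
  · rintro κ _ ⟨h1, h2⟩ e he
    rcases Nat.lt_succ_iff_lt_or_eq.1 he with hlt | heq
    · exact h1 e hlt
    · have : e = e₀ := Fin.ext heq
      subst this
      by_cases hif : q.inst.IsFirst e₀
      · rw [if_pos hif]
        exact h2.trans (if_pos hif)
      · rw [if_neg hif]
        exact h2.trans (if_neg hif)

theorem computeRanks_spec (hB : Bounds q m V) (h : Decoded q σ) (hfst : FirstView q σ) :
    wp m computeRanks (fun τ => ∀ e : Fin q.inst.r, τ aRank e = q.inst.rank e) σ := by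
  classical
  refine wp_for q.inst.r (fun j τ => ∀ e : Fin q.inst.r, e.val < j → τ aRank e = q.inst.rank e) hB.r
    h.r rfl rfl ?_ (by simp) ?_ (fun τ _ hI e => by rw [hI e e.2])
  · intro i τ x hI
    simpa [Memory.write_of_ne] using hI
  intro j hj τ _ hcA hF hI
  have hd : Decoded q τ := h.frame hF (by decide)
  refine wp_seq (wp_write (x := j) (y := 0) (by simp [hcA]) rfl (fun _ => small_zero m) ?_)
  set υ := τ.write aRank j 0 with hυ
  have hdυ : Decoded q υ := hd.congr fun a ha => Memory.write_of_ne _ _ _ (by rintro rfl; simp at ha)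
  have hcAυ : υ cA 0 = j := by rw [hυ, Memory.write_of_ne _ _ _ (by norm_num), hcA]
  have hfυ : υ aFst = σ aFst := by rw [hυ, Memory.write_of_ne _ _ _ (by norm_num), hF _ rfl]
  set e₀ : Fin q.inst.r := ⟨j, hj⟩ with he₀
  set F : Fin q.inst.r → ℤ := fun e' =>
    if q.inst.IsFirst e' ∧ q.inst.cost e' ≤ q.inst.cost e₀ then 1 else 0 with hFdef
  have hF0 : ∀ e, 0 ≤ F e ∧ F e ≤ 1 := by
    intro e
    simp only [hFdef]
    split_ifs <;> simp
  refine wp_for q.inst.r (fun x τ => (∀ e : Fin q.inst.r, e.val < j → τ aRank e = q.inst.rank e) ∧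
    τ aRank j = ∑ e : Fin q.inst.r, if e.val < x then F e else 0) hB.r hdυ.r rfl rfl ?_ ?_ ?_ ?_
  · intro i τ x hI
    simpa [Memory.write_of_ne] using hI
  · refine ⟨fun e he => ?_, by simp [hυ]⟩
    rw [hυ, Memory.write_self, Function.update_of_ne (by exact_mod_cast he.ne), hI e he]
  · rintro x hx κ _ hcB hFκ ⟨h1, h2⟩
    have hdκ : Decoded q κ := hdυ.frame hFκ (by decide)
    have hcAκ : κ cA 0 = j := by rw [hFκ _ rfl, hcAυ]
    have k1 : 0 < (rd aFst (var cB)).eval κ ↔ q.inst.IsFirst ⟨x, hx⟩ := by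
      have := hfst ⟨x, hx⟩
      simp only [Expr.eval_get, Expr.eval_zero, hcB, hFκ aFst rfl, hfυ, this]
      split_ifs with hif <;> simp [hif]
    have k2 : 0 < (1 + rd aCN (var cA) * rd aCD (var cB) - rd aCN (var cB) * rd aCD (var cA)).eval κ ↔
        q.inst.cost ⟨x, hx⟩ ≤ q.inst.cost e₀ := by
      have e1 := hdκ.costNum ⟨x, hx⟩
      have e2 := hdκ.costNum e₀
      have e3 := hdκ.costDen ⟨x, hx⟩
      have e4 := hdκ.costDen e₀
      simp only [he₀] at e1 e2 e3 e4
      rw [Rat.le_iff]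
      simp only [Expr.eval_add, Expr.eval_sub, Expr.eval_mul, Expr.eval_get, Expr.eval_zero,
        Expr.eval_one, hcB, hcAκ, e1, e2, e3, e4, he₀]
      omega
    have hskip : ¬ (q.inst.IsFirst ⟨x, hx⟩ ∧ q.inst.cost ⟨x, hx⟩ ≤ q.inst.cost e₀) →
        wp m .skip (fun τ => (∀ e : Fin q.inst.r, e.val < j → τ aRank e = q.inst.rank e) ∧
          τ aRank j = ∑ e : Fin q.inst.r, if e.val < x + 1 then F e else 0) κ := by
      intro hn
      refine wp_skip ⟨h1, ?_⟩
      rw [h2, sum_ite_lt_succ _ hx]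
      simp only [hFdef, if_neg hn, add_zero]
    refine wp_ite (fun g1 => wp_ite (fun g2 => ?_) fun g2 => hskip fun hn => g2 (k2.2 hn.2))
      fun g1 => hskip fun hn => g1 (k1.2 hn.1)
    have hFx : F ⟨x, hx⟩ = 1 := if_pos ⟨k1.1 g1, k2.1 g2⟩
    refine wp_write (x := j) (y := ∑ e : Fin q.inst.r, if e.val < x + 1 then F e else 0)
      (by simp [hcAκ]) ?_ (fun _ => ?_) ⟨fun e he => ?_, by simp⟩
    · rw [sum_ite_lt_succ _ hx, hFx]
      simp [hcAκ, h2]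
    · have b1 := sum_ite_lt_le (fun v => (hF0 v).2) (fun _ => zero_le_one) (x + 1)
      have b2 : 0 ≤ ∑ e : Fin q.inst.r, if e.val < x + 1 then F e else 0 :=
        Finset.sum_nonneg fun v _ => by split_ifs; exacts [(hF0 v).1, le_rfl]
      have b3 : ∑ e : Fin q.inst.r, (1 : ℤ) = q.inst.r := by simp
      rw [b3] at b1
      have b4 := hB.r
      refine small_of_le ?_
      rw [abs_of_nonneg b2]
      omega
    · rw [Memory.write_self, Function.update_of_ne (by exact_mod_cast he.ne), h1 e he]
  · rintro κ _ ⟨h1, h2⟩ e he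
    rcases Nat.lt_succ_iff_lt_or_eq.1 he with hlt | heq
    · exact h1 e hlt
    · have : e = e₀ := Fin.ext heq
      subst this
      rw [sum_ite_lt_all] at h2
      rw [q.inst.rank_eq_sum]
      exact h2

theorem countCosts_spec (hB : Bounds q m V) (h : Decoded q σ) (hfst : FirstView q σ) :
    wp m countCosts (fun τ => τ aK 0 = q.inst.k ∧ τ aKB 0 = q.inst.k * q.inst.b) σ := by
  classical
  refine wp_seq (wp_write (x := 0) (y := 0) rfl rfl (fun _ => small_zero m) ?_)
  set υ := σ.write aK 0 0 with hυ
  have hdυ : Decoded q υ := h.congr fun a ha => Memory.write_of_ne _ _ _ (by rintro rfl; simp at ha)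
  set F : Fin q.inst.r → ℤ := fun e => if q.inst.IsFirst e then 1 else 0 with hFdef
  have hF0 : ∀ e, 0 ≤ F e ∧ F e ≤ 1 := by
    intro e
    simp only [hFdef]
    split_ifs <;> simp
  refine wp_then (Q := fun τ => τ aK 0 = q.inst.k) ?_ ?_
  · refine wp_for q.inst.r (fun j τ => τ aK 0 = ∑ e : Fin q.inst.r, if e.val < j then F e else 0) hB.r
      hdυ.r rfl rfl ?_ (by simp [hυ]) ?_ ?_
    · intro i τ x hI
      simpa [Memory.write_of_ne] using hI
    · intro x hx τ _ hcA hF hI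
      have hfx : τ aFst x = F ⟨x, hx⟩ := by
        rw [hF _ rfl, hυ, Memory.write_of_ne _ _ _ (by norm_num)]
        exact hfst ⟨x, hx⟩
      refine wp_write (x := 0) (y := ∑ e : Fin q.inst.r, if e.val < x + 1 then F e else 0)
        rfl ?_ (fun _ => ?_) (by simp)
      · rw [sum_ite_lt_succ _ hx]
        simp [hcA, hI, hfx]
      · have b1 := sum_ite_lt_le (fun v => (hF0 v).2) (fun _ => zero_le_one) (x + 1)
        have b2 : 0 ≤ ∑ e : Fin q.inst.r, if e.val < x + 1 then F e else 0 :=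
          Finset.sum_nonneg fun v _ => by split_ifs; exacts [(hF0 v).1, le_rfl]
        have b3 : ∑ e : Fin q.inst.r, (1 : ℤ) = q.inst.r := by simp
        rw [b3] at b1
        have b4 := hB.r
        refine small_of_le ?_
        rw [abs_of_nonneg b2]
        omega
    · intro τ _ hI
      rw [hI, sum_ite_lt_all, q.inst.k_eq_sum]
  · intro τ _ hF hk
    have hd : Decoded q τ := hdυ.frame hF (by decide)
    refine wp_write (x := 0) (y := q.inst.k * q.inst.b) rfl (by simp [hk, hd.b]) (fun _ => ?_)
      ⟨by rw [Memory.write_of_ne _ _ _ (by norm_num), hk], by simp⟩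
    have := small_natCast hB.kb
    push_cast at this
    exact this

theorem scalePoint_spec (hB : Bounds q m V) (hm : 4 + 4 * q.inst.r + 2 * q.inst.b ≤ m)
    (h : Decoded q σ) (hkb : σ aKB 0 = q.inst.k * q.inst.b) :
    wp m scalePoint (fun τ => τ aDen 0 = q.den ∧
      ∀ (i : Fin q.inst.k) (e : Fin q.inst.b), τ aX (i * q.inst.b + e) = q.num i e) σ := by
  set O : ℤ := 4 + 4 * q.inst.r + 2 * q.inst.b with hO
  refine wp_seq (wp_write (x := 0) (y := O) rfl (by simp [h.r, h.b, hO]) (fun _ => ?_) ?_)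
  · have := small_natCast hm
    push_cast at this
    exact this
  refine wp_seq (wp_write (x := 0) (y := 1) rfl rfl (fun _ => hB.small_one) ?_)
  set υ := (σ.write aOff 0 O).write aDen 0 1 with hυ
  have hυ' : ∀ a, a ≠ aOff → a ≠ aDen → υ a = σ a := fun a h1 h2 => by
    rw [hυ, Memory.write_of_ne _ _ _ h2, Memory.write_of_ne _ _ _ h1]
  have hin : Input q υ := h.input.congr (hυ' _ (by norm_num) (by norm_num))
  have hoff : υ aOff 0 = O := by simp [hυ, Memory.write_of_ne]
  have hkbυ : υ aKB 0 = (q.inst.k * q.inst.b : ℕ) := by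
    rw [hυ' _ (by norm_num) (by norm_num), hkb]
    push_cast
    rfl
  set D : ℕ → ℤ := fun p => υ aIn (O + 2 * p + 1) with hD
  have hDie : ∀ (i : Fin q.inst.k) (e : Fin q.inst.b), D (i * q.inst.b + e) = (q.x i e).den := by
    intro i e
    have := hin.xDen i e
    simp only [hD]
    push_cast
    exact this
  have hprod : ∏ p ∈ Finset.range (q.inst.k * q.inst.b), D p = q.den := by
    rw [prod_range_mul]
    simp only [hDie]
    rfl
  have hDpos : ∀ p < q.inst.k * q.inst.b, 0 < D p := by
    intro p hp
    obtain ⟨i, hi, e, he, rfl⟩ := exists_index hp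
    have := hDie ⟨i, hi⟩ ⟨e, he⟩
    simp only at this
    rw [this]
    exact_mod_cast Rat.den_pos _
  refine wp_then (Q := fun τ => τ aDen 0 = q.den) ?_ ?_
  · refine wp_for (q.inst.k * q.inst.b) (fun j τ => τ aDen 0 = ∏ p ∈ Finset.range j, D p) hB.kb hkbυ
      rfl rfl ?_ (by simp [hυ]) ?_ ?_
    · intro i τ x hI
      simpa [Memory.write_of_ne] using hI
    · intro x hx τ _ hcA hF hI
      refine wp_write (x := 0) (y := ∏ p ∈ Finset.range (x + 1), D p) rfl ?_ (fun _ => ?_) (by simp)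
      · rw [Finset.prod_range_succ]
        simp [hcA, hI, hF aOff rfl, hF aIn rfl, hoff, hD]
      · refine hB.small_of_le ?_
        -- The partial products are bounded because they divide the full product.
        have h1 : ∏ p ∈ Finset.range (x + 1), D p ∣ q.den := by
          rw [← hprod]
          exact Finset.prod_dvd_prod_of_subset _ _ _ (Finset.range_subset_range.2 hx)
        have h2 : 0 < ∏ p ∈ Finset.range (x + 1), D p :=
          Finset.prod_pos fun p hp => hDpos p (by have := Finset.mem_range.1 hp; omega)
        rw [abs_of_pos h2]
        have h3 := Int.le_of_dvd q.den_pos h1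
        linarith [hB.den, hB.V_pos]
    · intro τ _ hI
      rw [hI, hprod]
  intro τ₁ _ hF₁ hden
  refine wp_for (q.inst.k * q.inst.b) (fun j τ => ∀ (i : Fin q.inst.k) (e : Fin q.inst.b),
    i * q.inst.b + e < j → τ aX (i * q.inst.b + e) = q.num i e) hB.kb (by rw [hF₁ _ rfl, hkbυ]) rfl rfl
    ?_ (by simp) ?_ ?_
  · intro i τ x hI
    simpa [Memory.write_of_ne] using hI
  · intro j hj τ _ hcA hF hI
    obtain ⟨i, hi, e, he, rfl⟩ := exists_index hj
    have e1 := hin.xNum ⟨i, hi⟩ ⟨e, he⟩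
    have e2 := hin.xDen ⟨i, hi⟩ ⟨e, he⟩
    simp only at e1 e2
    refine wp_write (x := i * q.inst.b + e) (y := q.num ⟨i, hi⟩ ⟨e, he⟩) (by simp [hcA]) ?_
      (fun _ => ?_) fun i' e' hlt => ?_
    · simp only [Expr.eval_add, Expr.eval_mul, Expr.eval_div, Expr.eval_get, Expr.eval_zero,
        Expr.eval_one, Expr.eval_ofNat, hcA, hF aOff rfl, hF aIn rfl, hF aDen rfl, hF₁ aOff rfl,
        hF₁ aIn rfl, hoff, hden, hO]
      push_cast
      rw [e1, e2]
      rfl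
    · refine hB.small_of_le ((hB.num_le _ _).trans ?_)
      linarith [hB.V_pos]
    · rw [Memory.write_self, Function.update_apply]
      simp only [index_inj_iff e'.2 he]
      split_ifs with heq
      · have h1 : i' = ⟨i, hi⟩ := Fin.ext heq.1
        have h2 : e' = ⟨e, he⟩ := Fin.ext heq.2
        rw [h1, h2]
      · refine hI i' e' ?_
        have : i' * q.inst.b + e' ≠ i * q.inst.b + e := fun h => heq (index_inj e'.2 he h)
        omega
  · intro τ hF hI
    exact ⟨by rw [hF _ rfl, hden], fun i e => hI i e (index_lt i.2 e.2)⟩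

theorem prepare_spec (hB : Bounds q m V) (hm : 4 + 4 * q.inst.r + 2 * q.inst.b ≤ m) (h : Input q σ) :
    wp m prepare (fun τ => Base q τ ∧ Ok q True τ) σ := by
  refine wp_then (readEdges_spec hB h) fun τ₁ _ _ h₁ => ?_
  refine wp_then (markFirst_spec hB h₁) fun τ₂ _ hF₂ hfst => ?_
  have h₂ : Decoded q τ₂ := h₁.frame hF₂ (by decide)
  refine wp_then (computeRanks_spec hB h₂ hfst) fun τ₃ _ hF₃ hrank => ?_
  have h₃ : Decoded q τ₃ := h₂.frame hF₃ (by decide)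
  have hfst₃ : FirstView q τ₃ := fun e => by rw [hF₃ _ rfl, hfst e]
  refine wp_then (countCosts_spec hB h₃ hfst₃) fun τ₄ _ hF₄ hk => ?_
  have h₄ : Decoded q τ₄ := h₃.frame hF₄ (by decide)
  refine wp_mono (scalePoint_spec hB hm h₄ hk.2) fun τ₅ _ hF₅ hx => ?_
  have h₅ : Decoded q τ₅ := h₄.frame hF₅ (by decide)
  refine ⟨⟨h₅.n, h₅.r, h₅.b, ?_, hx.1, ?_, h₅.rb, h₅.n1, h₅.nn, hx.2, fun e => ?_, h₅.redA, h₅.redB,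
    h₅.blueA, h₅.blueB⟩, Or.inl ⟨⟨h₅.out0, ?_⟩, trivial⟩⟩
  · rw [hF₅ _ rfl, hk.1]
  · rw [hF₅ _ rfl, hk.2]
  · rw [hF₅ _ rfl, hF₄ _ rfl, hrank e]
  · intro p hp
    have : p = 0 := by simpa [Query.encodeAnswer] using hp
    subst this
    simpa [Query.encodeAnswer] using h₅.out1

end

/-! ## The encoding length bounds all numbers -/

theorem encodingLength_append (v w : List ℤ) :
    encodingLength (v ++ w) = encodingLength v + encodingLength w := by
  simp [encodingLength]

theorem encodingLength_flatMap_finRange {k : ℕ} (g : Fin k → List ℤ) :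
    encodingLength ((List.finRange k).flatMap g) = ∑ i, encodingLength (g i) := by
  induction k with
  | zero => simp [encodingLength]
  | succ k ih =>
    rw [List.finRange_succ, List.flatMap_cons, encodingLength_append, List.flatMap_map, ih,
      Fin.sum_univ_succ]

theorem length_le_encodingLength (w : List ℤ) : w.length ≤ encodingLength w := by
  induction w with
  | nil => simp
  | cons z w ih =>
    have := bitLength_pos z
    simp only [encodingLength, List.map_cons, List.sum_cons, List.length_cons] at ih ⊢
    omega

theorem natAbs_lt_of_mem {w : List ℤ} {z : ℤ} (h : z ∈ w) : z.natAbs < 2 ^ encodingLength w := by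
  refine (natAbs_lt_two_pow_bitLength z).trans_le (Nat.pow_le_pow_right (by norm_num) ?_)
  have : bitLength z ≤ encodingLength w :=
    List.single_le_sum (by simp) _ (List.mem_map_of_mem h)
  omega

theorem initialMemory_bdd {w : List ℤ} {m : ℕ} (h : encodingLength w ≤ m) :
    (initialMemory w).Bdd m := by
  intro a i
  rw [initialMemory]
  split_ifs with h1 h2 h3
  · exact small_natCast ((length_le_encodingLength w).trans h)
  · rw [List.getD_eq_getElem?_getD]
    by_cases hl : i.toNat - 1 < w.length
    · rw [List.getElem?_eq_getElem hl, Option.getD_some]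
      have h4 := (natAbs_lt_of_mem (List.getElem_mem hl)).trans_le
        (Nat.pow_le_pow_right (by norm_num) h)
      rw [Small, Int.abs_eq_natAbs]
      exact_mod_cast h4
    · rw [List.getElem?_eq_none (by omega)]
      exact small_zero m
  · exact small_zero m
  · exact small_zero m

/-- The number `n` enters the encoding in binary, so by itself it could be exponential in the
encoding length. Connectivity by red edges, each of which occupies cells of its own, makes it
polynomial. -/
theorem Instance.n_le (I : Instance) : I.n ≤ I.r + 1 := by
  rcases Nat.eq_zero_or_pos I.n with h | h
  · omega
  have : Nonempty (Fin I.n) := ⟨⟨0, h⟩⟩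
  have hcon : (SimpleGraph.fromRel fun u v => ∃ e, I.redEnds e = (u, v)).Connected :=
    ⟨I.red_connected⟩
  have h1 := hcon.card_vert_le_card_edgeSet_add_one
  have h2 : (SimpleGraph.fromRel fun u v => ∃ e, I.redEnds e = (u, v)).edgeSet ⊆
      Set.range fun e : Fin I.r => s((I.redEnds e).1, (I.redEnds e).2) := by
    intro x hx
    induction x using Sym2.ind with
    | _ u v =>
      rw [SimpleGraph.mem_edgeSet, SimpleGraph.fromRel_adj] at hx
      rcases hx.2 with ⟨e, he⟩ | ⟨e, he⟩
      · exact ⟨e, by simp [he]⟩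
      · exact ⟨e, by simp [he, Sym2.eq_swap]⟩
  have h3 := Set.ncard_le_ncard h2 (Set.finite_range _)
  have h4 : (Set.range fun e : Fin I.r => s((I.redEnds e).1, (I.redEnds e).2)).ncard ≤ I.r := by
    rw [← Set.image_univ]
    refine (Set.ncard_image_le Set.finite_univ).trans ?_
    rw [Set.ncard_univ, Nat.card_fin]
  rw [Nat.card_fin, Nat.card_coe_set_eq] at h1
  omega

theorem Instance.k_le (I : Instance) : I.k ≤ I.r := by
  refine Finset.card_image_le.trans ?_
  simp

namespace Query

variable (q : Query)

theorem length_encode : q.encode.length =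
    3 + 4 * q.inst.r + 2 * q.inst.b + 2 * (q.inst.k * q.inst.b) := by
  have h1 : ((List.finRange q.inst.r).flatMap fun e =>
    encodeEnds (q.inst.redEnds e) ++ encodeRat (q.inst.cost e)).length = q.inst.r * 4 :=
    length_flatMap_finRange _ fun _ => rfl
  have h2 : ((List.finRange q.inst.b).flatMap fun e => encodeEnds (q.inst.blueEnds e)).length =
    q.inst.b * 2 := length_flatMap_finRange _ fun _ => rfl
  have h3 : ((List.finRange q.inst.k).flatMap fun i =>
    (List.finRange q.inst.b).flatMap fun e => encodeRat (q.x i e)).length =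
      q.inst.k * (q.inst.b * 2) :=
    length_flatMap_finRange _ fun _ => length_flatMap_finRange _ fun _ => rfl
  rw [encode, List.length_append, List.length_append, List.length_append, h1, h2, h3]
  simp only [List.length_cons, List.length_nil]
  ring

theorem sum_bitLength_le :
    ∑ i, ∑ e, (bitLength (q.x i e).num + bitLength (q.x i e).den) ≤ encodingLength q.encode := by
  rw [encode, encodingLength_append, encodingLength_flatMap_finRange]
  simp only [encodingLength_flatMap_finRange]
  refine le_trans (le_of_eq ?_) (Nat.le_add_left _ _)
  simp [encodingLength, encodeRat]

theorem bitLength_le (i : Fin q.inst.k) (e : Fin q.inst.b) :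
    bitLength (q.x i e).num + bitLength (q.x i e).den ≤ encodingLength q.encode :=
  le_trans (le_trans (Finset.single_le_sum
      (f := fun e => bitLength (q.x i e).num + bitLength (q.x i e).den)
      (fun _ _ => Nat.zero_le _) (Finset.mem_univ e))
    (Finset.single_le_sum
      (f := fun i => ∑ e, (bitLength (q.x i e).num + bitLength (q.x i e).den))
      (fun _ _ => Nat.zero_le _) (Finset.mem_univ i))) q.sum_bitLength_le

/-- Bit lengths add up under multiplication, and the denominators are disjoint parts of the input
word. -/
theorem den_le : q.den ≤ 2 ^ encodingLength q.encode := by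
  have h : ∀ i e, ((q.x i e).den : ℤ) ≤
      2 ^ (bitLength (q.x i e).num + bitLength (q.x i e).den) := by
    intro i e
    have h1 := natAbs_lt_two_pow_bitLength ((q.x i e).den : ℤ)
    rw [Int.natAbs_natCast] at h1
    have h2 := h1.le.trans (Nat.pow_le_pow_right (by norm_num)
      (show bitLength ((q.x i e).den : ℤ) - 1 ≤
        bitLength (q.x i e).num + bitLength (q.x i e).den by omega))
    exact_mod_cast h2
  calc q.den ≤ ∏ i, ∏ e, (2 : ℤ) ^ (bitLength (q.x i e).num + bitLength (q.x i e).den) :=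
        Finset.prod_le_prod (fun i _ => Finset.prod_nonneg fun e _ => by positivity) fun i _ =>
          Finset.prod_le_prod (fun e _ => by positivity) fun e _ => h i e
    _ = 2 ^ ∑ i, ∑ e, (bitLength (q.x i e).num + bitLength (q.x i e).den) := by
        simp only [Finset.prod_pow_eq_pow_sum]
    _ ≤ _ := pow_le_pow_right₀ (by norm_num) q.sum_bitLength_le

theorem abs_num_le (i : Fin q.inst.k) (e : Fin q.inst.b) :
    |q.num i e| ≤ 2 ^ (2 * encodingLength q.encode) := by
  have h1 : |(q.x i e).num| ≤ 2 ^ encodingLength q.encode := by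
    have h2 := (natAbs_lt_two_pow_bitLength (q.x i e).num).le.trans (Nat.pow_le_pow_right (by norm_num)
      (show bitLength (q.x i e).num - 1 ≤ encodingLength q.encode by
        have := q.bitLength_le i e
        omega))
    rw [Int.abs_eq_natAbs]
    exact_mod_cast h2
  have h3 : |q.den / (q.x i e).den| ≤ 2 ^ encodingLength q.encode := by
    rw [abs_of_nonneg (Int.ediv_nonneg q.den_pos.le (by positivity))]
    exact (Int.ediv_le_self _ q.den_pos.le).trans q.den_le
  rw [num, abs_mul, two_mul, pow_add]
  exact mul_le_mul h1 h3 (abs_nonneg _) (by positivity)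

/-- The term `L ^ 2` accounts for the loops over the pairs of vertices. A numerator is at most `2 ^
(2 * L)`, and there are at most `2 ^ L` of them, whence `V = 2 ^ (3 * L)`; the product in
`Bounds.value` is then at most `2 ^ (4 + 2 * L + 3 * L)`, which explains `5 * L + 5`. -/
theorem bounds {L : ℕ} (hL : encodingLength q.encode = L) :
    Bounds q (L ^ 2 + 5 * L + 5) (2 ^ (3 * L)) := by
  have h1 : 3 + 4 * q.inst.r + 2 * q.inst.b + 2 * (q.inst.k * q.inst.b) ≤ L := by
    rw [← q.length_encode, ← hL]
    exact length_le_encodingLength _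
  have h2 := q.inst.n_le
  have h3 := q.inst.k_le
  have h4 : q.inst.n + 1 ≤ L := by omega
  have h5 : (q.inst.n + 1) * (q.inst.n + 1) ≤ L ^ 2 := by
    rw [sq]
    exact Nat.mul_le_mul h4 h4
  have hpow : L < 2 ^ L := Nat.lt_two_pow_self
  refine ⟨by omega, by omega, by omega, by omega, ?_, ?_, ?_⟩
  · refine q.den_le.trans ?_
    rw [hL]
    exact pow_le_pow_right₀ (by norm_num) (by omega)
  · calc ∑ i, ∑ e, |q.num i e| ≤ ∑ _i : Fin q.inst.k, ∑ _e : Fin q.inst.b, (2 : ℤ) ^ (2 * L) :=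
          Finset.sum_le_sum fun i _ => Finset.sum_le_sum fun e _ => by
            rw [← hL]
            exact q.abs_num_le i e
      _ = ((q.inst.k * q.inst.b : ℕ) : ℤ) * 2 ^ (2 * L) := by
          simp only [Finset.sum_const, Finset.card_univ, Fintype.card_fin, nsmul_eq_mul]
          push_cast
          ring
      _ ≤ 2 ^ L * 2 ^ (2 * L) := by
          refine mul_le_mul_of_nonneg_right ?_ (by positivity)
          have : q.inst.k * q.inst.b ≤ 2 ^ L := by omega
          exact_mod_cast this
      _ = 2 ^ (3 * L) := by
          rw [← pow_add]
          congr 1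
          ring
  · have h6 : (((q.inst.n + 1) * (q.inst.n + 1) : ℕ) : ℤ) ≤ 2 ^ (2 * L) := by
      have : (q.inst.n + 1) * (q.inst.n + 1) ≤ 2 ^ (2 * L) := by
        rw [two_mul, pow_add]
        exact Nat.mul_le_mul (by omega) (by omega)
      exact_mod_cast this
    push_cast at h6
    calc 16 * (((q.inst.n : ℤ) + 1) * (q.inst.n + 1)) * 2 ^ (3 * L)
        ≤ 16 * 2 ^ (2 * L) * 2 ^ (3 * L) :=
          mul_le_mul_of_nonneg_right (by linarith) (by positivity)
      _ = 2 ^ (5 * L + 4) := by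
          rw [show 5 * L + 4 = 4 + 2 * L + 3 * L by ring, pow_add, pow_add]
          norm_num
      _ < 2 ^ (L ^ 2 + 5 * L + 5) :=
          pow_lt_pow_right₀ (by norm_num) (by omega)

end Query

/-! ## The separation theorem -/

theorem Instance.feasible_of_satisfied {I : Instance} {x : Fin I.k → Fin I.b → ℚ}
    (hm : ∀ i e, (I.monoIneq i e).Satisfied x)
    (hf : ∀ (i : Fin I.k) (𝒞 : Finset (I.Component i)), 𝒞.Nonempty → (I.forestIneq i 𝒞).Satisfied x)
    (hc : ∀ (f : Fin I.b) (i : Fin I.k), 1 ≤ i.val → ∀ P W,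
      I.IsPath (I.edgesWithout i f) (I.blueEnds f).1 (I.blueEnds f).2 P W →
      (I.cycleIneq f i P).Satisfied x) : I.Feasible x := by
  intro a ha
  cases ha with
  | forest i 𝒞 h𝒞 => exact hf i 𝒞 h𝒞
  | cycle f i hi P W hP =>
    convert hc f i hi P W hP using 1
    ext i' e
    · simp only [cycleIneq]
    · rfl
  | mono e i j hij =>
    convert hm i e using 1
    ext i' e'
    · have : i' = j ↔ i'.val = i.val + 1 := by rw [Fin.ext_iff, hij]
      simp only [monoIneq, this]
    · rfl
  | nonneg e i hi =>
    convert hm i e using 1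
    ext i' e'
    · have : ¬ i'.val = i.val + 1 := by omega
      simp only [monoIneq, this, false_and, if_false, zero_sub]
      split_ifs <;> rfl
    · rfl

/-- The order of the stages matters: the forest stage needs the non-negativity of the point, and the
cycle stage also needs `Query.num_le_den`, which rests on the forest inequalities of the first
level. -/
theorem separate_spec {q : Query} {m : ℕ} {V : ℤ} (hB : Bounds q m V)
    (hm : 4 + 4 * q.inst.r + 2 * q.inst.b ≤ m) {σ : Memory} (h : Input q σ) :
    wp m separate (Ok q (q.inst.Feasible q.x)) σ := by
  refine wp_then (prepare_spec hB hm h) ?_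
  rintro τ₁ _ _ ⟨h₁, hO₁⟩
  refine wp_then (monoStage_spec hB h₁ hO₁) fun τ₂ _ hF₂ hO₂ => ?_
  have h₂ : Base q τ₂ := h₁.frame hF₂ (by decide)
  refine wp_then (forestStage_spec hB h₂ hO₂ fun h => Query.num_nonneg h.2) fun τ₃ _ hF₃ hO₃ => ?_
  have h₃ : Base q τ₃ := h₂.frame hF₃ (by decide)
  refine wp_mono (cycleStage_spec hB h₃ hO₃ fun h h0 =>
    Query.num_le_den h0 (Query.num_nonneg h.1.2) (h.2 _)) fun τ₄ _ _ hO₄ => hO₄.mono ?_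
  rintro ⟨⟨⟨_, h1⟩, h2⟩, h3⟩
  exact Instance.feasible_of_satisfied h1 h2 h3

end StackMST

theorem mainTheorem7 :
    StackMST.SolvableInPolyTime StackMST.Query.encode StackMST.Query.encodeAnswer
      StackMST.Query.Correct := by
  -- The cost polynomial is taken in the variable `m`, and the bound `m = L ^ 2 + 5 * L + 5` is
  -- substituted. As `L ≤ m`, the initial memory respects it.
  refine ⟨StackMST.separate, StackMST.separate.costPoly.comp
    (Polynomial.X ^ 2 + 5 * Polynomial.X + 5), fun q => ?_⟩
  set L := StackMST.encodingLength q.encode with hL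
  have hm : 4 + 4 * q.inst.r + 2 * q.inst.b ≤ L ^ 2 + 5 * L + 5 := by
    have h1 := StackMST.length_le_encodingLength q.encode
    rw [q.length_encode] at h1
    have : L ≤ 5 * L := by omega
    omega
  obtain ⟨t, τ, hexec, ht, -, hO⟩ := StackMST.separate_spec (q.bounds hL.symm) hm
    (StackMST.input_initialMemory q) (StackMST.initialMemory_bdd (by omega))
  have ht' : t ≤ (StackMST.separate.costPoly.comp
      (Polynomial.X ^ 2 + 5 * Polynomial.X + 5)).eval L := by
    simpa using ht
  rcases hO with ⟨h1, h2⟩ | ⟨a, h1, h2⟩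
  · exact ⟨none, t, τ, hexec, ht', h1, h2⟩
  · exact ⟨some a, t, τ, hexec, ht', h2, h1⟩
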